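/- Let $(M,g)$ be a smooth orientable two-dimensional Riemannian manifold (without boundary, Hausdorff and second countable) and $S^1=\mathbb{R}/\mathbb{Z}$. For $k\ge 2$ let $\mathcal{E}^k(M)$ be the set of embedded loops $v\colon S^1\to M$ of class $W^{k,2}$ (injective immersions), let $\mathcal{D}^k$ be the group of diffeomorphisms of $S^1$ of class $W^{k,2}$, acting by $v\mapsto v\circ\psi$, and let $E^k(M)=\mathcal{E}^k(M)/\mathcal{D}^k$. The space $E(M)=E^2(M)$ carries the sc-structure with levels $E(M)_k=E^{k+2}(M)$, $k\ge 0$. Its charts are the maps $\tau\mapsto[u_\tau]$, $u_\tau(t)=\sigma(t,\tau(t))$, where $\sigma\colon S^1\times(-\varepsilon,\varepsilon)\to M$ is a smooth embedding and $\tau$ ranges over the open set $U_\varepsilon=\{\tau\in W^{2,2}(S^1,\mathbb{R}) : \sup|\tau|<\varepsilon\}$ of the sc-Banach space $W^{2,2}(S^1,\mathbb{R})$ with levels $W^{k+2,2}(S^1,\mathbb{R})$. Let $L([v])=\int_{S^1}\|v'(t)\|_g\,dt$, which does not depend on the representative $v$. Then the following hold. 1. For each such $\sigma$ and each $\tau\in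 U_\varepsilon$ the loop $u_\tau$ lies in $\mathcal{E}^2(M)$, and the charts cover $E(M)$. 2. The length functional $L\colon E(M)\to\mathbb{R}$ is sc-smooth, that is, in each of these charts it is of class $sc^k$ for every $k$. 3. Let $\tau\in U_\varepsilon\cap W^{3,2}(S^1,\mathbb{R})$ be a point of a chart. Then $\tau \mapsto L([u_\tau])$ has at $\tau$ an sc-differential $DL$, a bounded linear functional on $W^{2,2}(S^1,\mathbb{R})$. For $\psi\in\mathcal{D}^2$ and $h\in W^{2,2}(S^1,\mathbb{R})$ put $v=u_\tau\circ\psi$ and $V(t)=\partial_s\sigma\big(\psi(t),\tau(\psi(t))\big)\,h(\psi(t))$, the vector field along $v$ that represents the tangent vector $h$. With the Levi-Civita covariant derivative $\nabla_t$ along $v$, $$DL(h)=\int_{S^1}\frac{1}{\|v'(t)\|_g}\,g\big(v'(t),\nabla_tV(t)\big)\,dt .$$ There is a $\psi\in\mathcal{D}^2$ for which $v$ has constant speed, and for every such $\psi$ $$DL(h)=-\int_{S^1}\frac{1}{\|v'(t)\|_g}\,g\big(\nabla_tv'(t),V(t)\big)\,dt .$$ 4. A point $x\in E(M)$ is a critical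 point of $L$ (that is, $x\in E(M)_1=E^3(M)$ and the sc-differential of $L$ at $x$ vanishes) if and only if $x$ is an embedded geodesic, that is, $x=[v]$ for a smooth embedded loop $v$ with $\nabla_tv'=0$. -/

import Mathlib

open scoped Manifold ContDiff
open MeasureTheory Set

noncomputable section

namespace LengthFunctional

/-- The circle `ℝ / ℤ`. -/
abbrev S1 : Type := AddCircle (1 : ℝ)

/-- The model plane. -/
abbrev Plane : Type := EuclideanSpace ℝ (Fin 2)

/-! ### Scales of normed spaces and sc-smoothness -/

/-- A nested sequence `X 0 ⊇ X 1 ⊇ X 2 ⊇ …` of normed spaces with continuous injective inclusions.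
This is all the data that enters the definition of the classes `sc^k` (the compactness and density
of the inclusions of an sc-Banach space do not); it is used for the scales `W^{k+2,2}(S¹, ℝ)` and
`ℝ`, and for their tangent scales. -/
structure ScScale where
  X : ℕ → Type
  [grp : ∀ m, NormedAddCommGroup (X m)]
  [nsp : ∀ m, NormedSpace ℝ (X m)]
  incl : ∀ m, X (m + 1) →L[ℝ] X m
  incl_injective : ∀ m, Function.Injective (incl m)

attribute [instance] ScScale.grp ScScale.nsp

namespace ScScale

/-- The inclusion of level `m` into level `0`. -/
def toZero (E : ScScale) : ∀ m, E.X m →L[ℝ] E.X 0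
  | 0 => ContinuousLinearMap.id ℝ (E.X 0)
  | m + 1 => (E.toZero m).comp (E.incl m)

/-- The constant scale on `ℝ`. -/
abbrev real : ScScale where
  X := fun _ => ℝ
  incl := fun _ => ContinuousLinearMap.id ℝ ℝ
  incl_injective := fun _ => Function.injective_id

/-- The tangent scale `T E`, with levels `(T E)_m = E_{m+1} ⊕ E_m`. -/
abbrev tangent (E : ScScale) : ScScale where
  X := fun m => E.X (m + 1) × E.X m
  incl := fun m => (E.incl (m + 1)).prodMap (E.incl m)
  incl_injective := fun m => (E.incl_injective (m + 1)).prodMap (E.incl_injective m)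

/-- `f : U → F` is `sc^0`: for every `m` it restricts to a continuous map from
`U_m = U ∩ E_m` (with the topology of `E_m`) to `F_m`. -/
def IsSc0 (E F : ScScale) (f : E.X 0 → F.X 0) (U : Set (E.X 0)) : Prop :=
  ∀ m, ∃ fm : E.X m → F.X m,
    ContinuousOn fm {x | E.toZero m x ∈ U} ∧
      ∀ x, E.toZero m x ∈ U → F.toZero m (fm x) = f (E.toZero m x)

/-- `D : E_0 → F_0` is the sc-differential of `f` at the point `x` of level `1`:
`‖f (x + h) - f x - D h‖_0 / ‖h‖_1 → 0` as `h → 0` in `E_1`. -/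
def HasScDifferentialAt (E F : ScScale) (f : E.X 0 → F.X 0) (D : E.X 0 →L[ℝ] F.X 0)
    (x : E.X 1) : Prop :=
  HasFDerivAt (fun y : E.X 1 => f (E.incl 0 y)) (D.comp (E.incl 0)) x

/-- `f : U → F` is of class `sc^k`: it is `sc^0` and, if `k ≥ 1`, it has an sc-differential at every
point of `U_1`, and the tangent map `T f : T U = U_1 ⊕ E_0 → T F`, `(x, h) ↦ (f x, D f (x) h)`
is of class `sc^(k-1)`. -/
def IsScClass : ℕ → ∀ E F : ScScale, (E.X 0 → F.X 0) → Set (E.X 0) → Prop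
  | 0, E, F, f, U => IsSc0 E F f U
  | k + 1, E, F, f, U =>
    IsSc0 E F f U ∧
      ∃ (f₁ : E.X 1 → F.X 1) (Df : E.X 1 → E.X 0 →L[ℝ] F.X 0),
        (∀ x, E.incl 0 x ∈ U →
          F.incl 0 (f₁ x) = f (E.incl 0 x) ∧ HasScDifferentialAt E F f (Df x) x) ∧
        IsScClass k E.tangent F.tangent (fun p => (f₁ p.1, Df p.1 p.2)) {p | E.incl 0 p.1 ∈ U}

/-- `f : U → F` is sc-smooth (`U` is an open subset of `E_0`). -/
def IsScSmoothOn (E F : ScScale) (f : E.X 0 → F.X 0) (U : Set (E.X 0)) : Prop :=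
  ∀ k, IsScClass k E F f U

end ScScale

/-! ### The Sobolev spaces `W^{k,2}(S¹, ℝ)` -/

/-- `w` is the weak derivative of `u` on the circle. -/
def IsWeakDerivCircle (u w : S1 → ℝ) : Prop :=
  ∀ φ : ℝ → ℝ, ContDiff ℝ ∞ φ → Function.Periodic φ 1 →
    ∫ t in (0 : ℝ)..1, deriv φ t * u t = -∫ t in (0 : ℝ)..1, φ t * w t

/-- The space of `(k+1)`-tuples in `L²(S¹)`, with the Hilbert norm. -/
abbrev L2Tuple (k : ℕ) : Type :=
  PiLp 2 (fun _ : Fin (k + 1) => Lp ℝ 2 (volume : Measure S1))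

theorem intervalIntegrable_mul {φ : ℝ → ℝ} (hφ : Continuous φ)
    (u : Lp ℝ 2 (volume : Measure S1)) :
    IntervalIntegrable (fun t : ℝ => φ t * u (t : S1)) volume 0 1 := by
  have h1 : MemLp (fun t : ℝ => u (t : S1)) 2 (volume.restrict (Ioc (0 : ℝ) (0 + 1))) :=
    (Lp.memLp u).comp_measurePreserving (AddCircle.measurePreserving_mk (1 : ℝ) 0)
  have h2 : IntervalIntegrable (fun t : ℝ => u (t : S1)) volume 0 1 := by
    rw [intervalIntegrable_iff_integrableOn_Ioc_of_le zero_le_one]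
    rw [zero_add] at h1
    exact h1.integrable (by norm_num)
  exact h2.continuousOn_mul hφ.continuousOn

theorem ae_lift {p : S1 → Prop} (h : ∀ᵐ x ∂(volume : Measure S1), p x) :
    ∀ᵐ t ∂(volume : Measure ℝ), t ∈ Set.uIoc (0 : ℝ) 1 → p (t : S1) := by
  have := (AddCircle.measurePreserving_mk (1 : ℝ) 0).quasiMeasurePreserving.ae h
  rw [zero_add, ae_restrict_iff' measurableSet_Ioc] at this
  rwa [Set.uIoc_of_le zero_le_one]

/-- An `L²` function on the circle that is orthogonal to all smooth functions vanishes. -/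
theorem eq_of_integral_eq (u w : Lp ℝ 2 (volume : Measure S1))
    (h : ∀ φ : ℝ → ℝ, ContDiff ℝ ∞ φ → Function.Periodic φ 1 →
      ∫ t in (0 : ℝ)..1, φ t * u t = ∫ t in (0 : ℝ)..1, φ t * w t) : u = w := by
  have hvol : (volume : Measure S1) = AddCircle.haarAddCircle := by
    rw [AddCircle.volume_eq_smul_haarAddCircle]; simp
  set d : S1 → ℂ := fun x => ((u x - w x : ℝ) : ℂ) with hd
  have hmem : MemLp d 2 (AddCircle.haarAddCircle : Measure S1) := by
    rw [← hvol]
    exact ((Lp.memLp u).sub (Lp.memLp w)).ofReal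
  have hint : ∀ ψ : ℝ → ℝ, Continuous ψ →
      IntervalIntegrable (fun t : ℝ => ψ t * (u (t : S1) - w (t : S1))) volume 0 1 := by
    intro ψ hψ
    have := (intervalIntegrable_mul hψ u).sub (intervalIntegrable_mul hψ w)
    refine this.congr (fun t _ => ?_)
    simp only [mul_sub]
  have hzero : ∀ ψ : ℝ → ℝ, ContDiff ℝ ∞ ψ → Function.Periodic ψ 1 →
      ∫ t in (0 : ℝ)..1, ψ t * (u (t : S1) - w (t : S1)) = 0 := by
    intro ψ hψ hper
    simp only [mul_sub]
    rw [intervalIntegral.integral_sub (intervalIntegrable_mul hψ.continuous u)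
      (intervalIntegrable_mul hψ.continuous w), h ψ hψ hper, sub_self]
  have hcoeff : ∀ n : ℤ, fourierCoeff d n = 0 := by
    intro n
    rw [fourierCoeff_eq_intervalIntegral d n 0]
    have hc : ContDiff ℝ ∞ (fun t : ℝ => Real.cos (2 * Real.pi * n * t)) := by fun_prop
    have hs : ContDiff ℝ ∞ (fun t : ℝ => Real.sin (2 * Real.pi * n * t)) := by fun_prop
    have hcp : Function.Periodic (fun t : ℝ => Real.cos (2 * Real.pi * n * t)) 1 := by
      intro t
      refine Eq.trans ?_ (Real.cos_add_int_mul_two_pi (2 * Real.pi * n * t) n)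
      simp only []
      congr 1; ring
    have hsp : Function.Periodic (fun t : ℝ => Real.sin (2 * Real.pi * n * t)) 1 := by
      intro t
      refine Eq.trans ?_ (Real.sin_add_int_mul_two_pi (2 * Real.pi * n * t) n)
      simp only []
      congr 1; ring
    have e : ∀ t : ℝ, fourier (-n) (t : S1) • d t =
        ((Real.cos (2 * Real.pi * n * t) * (u (t : S1) - w (t : S1)) : ℝ) : ℂ) -
          ((Real.sin (2 * Real.pi * n * t) * (u (t : S1) - w (t : S1)) : ℝ) : ℂ) *
            Complex.I := by
      intro t
      rw [fourier_coe_apply]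
      have : (2 * (Real.pi : ℂ) * Complex.I * ((-n : ℤ) : ℂ) * (t : ℂ) / ((1 : ℝ) : ℂ)) =
          ((-(2 * Real.pi * n * t) : ℝ) : ℂ) * Complex.I := by
        push_cast; ring
      rw [this, Complex.exp_mul_I, ← Complex.ofReal_cos, ← Complex.ofReal_sin, Real.cos_neg,
        Real.sin_neg, hd]
      simp only [smul_eq_mul]
      push_cast
      ring
    have i1 := hint _ hc.continuous
    have i2 := hint _ hs.continuous
    have j1 : IntervalIntegrable (fun t : ℝ => ((Real.cos (2 * Real.pi * n * t) *
        (u (t : S1) - w (t : S1)) : ℝ) : ℂ)) volume 0 1 := ⟨i1.1.ofReal, i1.2.ofReal⟩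
    have j2 : IntervalIntegrable (fun t : ℝ => ((Real.sin (2 * Real.pi * n * t) *
        (u (t : S1) - w (t : S1)) : ℝ) : ℂ)) volume 0 1 := ⟨i2.1.ofReal, i2.2.ofReal⟩
    simp only [zero_add, e]
    rw [intervalIntegral.integral_sub j1 (j2.mul_const _),
      intervalIntegral.integral_mul_const, intervalIntegral.integral_ofReal,
      intervalIntegral.integral_ofReal, hzero _ hc hcp, hzero _ hs hsp]
    simp
  have h1 : hmem.toLp d = 0 := by
    apply fourierBasis.repr.injective
    ext n
    rw [fourierBasis_repr, fourierCoeff_congr_ae hmem.coeFn_toLp, hcoeff n]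
    simp
  have h2 : d =ᵐ[volume] 0 := by
    rw [hvol]
    exact hmem.coeFn_toLp.symm.trans (by rw [h1]; exact Lp.coeFn_zero ℂ 2 _)
  apply Lp.ext
  filter_upwards [h2] with x hx
  have : u x - w x = 0 := Complex.ofReal_eq_zero.1 hx
  linarith

/-- `W^{k,2}(S¹, ℝ)` as a space of pairs `(f, w)`: a continuous function `f` with its weak
derivatives `w 0 = f, w 1, …, w k`, all in `L²(S¹)`. Here `k ≥ 1`, so that each element of
`W^{k,2}(S¹, ℝ)` has exactly one continuous representative. -/
def sobSubmodule (k : ℕ) : Submodule ℝ (C(S1, ℝ) × L2Tuple k) where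
  carrier := {p | (⇑p.1 =ᵐ[volume] ⇑(p.2 0)) ∧
    ∀ j : Fin k, IsWeakDerivCircle (p.2 j.castSucc) (p.2 j.succ)}
  zero_mem' := by
    refine ⟨(Lp.coeFn_zero ℝ 2 (volume : Measure S1)).symm, fun j φ hφ hp => ?_⟩
    have h0 := ae_lift (Lp.coeFn_zero ℝ 2 (volume : Measure S1))
    have key : ∀ ψ : ℝ → ℝ, ∫ t in (0 : ℝ)..1,
        ψ t * (0 : Lp ℝ 2 (volume : Measure S1)) (t : S1) = 0 := by
      intro ψ
      rw [intervalIntegral.integral_congr_ae (g := fun _ => (0 : ℝ))]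
      · simp
      · filter_upwards [h0] with t ht hI
        rw [ht hI]; simp
    have h1 := key (deriv φ)
    have h2 := key φ
    change ∫ t in (0 : ℝ)..1, deriv φ t * (0 : Lp ℝ 2 (volume : Measure S1)) (t : S1) =
      -∫ t in (0 : ℝ)..1, φ t * (0 : Lp ℝ 2 (volume : Measure S1)) (t : S1)
    rw [h1, h2, neg_zero]
  add_mem' := by
    rintro p q ⟨hp0, hp⟩ ⟨hq0, hq⟩
    refine ⟨?_, fun j φ hφ hper => ?_⟩
    · refine Filter.EventuallyEq.trans ?_ (Lp.coeFn_add (p.2 0) (q.2 0)).symm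
      exact hp0.add hq0
    · have key : ∀ ψ : ℝ → ℝ, Continuous ψ → ∀ u w : Lp ℝ 2 (volume : Measure S1),
          ∫ t in (0 : ℝ)..1, ψ t * (u + w) (t : S1) =
            (∫ t in (0 : ℝ)..1, ψ t * u (t : S1)) + ∫ t in (0 : ℝ)..1, ψ t * w (t : S1) := by
        intro ψ hψ u w
        rw [← intervalIntegral.integral_add (intervalIntegrable_mul hψ u)
          (intervalIntegrable_mul hψ w)]
        apply intervalIntegral.integral_congr_ae
        filter_upwards [ae_lift (Lp.coeFn_add u w)] with t ht hI
        rw [ht hI, Pi.add_apply, mul_add]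
      have hd : Continuous (deriv φ) := hφ.continuous_deriv (by simp)
      have e1 := key (deriv φ) hd (p.2 j.castSucc) (q.2 j.castSucc)
      have e2 := key φ hφ.continuous (p.2 j.succ) (q.2 j.succ)
      have e3 := hp j φ hφ hper
      have e4 := hq j φ hφ hper
      refine e1.trans (Eq.trans ?_ (congrArg Neg.neg e2).symm)
      linarith
  smul_mem' := by
    rintro c p ⟨hp0, hp⟩
    refine ⟨?_, fun j φ hφ hper => ?_⟩
    · refine Filter.EventuallyEq.trans ?_ (Lp.coeFn_smul c (p.2 0)).symm
      exact hp0.const_smul c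
    · have key : ∀ (ψ : ℝ → ℝ) (u : Lp ℝ 2 (volume : Measure S1)),
          ∫ t in (0 : ℝ)..1, ψ t * (c • u) (t : S1) =
            c * ∫ t in (0 : ℝ)..1, ψ t * u (t : S1) := by
        intro ψ u
        rw [← intervalIntegral.integral_const_mul]
        apply intervalIntegral.integral_congr_ae
        filter_upwards [ae_lift (Lp.coeFn_smul c u)] with t ht hI
        rw [ht hI, Pi.smul_apply, smul_eq_mul]; ring
      have e1 := key (deriv φ) (p.2 j.castSucc)
      have e2 := key φ (p.2 j.succ)
      have e3 := hp j φ hφ hper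
      refine e1.trans (Eq.trans ?_ (congrArg Neg.neg e2).symm)
      rw [e3]; ring

/-- `W^{k,2}(S¹, ℝ)`, for `k ≥ 1`. -/
def Sob (k : ℕ) : Type := sobSubmodule k

namespace Sob

variable {k : ℕ}

instance : AddCommGroup (Sob k) := inferInstanceAs (AddCommGroup (sobSubmodule k))
instance : Module ℝ (Sob k) := inferInstanceAs (Module ℝ (sobSubmodule k))

/-- The continuous function underlying an element of `W^{k,2}(S¹, ℝ)`. -/
def fn (τ : Sob k) : C(S1, ℝ) := τ.1.1

instance : CoeFun (Sob k) (fun _ => S1 → ℝ) := ⟨fun τ => ⇑τ.fn⟩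

/-- The tuple of weak derivatives. -/
def jet : Sob k →ₗ[ℝ] L2Tuple k :=
  (LinearMap.snd ℝ (C(S1, ℝ)) (L2Tuple k)).comp (sobSubmodule k).subtype

theorem jet_injective : Function.Injective (jet (k := k)) := by
  rintro ⟨⟨f, w⟩, hf, hw⟩ ⟨⟨f', w'⟩, hf', hw'⟩ h
  have hww : w = w' := h
  subst hww
  have h1 : (⇑f : S1 → ℝ) =ᵐ[volume] ⇑f' := hf.trans hf'.symm
  have h2 : (⇑f : S1 → ℝ) = ⇑f' :=
    (Continuous.ae_eq_iff_eq volume f.continuous f'.continuous).1 h1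
  have h3 : f = f' := DFunLike.coe_injective h2
  subst h3
  rfl

/-- The Sobolev norm `‖τ‖² = ∑_{j ≤ k} ‖τ^{(j)}‖²_{L²}`. -/
instance : NormedAddCommGroup (Sob k) :=
  NormedAddCommGroup.induced (Sob k) (L2Tuple k) jet jet_injective

instance : NormedSpace ℝ (Sob k) := NormedSpace.induced ℝ (Sob k) (L2Tuple k) jet

/-- The inclusion `W^{k+1,2}(S¹, ℝ) → W^{k,2}(S¹, ℝ)` as a linear map. -/
def inclₗ (k : ℕ) : Sob (k + 1) →ₗ[ℝ] Sob k where
  toFun τ := ⟨(τ.1.1, WithLp.toLp 2 (fun j => τ.1.2 j.castSucc)),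
    τ.2.1, fun j => τ.2.2 j.castSucc⟩
  map_add' _ _ := rfl
  map_smul' _ _ := rfl

theorem norm_inclₗ_le (τ : Sob (k + 1)) : ‖inclₗ k τ‖ ≤ 1 * ‖τ‖ := by
  rw [one_mul]
  change ‖jet (inclₗ k τ)‖ ≤ ‖jet τ‖
  rw [PiLp.norm_eq_of_L2, PiLp.norm_eq_of_L2]
  apply Real.sqrt_le_sqrt
  rw [Fin.sum_univ_castSucc (n := k + 1)]
  exact le_add_of_nonneg_right (sq_nonneg _)

/-- The inclusion `W^{k+1,2}(S¹, ℝ) → W^{k,2}(S¹, ℝ)`. -/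
def incl (k : ℕ) : Sob (k + 1) →L[ℝ] Sob k :=
  (inclₗ k).mkContinuous 1 norm_inclₗ_le

theorem incl_injective (k : ℕ) : Function.Injective (incl k) := by
  intro τ τ' h
  have h2 : ∀ j : Fin (k + 1), τ.1.2 j.castSucc = τ'.1.2 j.castSucc := fun j =>
    congrArg (fun σ : Sob k => σ.1.2 j) h
  apply jet_injective
  change τ.1.2 = τ'.1.2
  ext1 j
  refine Fin.lastCases ?_ h2 j
  apply eq_of_integral_eq
  intro φ hφ hper
  have e1 := τ.2.2 (Fin.last k) φ hφ hper
  have e2 := τ'.2.2 (Fin.last k) φ hφ hper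
  rw [h2 (Fin.last k)] at e1
  have e3 := neg_injective (e1.symm.trans e2)
  exact e3

end Sob

/-- The sc-structure `W^{k+2,2}(S¹, ℝ)`, `k = 0, 1, 2, …`, of `W^{2,2}(S¹, ℝ)`. -/
abbrev sobScale : ScScale where
  X := fun m => Sob (m + 2)
  incl := fun m => Sob.incl (m + 2)
  incl_injective := fun m => Sob.incl_injective (m + 2)

/-! ### Loops of class `W^{k,2}` and embedded loops -/

/-- The function `c` has weak derivatives up to order `k` on `(a, b)`, and these are in `L²`. -/
def IsSobolevOn {F : Type*} [NormedAddCommGroup F] [NormedSpace ℝ F] (k : ℕ) (c : ℝ → F)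
    (a b : ℝ) : Prop :=
  ∃ w : ℕ → ℝ → F, w 0 = c ∧
    (∀ j ≤ k, MemLp (w j) 2 (volume.restrict (Ioo a b))) ∧
    ∀ j < k, ∀ φ : ℝ → ℝ, ContDiff ℝ ∞ φ → HasCompactSupport φ → tsupport φ ⊆ Ioo a b →
      ∫ t in Ioo a b, deriv φ t • w j t = -∫ t in Ioo a b, φ t • w (j + 1) t

/-- `ψ ∈ 𝓓^k`: the homeomorphism `ψ` of the circle is a diffeomorphism of class `W^{k,2}`
(for `k ≥ 2`; then `ψ` is continuously differentiable). -/
def IsReparam (k : ℕ) (ψ : S1 ≃ₜ S1) : Prop :=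
  ∃ Ψ : ℝ → ℝ, Continuous Ψ ∧ (∀ t : ℝ, ((Ψ t : ℝ) : S1) = ψ (t : S1)) ∧
    (∀ a b : ℝ, IsSobolevOn k Ψ a b) ∧ ∀ t, deriv Ψ t ≠ 0

section Loops

variable {M : Type*} [TopologicalSpace M] [ChartedSpace Plane M]

/-- `v ∈ W^{k,2}(S¹, M)`, for `k ≥ 1`: `v` is continuous and of class `W^{k,2}` in charts. -/
def IsSobolevLoop (k : ℕ) (v : S1 → M) : Prop :=
  Continuous v ∧ ∀ t₀ : ℝ, ∃ δ > 0,
    (∀ t ∈ Ioo (t₀ - δ) (t₀ + δ), v (t : S1) ∈ (chartAt Plane (v (t₀ : S1))).source) ∧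
    IsSobolevOn k (fun t : ℝ => extChartAt (𝓡 2) (v (t₀ : S1)) (v (t : S1))) (t₀ - δ) (t₀ + δ)

/-- The velocity `v'(t)` of a loop. -/
def velocity (v : S1 → M) (t : ℝ) : TangentSpace (𝓡 2) (v (t : S1)) :=
  mfderiv 𝓘(ℝ, ℝ) (𝓡 2) (fun s : ℝ => v (s : S1)) t (1 : ℝ)

/-- `v ∈ 𝓔^k(M)`, for `k ≥ 2`: `v` is a loop of class `W^{k,2}` which is an injective immersion,
that is, an embedding (the circle is compact). -/
def IsEmbeddedLoop (k : ℕ) (v : S1 → M) : Prop :=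
  IsSobolevLoop k v ∧ Function.Injective v ∧ ∀ t, velocity v t ≠ 0

variable (M) in
/-- The space `𝓔(M) = 𝓔^2(M)` of parametrized embedded loops. -/
def EmbeddedLoop : Type _ := {v : S1 → M // IsEmbeddedLoop 2 v}

variable (M) in
/-- The space `E(M) = 𝓔^2(M) / 𝓓^2` of unparametrized embedded loops. -/
def UnparamLoop : Type _ :=
  Quot (fun v w : EmbeddedLoop M => ∃ ψ : S1 ≃ₜ S1, IsReparam 2 ψ ∧ w.1 = v.1 ∘ ψ)

/-- The unparametrized loop `[v]`. -/
def UnparamLoop.mk (v : S1 → M) (hv : IsEmbeddedLoop 2 v) : UnparamLoop M := Quot.mk _ ⟨v, hv⟩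

/-- `v` is a parametrization of `x`, that is, `x = [v]`. -/
def UnparamLoop.IsParamBy (x : UnparamLoop M) (v : S1 → M) : Prop :=
  ∃ hv : IsEmbeddedLoop 2 v, UnparamLoop.mk v hv = x

/-- The subset `E^{m+2}(M)` of `E(M)`, the level `m` of its sc-structure. -/
def UnparamLoop.level (M : Type*) [TopologicalSpace M] [ChartedSpace Plane M] (m : ℕ) :
    Set (UnparamLoop M) :=
  {x | ∃ v : S1 → M, IsEmbeddedLoop (m + 2) v ∧ x.IsParamBy v}

end Loops

/-! ### Riemannian surfaces -/

variable {M : Type*} [TopologicalSpace M] [ChartedSpace Plane M] [IsManifold (𝓡 2) ∞ M]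

/-- The smooth surface `M` is orientable: it is covered by smooth charts all of whose transition
maps have positive Jacobian determinant. -/
def IsOrientableSurface (M : Type*) [TopologicalSpace M] [ChartedSpace Plane M] : Prop :=
  ∃ A ⊆ IsManifold.maximalAtlas (𝓡 2) ∞ M, (∀ x : M, ∃ e ∈ A, x ∈ e.source) ∧
    ∀ e ∈ A, ∀ e' ∈ A, ∀ x ∈ e.source ∩ e'.source,
      0 < (fderiv ℝ (fun y : Plane => e' (e.symm y)) (e x)).det

variable (M) in
/-- Smooth Riemannian metrics on the surface `M`. -/
abbrev RiemMetric : Type _ :=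
  Bundle.ContMDiffRiemannianMetric (𝓡 2) ∞ Plane (fun x : M => TangentSpace (𝓡 2) x)

/-- The speed `‖v'(t)‖_g`. -/
def speed (g : RiemMetric M) (v : S1 → M) (t : ℝ) : ℝ :=
  √(g.inner (v (t : S1)) (velocity v t) (velocity v t))

/-- The length `∫_{S¹} ‖v'(t)‖_g dt`. -/
def loopLength (g : RiemMetric M) (v : S1 → M) : ℝ :=
  ∫ t in (0 : ℝ)..1, speed g v t

/-- The metric in the chart at `p`: `g_y(u, w)` for a point `y` and vectors `u`, `w` of the plane. -/
def chartMetric (g : RiemMetric M) (p : M) (y u w : Plane) : ℝ :=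
  g.inner ((extChartAt (𝓡 2) p).symm y)
    (mfderiv 𝓘(ℝ, Plane) (𝓡 2) (extChartAt (𝓡 2) p).symm y u)
    (mfderiv 𝓘(ℝ, Plane) (𝓡 2) (extChartAt (𝓡 2) p).symm y w)

/-- The Christoffel symbols of the first kind in the chart at `p`, in coordinate-free form:
`Γ(u, w; z) = ½ (∂_u g(w, z) + ∂_w g(u, z) - ∂_z g(u, w))`, for constant vectors `u`, `w`, `z`. -/
def christoffel (g : RiemMetric M) (p : M) (y u w z : Plane) : ℝ :=
  (fderiv ℝ (fun y' => chartMetric g p y' w z) y u +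
    fderiv ℝ (fun y' => chartMetric g p y' u z) y w -
    fderiv ℝ (fun y' => chartMetric g p y' u w) y z) / 2

/-- The number `g(Z, ∇_t V)`, where `∇_t V` is the covariant derivative at time `t`, for the
Levi-Civita connection of `g`, of the vector field `V` along the curve `c`, and `Z` is a tangent
vector at `c t`. It is computed in the chart at `c t`, where `∇_t V = V' + Γ(c', V)`. -/
def innerCovDeriv (g : RiemMetric M) (c : ℝ → M) (V : ∀ t, TangentSpace (𝓡 2) (c t)) (t : ℝ)
    (Z : TangentSpace (𝓡 2) (c t)) : ℝ :=
  let e := extChartAt (𝓡 2) (c t)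
  let c₁ : ℝ → Plane := fun s => e (c s)
  let V₁ : ℝ → Plane := fun s => mfderiv (𝓡 2) 𝓘(ℝ, Plane) e (c s) (V s)
  let Z₁ : Plane := mfderiv (𝓡 2) 𝓘(ℝ, Plane) e (c t) Z
  chartMetric g (c t) (c₁ t) (deriv V₁ t) Z₁ +
    christoffel g (c t) (c₁ t) (deriv c₁ t) (V₁ t) Z₁

/-- `x ∈ E(M)` is an embedded geodesic: it has a parametrization by a smooth embedded loop `v` with
`∇_t v' = 0`. -/
def IsEmbeddedGeodesic (g : RiemMetric M) (x : UnparamLoop M) : Prop :=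
  ∃ v : S1 → M, x.IsParamBy v ∧
    ContMDiff 𝓘(ℝ, ℝ) (𝓡 2) ∞ (fun t : ℝ => v (t : S1)) ∧
    ∀ (t : ℝ) (Z : TangentSpace (𝓡 2) (v (t : S1))),
      innerCovDeriv g (fun s : ℝ => v (s : S1)) (velocity v) t Z = 0

/-! ### The length functional on `E(M)` -/

/-- The speed of a curve `c : ℝ → M`. -/
def curveSpeed (g : RiemMetric M) (c : ℝ → M) (t : ℝ) : ℝ :=
  √(g.inner (c t) (mfderiv 𝓘(ℝ, ℝ) (𝓡 2) c t (1 : ℝ)) (mfderiv 𝓘(ℝ, ℝ) (𝓡 2) c t (1 : ℝ)))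

theorem curveSpeed_comp (g : RiemMetric M) {c : ℝ → M} {Ψ : ℝ → ℝ} {t : ℝ}
    (hc : MDifferentiableAt 𝓘(ℝ, ℝ) (𝓡 2) c (Ψ t)) (hΨ : DifferentiableAt ℝ Ψ t) :
    curveSpeed g (c ∘ Ψ) t = |deriv Ψ t| * curveSpeed g c (Ψ t) := by
  have h1 : mfderiv 𝓘(ℝ, ℝ) (𝓡 2) (c ∘ Ψ) t (1 : ℝ) =
      deriv Ψ t • (mfderiv 𝓘(ℝ, ℝ) (𝓡 2) c (Ψ t) (1 : ℝ)) := by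
    rw [mfderiv_comp t hc hΨ.mdifferentiableAt, mfderiv_eq_fderiv]
    have : fderiv ℝ Ψ t (1 : ℝ) = deriv Ψ t • (1 : ℝ) := by simp
    refine Eq.trans (congrArg (mfderiv 𝓘(ℝ, ℝ) (𝓡 2) c (Ψ t)) this) ?_
    exact (mfderiv 𝓘(ℝ, ℝ) (𝓡 2) c (Ψ t)).map_smul _ _
  unfold curveSpeed
  rw [h1]
  change √(g.inner (c (Ψ t)) (deriv Ψ t • (mfderiv 𝓘(ℝ, ℝ) (𝓡 2) c (Ψ t) (1 : ℝ)))
    (deriv Ψ t • (mfderiv 𝓘(ℝ, ℝ) (𝓡 2) c (Ψ t) (1 : ℝ)))) = _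
  rw [map_smul, map_smul, smul_apply, smul_smul, smul_eq_mul,
    Real.sqrt_mul (mul_self_nonneg _), Real.sqrt_mul_self_eq_abs]

theorem loopLength_comp (g : RiemMetric M) {v : S1 → M} (hv : ∀ t, velocity v t ≠ 0)
    {ψ : S1 ≃ₜ S1} {k : ℕ} (hψ : IsReparam k ψ) :
    loopLength g (v ∘ ψ) = loopLength g v := by
  obtain ⟨Ψ, hΨc, hΨ, -, hΨd⟩ := hψ
  set c : ℝ → M := fun t => v (t : S1) with hc
  have hcd : ∀ t, MDifferentiableAt 𝓘(ℝ, ℝ) (𝓡 2) c t := by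
    intro t
    by_contra hn
    apply hv t
    have h0 : mfderiv 𝓘(ℝ, ℝ) (𝓡 2) c t = 0 := mfderiv_zero_of_not_mdifferentiableAt hn
    change mfderiv 𝓘(ℝ, ℝ) (𝓡 2) c t (1 : ℝ) = 0
    rw [h0]; rfl
  have hd : ∀ t, DifferentiableAt ℝ Ψ t := fun t => differentiableAt_of_deriv_ne_zero (hΨd t)
  have hcomp : (fun t : ℝ => (v ∘ ψ) (t : S1)) = c ∘ Ψ := by
    funext t
    simp only [hc, Function.comp, hΨ]
  have hper : Function.Periodic (curveSpeed g c) 1 := by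
    intro t
    have e := curveSpeed_comp g (Ψ := fun s : ℝ => s + 1) (t := t) (hcd _) (by fun_prop)
    have e2 : c ∘ (fun s => s + 1) = c := by
      funext s
      simp only [hc, Function.comp]
      rw [AddCircle.coe_add_period]
    rw [e2] at e
    simpa using e.symm
  have hinj : InjOn Ψ (Ico (0 : ℝ) 1) := by
    intro s hs t ht hst
    have h1 : ψ (s : S1) = ψ (t : S1) := by rw [← hΨ, ← hΨ, hst]
    have h2 := ψ.injective h1
    rw [← zero_add (1 : ℝ)] at hs ht
    exact (AddCircle.coe_eq_coe_iff_of_mem_Ico hs ht).1 h2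
  have hL : loopLength g (v ∘ ψ) = ∫ t in Ico (0 : ℝ) 1, |deriv Ψ t| • curveSpeed g c (Ψ t) := by
    unfold loopLength
    rw [intervalIntegral.integral_of_le zero_le_one, ← integral_Ico_eq_integral_Ioc]
    refine integral_congr_ae (Filter.Eventually.of_forall fun t => ?_)
    change curveSpeed g (fun t : ℝ => (v ∘ ψ) (t : S1)) t = _
    rw [hcomp, curveSpeed_comp g (hcd _) (hd t)]
    rfl
  rw [hL, ← integral_image_eq_integral_abs_deriv_smul measurableSet_Ico
    (fun t _ => (hd t).hasDerivAt.hasDerivWithinAt) hinj]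
  have hR : loopLength g v = ∫ t in Ioc (0 : ℝ) (0 + 1), curveSpeed g c t := by
    unfold loopLength
    rw [intervalIntegral.integral_of_le zero_le_one, zero_add]
    rfl
  rw [hR]
  have hS : IsAddFundamentalDomain (AddSubgroup.zmultiples (1 : ℝ)) (Ψ '' Ico (0 : ℝ) 1)
      (volume : Measure ℝ) := by
    refine IsAddFundamentalDomain.mk' ?_ ?_
    · exact (measurableSet_Ico.image_of_continuousOn_injOn hΨc.continuousOn hinj).nullMeasurableSet
    · intro x
      obtain ⟨y, hy⟩ := ψ.surjective (x : S1)
      have hy' : y ∈ ((↑) : ℝ → S1) '' Ico (0 : ℝ) (0 + 1) := by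
        rw [AddCircle.coe_image_Ico_eq]; trivial
      obtain ⟨t, ht, rfl⟩ := hy'
      rw [zero_add] at ht
      rw [← hΨ, QuotientAddGroup.eq] at hy
      have hmem : Ψ t - x ∈ AddSubgroup.zmultiples (1 : ℝ) := by
        have := neg_mem hy
        rwa [show -(-Ψ t + x) = Ψ t - x by ring] at this
      refine ⟨⟨Ψ t - x, hmem⟩, ⟨t, ht, ?_⟩, ?_⟩
      · simp [AddSubgroup.vadd_def]
      · rintro ⟨a, ha⟩ ⟨s, hs, hsa⟩
        have hsa' : Ψ s = a + x := hsa
        have e1 : ((Ψ s : ℝ) : S1) = ((Ψ t : ℝ) : S1) := by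
          rw [QuotientAddGroup.eq]
          have := add_mem (neg_mem ha) hmem
          rwa [show -a + (Ψ t - x) = -Ψ s + Ψ t by rw [hsa']; ring] at this
        rw [hΨ, hΨ] at e1
        have hst : s = t := by
          have h2 := ψ.injective e1
          rw [← zero_add (1 : ℝ)] at hs ht
          exact (AddCircle.coe_eq_coe_iff_of_mem_Ico hs ht).1 h2
        subst hst
        apply Subtype.ext
        change a = Ψ s - x
        rw [hsa']; ring
  refine hS.setIntegral_eq (isAddFundamentalDomain_Ioc one_pos 0) ?_
  rintro ⟨_, n, rfl⟩ x
  have := hper.int_mul n x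
  change curveSpeed g c (n • (1 : ℝ) + x) = _
  rw [zsmul_eq_mul, add_comm]
  exact this

/-- The length functional `L : E(M) → ℝ`; it does not depend on the parametrization. -/
def UnparamLoop.length (g : RiemMetric M) : UnparamLoop M → ℝ :=
  Quot.lift (fun v => loopLength g v.1) (by
    rintro v w ⟨ψ, hψ, hw⟩
    rw [hw, loopLength_comp g v.2.2.2 hψ])

/-! ### The charts of `E(M)` -/

variable (M) in
/-- A smooth embedding `σ : S¹ × (-ε, ε) → M` of an annulus in the surface `M`. -/
structure Annulus where
  ε : ℝ
  ε_pos : 0 < ε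
  σ : S1 → ℝ → M
  smooth : ContMDiffOn 𝓘(ℝ, ℝ × ℝ) (𝓡 2) ∞ (fun p : ℝ × ℝ => σ (p.1 : S1) p.2) {p | |p.2| < ε}
  injective : ∀ x y : S1, ∀ s r : ℝ, |s| < ε → |r| < ε → σ x s = σ y r → x = y ∧ s = r
  immersive : ∀ p : ℝ × ℝ, |p.2| < ε → Function.Injective
    (mfderiv 𝓘(ℝ, ℝ × ℝ) (𝓡 2) (fun p : ℝ × ℝ => σ (p.1 : S1) p.2) p)

namespace Annulus

/-- The loop `u_τ(t) = σ(t, τ(t))`. -/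
def graph (A : Annulus M) (τ : S1 → ℝ) : S1 → M := fun x => A.σ x (τ x)

/-- The set `U_ε = {τ ∈ W^{2,2}(S¹, ℝ) : sup |τ| < ε}`, on which the chart
`τ ↦ [u_τ] ∈ E(M)` is defined. -/
def domain (A : Annulus M) : Set (sobScale.X 0) := {τ | ∀ x, |τ.fn x| < A.ε}

open Classical in
/-- A function `f` on `E(M)`, read in the chart `τ ↦ [u_τ]` (the value `0` is never taken for
`τ ∈ U_ε`, where `u_τ` is an embedded loop). -/
def inChart (A : Annulus M) (f : UnparamLoop M → ℝ) (τ : sobScale.X 0) : ℝ :=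
  if h : IsEmbeddedLoop 2 (A.graph τ.fn) then f (UnparamLoop.mk _ h) else 0

/-- The vector field `t ↦ (∂_s σ)(t, τ(t)) h(t)` along the loop `u_τ`, which the chart associates
with a tangent vector `h` at `τ`, in the parametrization `u_τ ∘ ψ`. -/
def field (A : Annulus M) (τ h : S1 → ℝ) (ψ : S1 → S1) (t : ℝ) :
    TangentSpace (𝓡 2) ((A.graph τ ∘ ψ) (t : S1)) :=
  mfderiv 𝓘(ℝ, ℝ) (𝓡 2) (A.σ (ψ t)) (τ (ψ t)) (h (ψ t))

end Annulus

variable (M) in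
/-- The charts `τ ↦ [u_τ]` are everywhere defined on their domains and cover `E(M)`. -/
def ChartsCover : Prop :=
  (∀ (A : Annulus M), ∀ τ ∈ A.domain, IsEmbeddedLoop 2 (A.graph τ.fn)) ∧
  ∀ x : UnparamLoop M, ∃ A : Annulus M, ∃ τ ∈ A.domain, x.IsParamBy (A.graph τ.fn)

/-- `f : E(M) → ℝ` is sc-smooth: it is so in all charts. -/
def IsScSmooth (f : UnparamLoop M → ℝ) : Prop :=
  ∀ A : Annulus M, ScScale.IsScSmoothOn sobScale ScScale.real (A.inChart f) A.domain

/-- `x` is a critical point of `f : E(M) → ℝ`: it lies in the level `1`, where sc-differentials are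
defined, and the sc-differential of `f` at `x`, in charts at `x`, vanishes. -/
def IsCriticalPoint (f : UnparamLoop M → ℝ) (x : UnparamLoop M) : Prop :=
  x ∈ UnparamLoop.level M 1 ∧
    ∀ (A : Annulus M) (τ : sobScale.X 1), sobScale.incl 0 τ ∈ A.domain →
      x.IsParamBy (A.graph τ.fn) →
        ScScale.HasScDifferentialAt sobScale ScScale.real (A.inChart f) 0 τ

end LengthFunctional

end

open LengthFunctional

noncomputable section
namespace LengthFunctional

open Filter Topology

/-! ### Absolutely continuous functions with square integrable derivative -/

/-! Smoothness of the length. In a chart the length is the integral of F(t, τ(t), τ'(t)), where F(x,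
s, p) is the g-norm of dσ(1, p). The component 1 keeps this vector away from zero, so F is smooth
(`contDiffOn_lagr`). On W^{2,2} the evaluations of τ and τ' at t are bounded functionals that depend
on t continuously in operator norm. Differentiation under the integral can therefore be repeated
forever, and the length is smooth in the ordinary Fréchet sense on level 0
(`contDiffOn_integral_comp`); this is stronger than sc-smoothness (`isScClass_of_contDiffOn`).

First variation. The derivative of F in the direction of a field V is g(T, ∇V), with T the unit
tangent (`fderiv_lagr`). Metric compatibility and periodicity turn its integral into minus that of
g(∇T, V) (`hasDerivAt_inner`, `integral_firstVariation`). All this takes place in the coordinates of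
σ; the transformation law of the Christoffel symbols (`gammaForm_pullback`, `innerCovDeriv_eq`)
connects it with the covariant derivative defined in the charts of M. A reparametrization Ψ
multiplies the integrands by |Ψ'|, which the change of variables `IsDiffLift.integral_comp` absorbs.

Critical points. If the variation vanishes on all W^{3,2} functions, then ∇T is zero in the
direction ∂_sσ by the fundamental lemma, and zero along T because |T| = 1. The constant speed
parametrization then solves the geodesic equation in the coordinates of σ and is smooth by
bootstrapping. Conversely, a geodesic has constant speed, and the second variation formula gives a
zero differential in every chart.

Covering by charts. A loop v is only of class W^{2,2}, whereas σ must be smooth. Near v one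
constructs a smooth map Z to the unit circle that restricts to a degree one diffeomorphism along v
(`IsEmbeddedLoop.nonempty_angleMap`), and a smooth function ρ whose differential is nonzero on the
kernel of dZ along v (`AngleMap.exists_transverse`); orientability is what prevents the local
choices of ρ from cancelling. The map exp(ρ) Z is a local diffeomorphism and injective on v, hence
invertible near v (`exists_inverse_nhdsSet`). In polar coordinates v is the graph of a function r on
the circle. The annulus is centred at a smooth approximation τ₀ of r, and v becomes the graph of r -
τ₀ (`exists_annulus`). -/

theorem _root_.AbsolutelyContinuousOnInterval.congr {f g : ℝ → ℝ} {a b : ℝ}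
    (hf : AbsolutelyContinuousOnInterval f a b) (h : EqOn f g (uIcc a b)) :
    AbsolutelyContinuousOnInterval g a b := by
  rw [absolutelyContinuousOnInterval_iff] at hf ⊢
  intro ε hε
  obtain ⟨δ, hδ, H⟩ := hf ε hε
  refine ⟨δ, hδ, fun E hE hl => lt_of_eq_of_lt (Finset.sum_congr rfl fun i hi => ?_) (H E hE hl)⟩
  rw [h (hE.1 i hi).1, h (hE.1 i hi).2]

/-- `f` is of class `W^{1,2}` on the interval `(a, b)`. -/
def W1On (f : ℝ → ℝ) (a b : ℝ) : Prop :=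
  AbsolutelyContinuousOnInterval f a b ∧ MemLp (deriv f) 2 (volume.restrict (Ioo a b))

theorem intervalIntegrable_of_memLp {w : ℝ → ℝ} {a b : ℝ} (hab : a ≤ b)
    (hw : MemLp w 2 (volume.restrict (Ioo a b))) : IntervalIntegrable w volume a b := by
  rw [intervalIntegrable_iff_integrableOn_Ioo_of_le hab]
  exact hw.integrable (by norm_num)

theorem W1On.mono {f : ℝ → ℝ} {a b c d : ℝ} (h : W1On f a b) (hac : a ≤ c) (hcd : c ≤ d)
    (hdb : d ≤ b) : W1On f c d := by
  refine ⟨h.1.mono ?_, h.2.mono_measure (Measure.restrict_mono (Ioo_subset_Ioo hac hdb) le_rfl)⟩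
  rw [uIcc_of_le hcd, uIcc_of_le (hac.trans (hcd.trans hdb))]
  exact Icc_subset_Icc hac hdb

/-- Lebesgue's differentiation theorem for primitives of integrable functions. -/
theorem deriv_ae_eq_of_integral {f w : ℝ → ℝ} {a b C : ℝ} (hab : a ≤ b)
    (hw : IntervalIntegrable w volume a b)
    (h : ∀ x ∈ Icc a b, f x = C + ∫ t in a..x, w t) :
    deriv f =ᵐ[volume.restrict (Ioo a b)] w := by
  refine (ae_restrict_iff' measurableSet_Ioo).2 ?_
  filter_upwards [hw.ae_hasDerivAt_integral] with x hx hxab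
  have h1 := hx (by rw [uIcc_of_le hab]; exact Ioo_subset_Icc_self hxab) a (by simp)
  have h2 : f =ᶠ[𝓝 x] fun x => C + ∫ t in a..x, w t := by
    filter_upwards [Icc_mem_nhds hxab.1 hxab.2] with y hy using h y hy
  exact ((h1.const_add C).congr_of_eventuallyEq h2).deriv

theorem W1On.of_integral {f w : ℝ → ℝ} {a b C : ℝ} (hab : a ≤ b)
    (hw : MemLp w 2 (volume.restrict (Ioo a b)))
    (h : ∀ x ∈ Icc a b, f x = C + ∫ t in a..x, w t) : W1On f a b := by
  have hi := intervalIntegrable_of_memLp hab hw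
  refine ⟨?_, hw.ae_eq (deriv_ae_eq_of_integral hab hi h).symm⟩
  have h1 := hi.absolutelyContinuousOnInterval_intervalIntegral (c := a) (by simp)
  have h2 : AbsolutelyContinuousOnInterval (fun _ : ℝ => C) a b :=
    contDiffOn_const.absolutelyContinuousOnInterval
  refine (h2.add h1).congr fun x hx => ?_
  rw [uIcc_of_le hab] at hx
  exact (h x hx).symm

theorem W1On.eq_integral {f : ℝ → ℝ} {a b x y : ℝ} (h : W1On f a b) (hx : x ∈ Icc a b)
    (hy : y ∈ Icc a b) : f y - f x = ∫ t in x..y, deriv f t := by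
  refine (AbsolutelyContinuousOnInterval.integral_deriv_eq_sub (h.1.mono ?_)).symm
  rw [uIcc_of_le (hx.1.trans hx.2)]
  exact uIcc_subset_Icc hx hy

/-- `f` is of class `W^{1,2}` near `t`. -/
def W1At (f : ℝ → ℝ) (t : ℝ) : Prop := ∃ δ > 0, W1On f (t - δ) (t + δ)

theorem W1On.w1At {f : ℝ → ℝ} {a b t : ℝ} (h : W1On f a b) (ht : t ∈ Ioo a b) : W1At f t := by
  refine ⟨min (t - a) (b - t), lt_min (by linarith [ht.1]) (by linarith [ht.2]), h.mono ?_ ?_ ?_⟩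
  · linarith [min_le_left (t - a) (b - t)]
  · linarith [lt_min (sub_pos.2 ht.1) (sub_pos.2 ht.2)]
  · linarith [min_le_right (t - a) (b - t)]

theorem W1At.eventually {f : ℝ → ℝ} {t : ℝ} (h : W1At f t) : ∀ᶠ s in 𝓝 t, W1At f s := by
  obtain ⟨δ, hδ, h⟩ := h
  filter_upwards [Ioo_mem_nhds (by linarith : t - δ < t) (by linarith : t < t + δ)] with s hs
  exact h.w1At hs

theorem W1At.exists_le {f : ℝ → ℝ} {t ε : ℝ} (h : W1At f t) (hε : 0 < ε) :
    ∃ δ > 0, δ ≤ ε ∧ W1On f (t - δ) (t + δ) := by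
  obtain ⟨δ, hδ, h⟩ := h
  have h1 := min_le_left δ ε
  have h3 : 0 < min δ ε := lt_min hδ hε
  exact ⟨min δ ε, h3, min_le_right _ _, h.mono (by linarith) (by linarith) (by linarith)⟩

theorem W1At.continuousAt {f : ℝ → ℝ} {t : ℝ} (h : W1At f t) : ContinuousAt f t := by
  obtain ⟨δ, hδ, h⟩ := h
  refine h.1.continuousOn.continuousAt ?_
  rw [uIcc_of_le (by linarith)]
  exact Icc_mem_nhds (by linarith) (by linarith)

theorem W1At.congr {f g : ℝ → ℝ} {t : ℝ} (h : W1At f t) (hfg : f =ᶠ[𝓝 t] g) : W1At g t := by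
  obtain ⟨ε, hε, hE⟩ := Metric.eventually_nhds_iff_ball.1 hfg
  obtain ⟨δ, hδ, hδε, h⟩ := h.exists_le (half_pos hε)
  have hsub : Icc (t - δ) (t + δ) ⊆ Metric.ball t ε := by
    intro x hx
    rw [Metric.mem_ball, Real.dist_eq, abs_lt]
    constructor <;> linarith [hx.1, hx.2]
  refine ⟨δ, hδ, h.1.congr fun x hx => ?_, h.2.ae_eq ?_⟩
  · rw [uIcc_of_le (by linarith)] at hx
    exact hE x (hsub hx)
  · refine (ae_restrict_iff' measurableSet_Ioo).2 (Eventually.of_forall fun x hx => ?_)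
    apply Filter.EventuallyEq.deriv_eq
    filter_upwards [Ioo_mem_nhds hx.1 hx.2] with y hy using hE y (hsub (Ioo_subset_Icc_self hy))

theorem memLp_Ioo_of_continuousOn {E : Type*} [NormedAddCommGroup E] {f : ℝ → E} {a b : ℝ}
    (hf : ContinuousOn f (Icc a b)) : MemLp f 2 (volume.restrict (Ioo a b)) := by
  obtain ⟨C, hC⟩ := isCompact_Icc.exists_bound_of_continuousOn hf
  refine MemLp.of_bound ((hf.mono Ioo_subset_Icc_self).aestronglyMeasurable measurableSet_Ioo) C ?_
  exact (ae_restrict_iff' measurableSet_Ioo).2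
    (Eventually.of_forall fun x hx => hC x (Ioo_subset_Icc_self hx))

theorem W1At.of_contDiffAt {f : ℝ → ℝ} {t : ℝ} (h : ContDiffAt ℝ 1 f t) : W1At f t := by
  obtain ⟨u, hu, htu, hf⟩ := h.contDiffOn' (m := 1) le_rfl (by simp)
  simp only [Set.insert_eq_of_mem (mem_univ t), univ_inter] at hf
  obtain ⟨ε, hε, hE⟩ := Metric.isOpen_iff.1 hu t htu
  have hsub : Icc (t - ε / 2) (t + ε / 2) ⊆ u := by
    intro x hx
    apply hE
    rw [Metric.mem_ball, Real.dist_eq, abs_lt]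
    constructor <;> linarith [hx.1, hx.2]
  refine ⟨ε / 2, by positivity, ContDiffOn.absolutelyContinuousOnInterval ?_, ?_⟩
  · rw [uIcc_of_le (by linarith)]
    exact hf.mono hsub
  · refine memLp_Ioo_of_continuousOn ?_
    exact ((hf.continuousOn_deriv_of_isOpen hu le_rfl)).mono hsub

/-- A `C^1` function is locally Lipschitz with some constant K, so the oscillation sums of the
composite are at most K times those of `f` and `g` together. By the chain rule, almost everywhere
its derivative is at most K(|f'| + |g'|), which is square integrable. -/
theorem W1At.comp₂ {φ : ℝ × ℝ → ℝ} {f g : ℝ → ℝ} {t : ℝ} (hφ : ContDiffAt ℝ 1 φ (f t, g t))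
    (hf : W1At f t) (hg : W1At g t) : W1At (fun s => φ (f s, g s)) t := by
  obtain ⟨K, u, hu, hK⟩ := hφ.exists_lipschitzOnWith
  have hd : ∀ᶠ p in 𝓝 (f t, g t), DifferentiableAt ℝ φ p :=
    (hφ.eventually (by simp)).mono fun p hp => hp.differentiableAt (by simp)
  have hc : ContinuousAt (fun s => (f s, g s)) t := hf.continuousAt.prodMk hg.continuousAt
  obtain ⟨ε, hε, hE⟩ := Metric.eventually_nhds_iff_ball.1
    (hc.eventually ((eventually_mem_nhds_iff.2 hu).and hd))
  obtain ⟨δ₁, h1, h1ε, hf⟩ := hf.exists_le (half_pos hε)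
  obtain ⟨δ, h2, h2δ, hg⟩ := hg.exists_le h1
  replace hf := hf.mono (c := t - δ) (d := t + δ) (by linarith) (by linarith) (by linarith)
  have hsub : Icc (t - δ) (t + δ) ⊆ Metric.ball t ε := by
    intro x hx
    rw [Metric.mem_ball, Real.dist_eq, abs_lt]
    constructor <;> linarith [hx.1, hx.2]
  have hle : t - δ ≤ t + δ := by linarith
  refine ⟨δ, h2, ?_, ?_⟩
  · have hlim := (hf.1.const_mul (K : ℝ)).add (hg.1.const_mul (K : ℝ))
    have hf' := hf.1
    have hg' := hg.1
    unfold AbsolutelyContinuousOnInterval at hf' hg' ⊢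
    have := (hf'.const_mul (K : ℝ)).add (hg'.const_mul (K : ℝ))
    rw [mul_zero, add_zero] at this
    refine squeeze_zero' (Eventually.of_forall fun E => Finset.sum_nonneg fun _ _ => dist_nonneg)
      ?_ this
    rw [eventually_inf_principal]
    refine Eventually.of_forall fun E hE' => ?_
    simp only [Finset.mul_sum, ← Finset.sum_add_distrib]
    refine Finset.sum_le_sum fun i hi => ?_
    have m1 := (hE'.1 i hi).1
    have m2 := (hE'.1 i hi).2
    rw [uIcc_of_le hle] at m1 m2
    have := hK.dist_le_mul _ (mem_of_mem_nhds (hE _ (hsub m1)).1) _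
      (mem_of_mem_nhds (hE _ (hsub m2)).1)
    refine this.trans ?_
    rw [← mul_add]
    refine mul_le_mul_of_nonneg_left ?_ K.2
    rw [Prod.dist_eq]
    exact max_le_add_of_nonneg dist_nonneg dist_nonneg
  · have hm : MemLp (fun s => (K : ℝ) * (‖deriv f s‖ + ‖deriv g s‖)) 2
        (volume.restrict (Ioo (t - δ) (t + δ))) := (hf.2.norm.add hg.2.norm).const_mul _
    refine hm.mono (stronglyMeasurable_deriv _).aestronglyMeasurable ?_
    rw [ae_restrict_iff' measurableSet_Ioo]
    filter_upwards [hf.1.ae_differentiableAt, hg.1.ae_differentiableAt] with x hx1 hx2 hx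
    have hx' := Ioo_subset_Icc_self hx
    rw [uIcc_of_le hle] at hx1 hx2
    have e := (hE x (hsub hx')).2.hasFDerivAt.comp_hasDerivAt x
      ((hx1 hx').hasDerivAt.prodMk (hx2 hx').hasDerivAt)
    have e' : deriv (fun s => φ (f s, g s)) x = _ := e.deriv
    rw [e', Real.norm_of_nonneg (by positivity : (0 : ℝ) ≤ K * (‖deriv f x‖ + ‖deriv g x‖))]
    refine (ContinuousLinearMap.le_opNorm _ _).trans ?_
    refine mul_le_mul (norm_fderiv_le_of_lipschitzOn ℝ (hE x (hsub hx')).1 hK) ?_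
      (norm_nonneg _) K.2
    rw [Prod.norm_def]
    exact max_le_add_of_nonneg (norm_nonneg _) (norm_nonneg _)

/-- A function that is of class `W^{1,2}` near every point is the integral of its derivative. -/
theorem W1On.of_forall {f : ℝ → ℝ} (h : ∀ t, W1At f t) {a b : ℝ} (hab : a ≤ b) : W1On f a b := by
  -- Square integrability passes to finite unions, so compactness of [a, b] makes the local bounds
  -- global.
  have hL : MemLp (deriv f) 2 (volume.restrict (Icc a b)) := by
    refine isCompact_Icc.induction_on (p := fun s => MemLp (deriv f) 2 (volume.restrict s))
      (by simp) (fun s t hst ht => ht.mono_measure (Measure.restrict_mono hst le_rfl))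
      (fun s t hs ht => ?_) (fun x _ => ?_)
    · refine MemLp.mono_measure (Measure.restrict_union_le s t) ?_
      rw [memLp_two_iff_integrable_sq_norm (stronglyMeasurable_deriv _).aestronglyMeasurable] at *
      exact hs.add_measure ht
    · obtain ⟨δ, hδ, h⟩ := h x
      exact ⟨_, mem_nhdsWithin_of_mem_nhds (Ioo_mem_nhds (by linarith) (by linarith)), h.2⟩
  have hii : ∀ x y : ℝ, IntervalIntegrable (deriv f) volume x y := by
    have : LocallyIntegrable (deriv f) volume := by
      intro x
      obtain ⟨δ, hδ, h⟩ := h x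
      exact ⟨_, Ioo_mem_nhds (by linarith) (by linarith), h.2.integrable (by norm_num)⟩
    exact fun x y => (this.integrableOn_isCompact isCompact_uIcc).intervalIntegrable
  -- The difference between `f` and the primitive of its derivative is locally constant, hence
  -- constant on the connected line.
  have hlc : IsLocallyConstant fun x => f x - ∫ t in a..x, deriv f t := by
    rw [IsLocallyConstant.iff_eventually_eq]
    intro x
    obtain ⟨δ, hδ, h⟩ := h x
    filter_upwards [Icc_mem_nhds (by linarith : x - δ < x) (by linarith : x < x + δ)] with y hy
    have h1 := h.eq_integral (x := x) ⟨by linarith, by linarith⟩ hy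
    have h2 := intervalIntegral.integral_add_adjacent_intervals (hii a x) (hii x y)
    linarith
  refine W1On.of_integral (C := f a) hab
    (hL.mono_measure (Measure.restrict_mono Ioo_subset_Icc_self le_rfl)) fun x _ => ?_
  have := hlc.apply_eq_of_isPreconnected isPreconnected_univ (mem_univ x) (mem_univ a)
  simp only [intervalIntegral.integral_same, sub_zero] at this
  linarith

/-- Composition with an increasing `C^1` diffeomorphism of the line. -/
theorem W1At.comp_diffeo {f θ θ' : ℝ → ℝ} {t : ℝ} (hθ : ∀ s, HasDerivAt θ (θ' s) s)
    (hθc : Continuous θ') (hpos : ∀ s, 0 < θ' s) (hf : W1At f (θ t)) :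
    W1At (fun s => f (θ s)) t := by
  obtain ⟨ε, hε, hf⟩ := hf
  have hcont : Continuous θ := continuous_iff_continuousAt.2 fun s => (hθ s).continuousAt
  obtain ⟨η, hη, hE⟩ := Metric.eventually_nhds_iff_ball.1 (hcont.continuousAt.eventually
    (Ioo_mem_nhds (by linarith : θ t - ε < θ t) (by linarith : θ t < θ t + ε)))
  set δ := η / 2 with hδ
  have hδ0 : 0 < δ := by positivity
  have hsub : ∀ x ∈ Icc (t - δ) (t + δ), θ x ∈ Icc (θ t - ε) (θ t + ε) := by
    intro x hx
    refine Ioo_subset_Icc_self (hE x ?_)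
    rw [Metric.mem_ball, Real.dist_eq, abs_lt]
    constructor <;> linarith [hx.1, hx.2]
  have hmono : StrictMono θ := strictMono_of_hasDerivAt_pos hθ hpos
  have hle : t - δ ≤ t + δ := by linarith
  have hw : MemLp (fun s => deriv f (θ s) * θ' s) 2
      (volume.restrict (Ioo (t - δ) (t + δ))) := by
    obtain ⟨C, hC⟩ := (isCompact_Icc (a := t - δ) (b := t + δ)).exists_bound_of_continuousOn
      hθc.continuousOn
    have hmeas : Measurable fun s => deriv f (θ s) * θ' s :=
      ((measurable_deriv f).comp hcont.measurable).mul hθc.measurable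
    rw [memLp_two_iff_integrable_sq hmeas.aestronglyMeasurable]
    have h1 : IntegrableOn (fun x => (deriv f x) ^ 2) (θ '' Ioo (t - δ) (t + δ)) := by
      have := (memLp_two_iff_integrable_sq (measurable_deriv f).aestronglyMeasurable).1 hf.2
      refine IntegrableOn.mono_set (t := Ioo (θ t - ε) (θ t + ε)) this ?_
      rintro _ ⟨x, hx, rfl⟩
      refine hE x ?_
      rw [Metric.mem_ball, Real.dist_eq, abs_lt]
      constructor <;> linarith [hx.1, hx.2]
    rw [integrableOn_image_iff_integrableOn_abs_deriv_smul measurableSet_Ioo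
      (fun x _ => (hθ x).hasDerivWithinAt) hmono.injective.injOn] at h1
    refine (h1.const_mul C).mono (hmeas.pow_const 2).aestronglyMeasurable ?_
    refine (ae_restrict_iff' measurableSet_Ioo).2 (Eventually.of_forall fun x hx => ?_)
    have hCx := hC x (Ioo_subset_Icc_self hx)
    rw [Real.norm_of_nonneg (hpos x).le] at hCx
    have hp := hpos x
    rw [Real.norm_of_nonneg (sq_nonneg _), smul_eq_mul, abs_of_pos hp,
      Real.norm_of_nonneg (by have := hp.le.trans hCx; positivity)]
    nlinarith [mul_nonneg (sq_nonneg (deriv f (θ x))) hp.le,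
      mul_nonneg (mul_nonneg (sq_nonneg (deriv f (θ x))) hp.le) (sub_nonneg.2 hCx)]
  refine ⟨δ, hδ0, W1On.of_integral (C := f (θ (t - δ))) hle hw fun x hx => ?_⟩
  have h1 := hf.eq_integral (hsub (t - δ) (left_mem_Icc.2 hle)) (hsub x hx)
  have h2 := intervalIntegral.integral_comp_mul_deriv_of_deriv_nonneg (a := t - δ) (b := x)
    (f := θ) (f' := θ') (g := deriv f) hcont.continuousOn (fun y _ => (hθ y))
    (fun y _ => (hpos y).le)
  simp only [Function.comp_def] at h2
  rw [h2]
  linarith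

end LengthFunctional
end

noncomputable section
namespace LengthFunctional

open Filter Topology

/-! ### Functions of class `W^{k+1,2}` near a point -/

/-- `f` is of class `W^{k+1,2}` near `t`. -/
def HAt : ℕ → (ℝ → ℝ) → ℝ → Prop
  | 0, f, t => W1At f t
  | k + 1, f, t => (∀ᶠ s in 𝓝 t, DifferentiableAt ℝ f s) ∧ HAt k (deriv f) t

namespace HAt

theorem congr {k : ℕ} : ∀ {f g : ℝ → ℝ} {t : ℝ}, HAt k f t → f =ᶠ[𝓝 t] g → HAt k g t := by
  induction k with
  | zero => exact fun h hfg => W1At.congr h hfg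
  | succ k ih =>
    intro f g t h hfg
    refine ⟨?_, ih h.2 hfg.deriv⟩
    filter_upwards [h.1, hfg.eventuallyEq_nhds] with s h1 h2
    exact h1.congr_of_eventuallyEq h2.symm

/-- The one-dimensional Sobolev embedding W^{k+1,2} ⊂ C^k. -/
theorem contDiffAt {k : ℕ} : ∀ {f : ℝ → ℝ} {t : ℝ}, HAt k f t → ContDiffAt ℝ k f t := by
  induction k with
  | zero =>
    intro f t h
    have h1 : {s | W1At f s} ∈ 𝓝 t := W1At.eventually h
    exact contDiffAt_zero.2 ⟨_, h1, fun s hs =>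
      (W1At.continuousAt hs).continuousWithinAt⟩
  | succ k ih =>
    intro f t h
    rw [show ((k + 1 : ℕ) : WithTop ℕ∞) = (k : WithTop ℕ∞) + 1 by push_cast; rfl,
      contDiffAt_succ_iff_hasFDerivAt]
    refine ⟨fun s => ContinuousLinearMap.toSpanSingleton ℝ (deriv f s), ⟨_, h.1, fun s hs => ?_⟩,
      ?_⟩
    · exact hs.hasDerivAt.hasFDerivAt
    · exact (ContinuousLinearMap.toSpanSingletonCLE (𝕜 := ℝ) (E := ℝ)).contDiff.contDiffAt.comp t (ih h.2)

theorem continuousAt {k : ℕ} {f : ℝ → ℝ} {t : ℝ} (h : HAt k f t) : ContinuousAt f t :=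
  h.contDiffAt.continuousAt

theorem differentiableAt {k : ℕ} {f : ℝ → ℝ} {t : ℝ} (h : HAt (k + 1) f t) :
    DifferentiableAt ℝ f t := h.1.self_of_nhds

theorem of_contDiffAt {k : ℕ} : ∀ {f : ℝ → ℝ} {t : ℝ},
    ContDiffAt ℝ (k + 1 : ℕ) f t → HAt k f t := by
  induction k with
  | zero =>
    intro f t h
    exact W1At.of_contDiffAt (by simpa using h)
  | succ k ih =>
    intro f t h
    refine ⟨?_, ih ?_⟩
    · have h1 : ContDiffAt ℝ 1 f t := h.of_le (by norm_cast; omega)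
      exact (h1.eventually (by simp)).mono fun s hs => hs.differentiableAt (by simp)
    · have h1 : ContDiffAt ℝ (k + 1 : ℕ) (fderiv ℝ f) t :=
        h.fderiv_right (by norm_cast)
      exact h1.clm_apply (contDiffAt_const (c := (1 : ℝ)))

theorem of_succ {k : ℕ} {f : ℝ → ℝ} {t : ℝ} (h : HAt (k + 1) f t) : HAt k f t :=
  of_contDiffAt h.contDiffAt

theorem of_le {k j : ℕ} (hjk : j ≤ k) {f : ℝ → ℝ} {t : ℝ} (h : HAt k f t) : HAt j f t := by
  induction hjk with
  | refl => exact h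
  | step _ ih => exact ih h.of_succ

/-- The derivative is ∂₁φ(f, g) f' + ∂₂φ(f, g) g'. Induction applies to the partial derivatives, and
then to the products and the sum, which are themselves smooth functions of two arguments. Two
arguments are therefore enough for closure under all algebraic operations. -/
theorem comp₂ {k : ℕ} : ∀ {φ : ℝ × ℝ → ℝ} {f g : ℝ → ℝ} {t : ℝ}, ContDiffAt ℝ ∞ φ (f t, g t) →
    HAt k f t → HAt k g t → HAt k (fun s => φ (f s, g s)) t := by
  induction k with
  | zero => exact fun hφ hf hg => W1At.comp₂ (hφ.of_le (by simp)) hf hg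
  | succ k ih =>
    intro φ f g t hφ hf hg
    have hc : ContinuousAt (fun s => (f s, g s)) t := hf.continuousAt.prodMk hg.continuousAt
    have hd : ∀ᶠ s in 𝓝 t, DifferentiableAt ℝ φ (f s, g s) := by
      refine hc.eventually (((hφ.of_le (m := 1) (by simp)).eventually (by simp)).mono
        fun p hp => hp.differentiableAt (by simp))
    have key : ∀ᶠ s in 𝓝 t, HasDerivAt (fun s => φ (f s, g s))
        (fderiv ℝ φ (f s, g s) (1, 0) * deriv f s + fderiv ℝ φ (f s, g s) (0, 1) * deriv g s)
        s := by
      filter_upwards [hd, hf.1, hg.1] with s h1 h2 h3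
      have e := h1.hasFDerivAt.comp_hasDerivAt s (h2.hasDerivAt.prodMk h3.hasDerivAt)
      have h4 : (deriv f s, deriv g s) = deriv f s • ((1 : ℝ), (0 : ℝ)) +
          deriv g s • ((0 : ℝ), (1 : ℝ)) := by simp
      rw [h4, map_add, map_smul, map_smul, smul_eq_mul, smul_eq_mul, mul_comm (deriv f s),
        mul_comm (deriv g s)] at e
      exact e
    refine ⟨key.mono fun s hs => hs.differentiableAt, ?_⟩
    have hφ' : ContDiffAt ℝ ∞ (fderiv ℝ φ) (f t, g t) := hφ.fderiv_right (by simp)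
    have h1 := ih (φ := fun p => fderiv ℝ φ p (1, 0)) (hφ'.clm_apply contDiffAt_const)
      hf.of_succ hg.of_succ
    have h2 := ih (φ := fun p => fderiv ℝ φ p (0, 1)) (hφ'.clm_apply contDiffAt_const)
      hf.of_succ hg.of_succ
    have hm : ∀ p : ℝ × ℝ, ContDiffAt ℝ ∞ (fun p : ℝ × ℝ => p.1 * p.2) p := fun p => by fun_prop
    have ha : ∀ p : ℝ × ℝ, ContDiffAt ℝ ∞ (fun p : ℝ × ℝ => p.1 + p.2) p := fun p => by fun_prop
    exact (ih (ha _) (ih (hm _) h1 hf.2) (ih (hm _) h2 hg.2)).congr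
      (key.mono fun s hs => hs.deriv.symm)

theorem comp {k : ℕ} {φ : ℝ → ℝ} {f : ℝ → ℝ} {t : ℝ} (hφ : ContDiffAt ℝ ∞ φ (f t))
    (hf : HAt k f t) : HAt k (fun s => φ (f s)) t :=
  comp₂ (φ := fun p => φ p.1) (hφ.comp (f t, f t) contDiffAt_fst) hf hf

theorem add {k : ℕ} {f g : ℝ → ℝ} {t : ℝ} (hf : HAt k f t) (hg : HAt k g t) :
    HAt k (fun s => f s + g s) t := comp₂ (φ := fun p => p.1 + p.2) (by fun_prop) hf hg

theorem sub {k : ℕ} {f g : ℝ → ℝ} {t : ℝ} (hf : HAt k f t) (hg : HAt k g t) :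
    HAt k (fun s => f s - g s) t := comp₂ (φ := fun p => p.1 - p.2) (by fun_prop) hf hg

theorem mul {k : ℕ} {f g : ℝ → ℝ} {t : ℝ} (hf : HAt k f t) (hg : HAt k g t) :
    HAt k (fun s => f s * g s) t := comp₂ (φ := fun p => p.1 * p.2) (by fun_prop) hf hg

theorem comp_diffeo {k : ℕ} {θ θ' : ℝ → ℝ} (hθ : ∀ s, HasDerivAt θ (θ' s) s)
    (hc : Continuous θ') (hpos : ∀ s, 0 < θ' s) : ∀ {f : ℝ → ℝ} {t : ℝ},
    (∀ s, HAt k θ s) → HAt k f (θ t) → HAt k (fun s => f (θ s)) t := by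
  induction k with
  | zero => exact fun _ hf => W1At.comp_diffeo hθ hc hpos hf
  | succ k ih =>
    intro f t hk hf
    have key : ∀ᶠ s in 𝓝 t, HasDerivAt (fun s => f (θ s)) (deriv f (θ s) * θ' s) s := by
      filter_upwards [(hθ t).continuousAt.eventually hf.1] with s hs
      exact hs.hasDerivAt.comp s (hθ s)
    refine ⟨key.mono fun s hs => hs.differentiableAt, ?_⟩
    have e : deriv θ = θ' := funext fun s => (hθ s).deriv
    have h1 := (hk t).2
    rw [e] at h1
    exact ((ih (fun s => (hk s).of_succ) hf.2).mul h1).congr (key.mono fun s hs => hs.deriv.symm)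

/-- The derivative of ξ is 1/θ'(ξ). If ξ has one order of regularity less, then so does this
expression, and ξ gains the missing order. -/
theorem inverse {k : ℕ} {θ θ' ξ : ℝ → ℝ} (hθ : ∀ s, HasDerivAt θ (θ' s) s)
    (hc : Continuous θ') (hpos : ∀ s, 0 < θ' s) (hξc : Continuous ξ) (hξ : ∀ x, θ (ξ x) = x)
    (hk : ∀ s, HAt k θ s) (x : ℝ) : HAt k ξ x := by
  have hd : ∀ x, HasDerivAt ξ (θ' (ξ x))⁻¹ x := fun x =>
    (hθ (ξ x)).of_local_left_inverse hξc.continuousAt (hpos _).ne' (Eventually.of_forall hξ)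
  have hdc : Continuous fun x => (θ' (ξ x))⁻¹ := (hc.comp hξc).inv₀ fun x => (hpos _).ne'
  induction k generalizing x with
  | zero =>
    refine of_contDiffAt (ContDiff.contDiffAt ?_)
    simp only [zero_add, Nat.cast_one]
    refine contDiff_one_iff_deriv.2 ⟨fun x => (hd x).differentiableAt, ?_⟩
    rwa [show deriv ξ = _ from funext fun x => (hd x).deriv]
  | succ k ih =>
    have h0 := ih fun s => (hk s).of_succ
    refine ⟨Eventually.of_forall fun x => (hd x).differentiableAt, ?_⟩
    rw [show deriv ξ = _ from funext fun x => (hd x).deriv]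
    have e : deriv θ = θ' := funext fun s => (hθ s).deriv
    have h1 := (hk (ξ x)).2
    rw [e] at h1
    have h2 := comp_diffeo hd hdc (fun x => inv_pos.2 (hpos _)) h0 h1
    exact comp (φ := fun y => y⁻¹) (contDiffAt_inv ℝ (hpos _).ne') h2

theorem iterate_deriv {k : ℕ} : ∀ {j : ℕ} {f : ℝ → ℝ} {t : ℝ}, HAt k f t → j ≤ k →
    W1At (deriv^[j] f) t := by
  induction k with
  | zero =>
    intro j f t h hj
    obtain rfl : j = 0 := by omega
    exact h
  | succ k ih =>
    intro j f t h hj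
    rcases j with _ | j
    · exact h.of_le (Nat.zero_le _)
    · exact ih (j := j) (f := deriv f) h.2 (by omega)

end HAt

/-! ### Comparison with weak derivatives -/

theorem W1On.integral_deriv_mul {u φ : ℝ → ℝ} {a b : ℝ} (hab : a ≤ b) (hu : W1On u a b)
    (hφ : ContDiff ℝ ∞ φ) (hs : tsupport φ ⊆ Ioo a b) :
    ∫ t in Ioo a b, deriv φ t * u t = -∫ t in Ioo a b, φ t * deriv u t := by
  have h1 : AbsolutelyContinuousOnInterval φ a b :=
    (hφ.of_le (by simp : (1 : WithTop ℕ∞) ≤ ∞)).contDiffOn.absolutelyContinuousOnInterval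
  have h2 := h1.integral_mul_deriv_eq_deriv_mul hu.1
  have h3 : φ a = 0 := image_eq_zero_of_notMem_tsupport fun h => lt_irrefl _ (hs h).1
  have h4 : φ b = 0 := image_eq_zero_of_notMem_tsupport fun h => lt_irrefl _ (hs h).2
  rw [h3, h4, zero_mul, zero_mul, sub_zero, zero_sub, intervalIntegral.integral_of_le hab,
    intervalIntegral.integral_of_le hab, integral_Ioc_eq_integral_Ioo,
    integral_Ioc_eq_integral_Ioo] at h2
  linarith

theorem isSobolevOn_of_w1On {k : ℕ} {f : ℝ → ℝ} {a b : ℝ} (hab : a ≤ b)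
    (h : ∀ j ≤ k, W1On (deriv^[j] f) a b) : IsSobolevOn (k + 1) f a b := by
  refine ⟨fun j => deriv^[j] f, rfl, fun j hj => ?_, fun j hj φ hφ _ hs => ?_⟩
  · rcases Nat.lt_or_ge j (k + 1) with h1 | h1
    · have h2 := (h j (by omega)).1.continuousOn
      rw [uIcc_of_le hab] at h2
      exact memLp_Ioo_of_continuousOn h2
    · obtain rfl : j = k + 1 := by omega
      change MemLp (deriv^[k + 1] f) 2 _
      rw [Function.iterate_succ_apply']
      exact (h k le_rfl).2
  · change ∫ t in Ioo a b, deriv φ t * deriv^[j] f t = -∫ t in Ioo a b, φ t * deriv^[j + 1] f t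
    rw [Function.iterate_succ_apply']
    exact (h j (by omega)).integral_deriv_mul hab hφ hs

theorem isSobolevOn_of_forall_hAt {k : ℕ} {f : ℝ → ℝ} (h : ∀ t, HAt k f t) (a b : ℝ) :
    IsSobolevOn (k + 1) f a b := by
  rcases le_total a b with hab | hab
  · exact isSobolevOn_of_w1On hab fun j hj => W1On.of_forall (fun t => (h t).iterate_deriv hj) hab
  -- For b ≤ a the interval is empty, and any functions serve as weak derivatives.
  · refine ⟨fun _ => f, rfl, fun j _ => ?_, fun j _ φ _ _ _ => ?_⟩ <;>
    simp [Ioo_eq_empty (not_lt.2 hab)]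

theorem IsSobolevOn.of_coord {k : ℕ} {c : ℝ → Plane} {a b : ℝ}
    (h : ∀ i, IsSobolevOn k (fun t => c t i) a b) : IsSobolevOn k c a b := by
  choose w hw0 hw hd using h
  have hm : ∀ j ≤ k, MemLp (fun t => WithLp.toLp 2 fun i => w i j t : ℝ → Plane) 2
      (volume.restrict (Ioo a b)) := by
    intro j hj
    exact MemLp.of_eval_piLp fun i => hw i j hj
  refine ⟨fun j t => WithLp.toLp 2 fun i => w i j t, ?_, hm, ?_⟩
  · funext t
    ext i
    exact congrFun (hw0 i) t
  · intro j hj φ hφ hc hs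
    have hint : ∀ (ψ : ℝ → ℝ), Continuous ψ → ∀ j ≤ k,
        IntegrableOn (fun t => ψ t • (WithLp.toLp 2 fun i => w i j t : Plane)) (Ioo a b) := by
      intro ψ hψ j hj
      obtain ⟨C, hC⟩ := (isCompact_Icc (a := a) (b := b)).exists_bound_of_continuousOn
        hψ.continuousOn
      refine Integrable.bdd_smul ((hm j hj).integrable (by norm_num)) C
        hψ.aestronglyMeasurable ?_
      exact (ae_restrict_iff' measurableSet_Ioo).2
        (Eventually.of_forall fun x hx => hC x (Ioo_subset_Icc_self hx))
    have hdφ : Continuous (deriv φ) := hφ.continuous_deriv (by simp)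
    ext i
    have e1 := (EuclideanSpace.proj (𝕜 := ℝ) i).integral_comp_comm (hint _ hdφ j hj.le)
    have e2 := (EuclideanSpace.proj (𝕜 := ℝ) i).integral_comp_comm (hint _ hφ.continuous (j + 1) hj)
    exact e1.symm.trans ((hd i j hj φ hφ hc hs).trans (congrArg Neg.neg e2))

theorem IsSobolevOn.coord {k : ℕ} {c : ℝ → Plane} {a b : ℝ} (h : IsSobolevOn k c a b)
    (i : Fin 2) : IsSobolevOn k (fun t => c t i) a b := by
  obtain ⟨w, hw0, hw, hd⟩ := h
  refine ⟨fun j t => w j t i, by subst hw0; rfl, fun j hj => (hw j hj).eval_piLp i,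
    fun j hj φ hφ hc hs => ?_⟩
  have hint : ∀ (ψ : ℝ → ℝ), Continuous ψ → ∀ j ≤ k,
      IntegrableOn (fun t => ψ t • w j t) (Ioo a b) := by
    intro ψ hψ j hj
    obtain ⟨C, hC⟩ := (isCompact_Icc (a := a) (b := b)).exists_bound_of_continuousOn
      hψ.continuousOn
    refine Integrable.bdd_smul ((hw j hj).integrable (by norm_num)) C
      hψ.aestronglyMeasurable ?_
    exact (ae_restrict_iff' measurableSet_Ioo).2
      (Eventually.of_forall fun x hx => hC x (Ioo_subset_Icc_self hx))
  have hdφ : Continuous (deriv φ) := hφ.continuous_deriv (by simp)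
  have e1 := (EuclideanSpace.proj (𝕜 := ℝ) i).integral_comp_comm (hint _ hdφ j hj.le)
  have e2 := (EuclideanSpace.proj (𝕜 := ℝ) i).integral_comp_comm (hint _ hφ.continuous (j + 1) hj)
  have e3 := congrArg (EuclideanSpace.proj (𝕜 := ℝ) i) (hd j hj φ hφ hc hs)
  exact e1.trans (e3.trans (congrArg Neg.neg e2.symm))

end LengthFunctional
end

noncomputable section
namespace LengthFunctional

open Filter Topology

/-! ### The lemma of du Bois-Reymond -/

/-- A test function on `(a, b)` with vanishing integral is the derivative of a test function. -/
theorem exists_testFunction_deriv_eq {ζ : ℝ → ℝ} {a b : ℝ} (hζ : ContDiff ℝ ∞ ζ)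
    (hs : tsupport ζ ⊆ Ioo a b) (hc : HasCompactSupport ζ) (h0 : ∫ t in Ioo a b, ζ t = 0) :
    ∃ φ : ℝ → ℝ, ContDiff ℝ ∞ φ ∧ HasCompactSupport φ ∧ tsupport φ ⊆ Ioo a b ∧ deriv φ = ζ := by
  rcases (tsupport ζ).eq_empty_or_nonempty with he | hne
  · refine ⟨0, contDiff_const, HasCompactSupport.zero, by simp, ?_⟩
    rw [tsupport_eq_empty_iff.1 he]
    exact deriv_const' 0
  obtain ⟨p, hp, hpl⟩ := hc.isCompact.exists_isLeast hne
  obtain ⟨q, hq, hql⟩ := hc.isCompact.exists_isGreatest hne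
  have hap := (hs hp).1
  have hqb := (hs hq).2
  have hpq : p ≤ q := hpl hq
  have hz : ∀ t, t ∉ Icc p q → ζ t = 0 := fun t ht => image_eq_zero_of_notMem_tsupport
    fun h => ht ⟨hpl h, hql h⟩
  have hd : ∀ t, HasDerivAt (fun t => ∫ s in a..t, ζ s) (ζ t) t := fun t =>
    intervalIntegral.integral_hasDerivAt_right (hζ.continuous.intervalIntegrable _ _)
      (hζ.continuous.stronglyMeasurableAtFilter _ _) hζ.continuous.continuousAt
  have hde : deriv (fun t => ∫ s in a..t, ζ s) = ζ := funext fun t => (hd t).deriv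
  -- The primitive vanishes to the left of the support of ζ because ζ does, and to the right of it
  -- because the total integral is zero.
  have hsupp : Function.support (fun t => ∫ s in a..t, ζ s) ⊆ Icc p q := by
    intro t ht
    by_contra hn
    apply ht
    rcases lt_or_ge t p with h1 | h1
    · have : ∫ s in a..t, ζ s = ∫ s in a..t, (0 : ℝ) := by
        refine intervalIntegral.integral_congr fun s hs => hz s fun h => ?_
        rcases le_total a t with h2 | h2
        · rw [uIcc_of_le h2] at hs
          linarith [hs.2, h.1]
        · rw [uIcc_of_ge h2] at hs
          linarith [hs.2, h.1]
      simpa using this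
    · have h2 : q < t := by
        by_contra h3
        exact hn ⟨h1, not_lt.1 h3⟩
      have e1 : ∫ s in a..b, ζ s = 0 := by
        rw [intervalIntegral.integral_of_le (by linarith), integral_Ioc_eq_integral_Ioo, h0]
      have e2 := intervalIntegral.integral_add_adjacent_intervals
        (hζ.continuous.intervalIntegrable (μ := volume) a t) (hζ.continuous.intervalIntegrable t b)
      have e3 : ∫ s in t..b, ζ s = ∫ s in t..b, (0 : ℝ) := by
        refine intervalIntegral.integral_congr fun s hs => hz s fun h => ?_
        rcases le_total t b with h4 | h4
        · rw [uIcc_of_le h4] at hs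
          linarith [hs.1, h.2]
        · rw [uIcc_of_ge h4] at hs
          linarith [hs.1, h.2]
      rw [intervalIntegral.integral_zero] at e3
      simp only
      linarith
  have hts : tsupport (fun t => ∫ s in a..t, ζ s) ⊆ Icc p q := closure_minimal hsupp isClosed_Icc
  refine ⟨fun t => ∫ s in a..t, ζ s, ?_, ?_, hts.trans (Icc_subset_Ioo hap hqb), hde⟩
  · exact contDiff_infty_iff_deriv.2 ⟨fun t => (hd t).differentiableAt, by rwa [hde]⟩
  · exact HasCompactSupport.of_support_subset_isCompact isCompact_Icc hsupp

theorem integrableOn_mul_of_memLp {u φ : ℝ → ℝ} {a b : ℝ} (hφ : Continuous φ)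
    (hu : MemLp u 2 (volume.restrict (Ioo a b))) : IntegrableOn (fun t => φ t * u t) (Ioo a b) := by
  obtain ⟨C, hC⟩ := (isCompact_Icc (a := a) (b := b)).exists_bound_of_continuousOn hφ.continuousOn
  refine Integrable.bdd_mul (c := C) (hu.integrable (by norm_num)) hφ.aestronglyMeasurable ?_
  exact (ae_restrict_iff' measurableSet_Ioo).2
    (Eventually.of_forall fun x hx => hC x (Ioo_subset_Icc_self hx))

/-- If v is the primitive of w, then u - v has weak derivative zero. A test function η minus (∫η)
η₀, where η₀ has integral 1, has mean zero and is the derivative of a test function. Hence ∫ η (u -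
v) = c ∫ η with c = ∫ η₀ (u - v), and u - v equals c almost everywhere. -/
theorem ae_eq_integral_of_weakDeriv {u w : ℝ → ℝ} {a b : ℝ} (hab : a < b)
    (hu : MemLp u 2 (volume.restrict (Ioo a b))) (hw : MemLp w 2 (volume.restrict (Ioo a b)))
    (h : ∀ φ : ℝ → ℝ, ContDiff ℝ ∞ φ → HasCompactSupport φ → tsupport φ ⊆ Ioo a b →
      ∫ t in Ioo a b, deriv φ t * u t = -∫ t in Ioo a b, φ t * w t) :
    ∃ C, u =ᵐ[volume.restrict (Ioo a b)] fun t => C + ∫ s in a..t, w s := by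
  set v : ℝ → ℝ := fun t => ∫ s in a..t, w s with hv
  have hv1 : W1On v a b := W1On.of_integral (C := 0) hab.le hw fun x _ => by simp [hv]
  have hv2 := deriv_ae_eq_of_integral (f := v) (C := 0) hab.le
    (intervalIntegrable_of_memLp hab.le hw) fun x _ => by simp [hv]
  have hvc : ContinuousOn v (Icc a b) := by
    have := hv1.1.continuousOn
    rwa [uIcc_of_le hab.le] at this
  have hvm : MemLp v 2 (volume.restrict (Ioo a b)) := memLp_Ioo_of_continuousOn hvc
  have hg : MemLp (fun t => u t - v t) 2 (volume.restrict (Ioo a b)) := hu.sub hvm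
  have hweak : ∀ φ : ℝ → ℝ, ContDiff ℝ ∞ φ → HasCompactSupport φ → tsupport φ ⊆ Ioo a b →
      ∫ t in Ioo a b, deriv φ t * (u t - v t) = 0 := by
    intro φ hφ hc hs
    have hd : Continuous (deriv φ) := hφ.continuous_deriv (by simp)
    simp only [mul_sub]
    rw [integral_sub (integrableOn_mul_of_memLp hd hu) (integrableOn_mul_of_memLp hd hvm),
      h φ hφ hc hs, hv1.integral_deriv_mul hab.le hφ hs, sub_eq_zero, neg_inj]
    refine integral_congr_ae (hv2.mono fun t ht => ?_)
    simp only [ht]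
  let β : ContDiffBump ((a + b) / 2) := ⟨(b - a) / 8, (b - a) / 4, by linarith, by linarith⟩
  set η₀ : ℝ → ℝ := β.normed volume with hη₀
  have hη₀c : ContDiff ℝ ∞ η₀ := β.contDiff_normed
  have hη₀s : tsupport η₀ ⊆ Ioo a b := by
    rw [hη₀, β.tsupport_normed_eq, Real.closedBall_eq_Icc]
    refine Icc_subset_Ioo ?_ ?_ <;> simp only [β] <;> linarith
  have hη₀k : HasCompactSupport η₀ := β.hasCompactSupport_normed
  have hη₀i : ∫ t in Ioo a b, η₀ t = 1 := by
    rw [setIntegral_eq_integral_of_forall_compl_eq_zero, β.integral_normed]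
    exact fun x hx => image_eq_zero_of_notMem_tsupport fun h => hx (hη₀s h)
  set c := ∫ t in Ioo a b, η₀ t * (u t - v t) with hc
  refine ⟨c, ?_⟩
  have hz : ∀ᵐ x ∂(volume : Measure ℝ), x ∈ Ioo a b → (u x - v x) - c = 0 := by
    refine isOpen_Ioo.ae_eq_zero_of_integral_contDiff_smul_eq_zero ?_ ?_
    · have h1 : IntegrableOn (fun x => u x - v x - c) (Ioo a b) :=
        (hg.integrable (by norm_num)).sub (integrable_const c)
      exact h1.locallyIntegrableOn
    · intro η hη hηk hηs
      set m := ∫ t in Ioo a b, η t with hm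
      have hηi : IntegrableOn η (Ioo a b) :=
        (hη.continuous.integrable_of_hasCompactSupport hηk).integrableOn
      have hη₀i' : IntegrableOn η₀ (Ioo a b) :=
        (hη₀c.continuous.integrable_of_hasCompactSupport hη₀k).integrableOn
      have hζs : tsupport (fun t => η t - m * η₀ t) ⊆ Ioo a b := by
        refine (closure_minimal ?_ (isClosed_tsupport η |>.union (isClosed_tsupport η₀))).trans
          (union_subset hηs hη₀s)
        intro t ht
        by_contra hn
        rw [mem_union, not_or] at hn
        apply ht
        simp [image_eq_zero_of_notMem_tsupport hn.1, image_eq_zero_of_notMem_tsupport hn.2]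
      have hζc : HasCompactSupport (fun t => η t - m * η₀ t) := by
        refine HasCompactSupport.of_support_subset_isCompact isCompact_Icc
          ((subset_tsupport _).trans (hζs.trans Ioo_subset_Icc_self))
      obtain ⟨φ, h1, h2, h3, h4⟩ := exists_testFunction_deriv_eq
        (hη.sub (contDiff_const.mul hη₀c)) hζs hζc (by
          rw [integral_sub hηi (hη₀i'.const_mul m), integral_const_mul, hη₀i, mul_one, sub_self])
      have h5 := hweak φ h1 h2 h3
      rw [h4] at h5
      simp only [sub_mul, mul_assoc] at h5
      rw [integral_sub (integrableOn_mul_of_memLp hη.continuous hg)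
        ((integrableOn_mul_of_memLp hη₀c.continuous hg).const_mul m), integral_const_mul,
        ← hc] at h5
      simp only [smul_eq_mul]
      rw [← setIntegral_eq_integral_of_forall_compl_eq_zero (s := Ioo a b)]
      · simp only [mul_sub (_ : ℝ) _ c]
        rw [integral_sub (integrableOn_mul_of_memLp hη.continuous hg) (hηi.mul_const c),
          integral_mul_const, ← hm]
        exact h5
      · intro x hx
        rw [image_eq_zero_of_notMem_tsupport fun h => hx (hηs h), zero_mul]
  refine (ae_restrict_iff' measurableSet_Ioo).2 (hz.mono fun x hx hxI => ?_)
  have := hx hxI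
  simp only [hv] at this ⊢
  linarith

theorem eqOn_of_ae_eq_Ioo {f g : ℝ → ℝ} {a b : ℝ} (h : f =ᵐ[volume.restrict (Ioo a b)] g)
    (hf : ContinuousOn f (Ioo a b)) (hg : ContinuousOn g (Ioo a b)) : EqOn f g (Ioo a b) :=
  Measure.eqOn_open_of_ae_eq h isOpen_Ioo hf hg

/-- Continuity selects the good representative. In the inductive step `w 1` agrees almost everywhere
with the continuous function C' + ∫ `w 2`, which is then the classical derivative of `f`. -/
theorem hAt_of_isSobolevOn {k : ℕ} : ∀ {f : ℝ → ℝ} {a b : ℝ}, IsSobolevOn (k + 1) f a b →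
    ContinuousOn f (Ioo a b) → ∀ t ∈ Ioo a b, HAt k f t := by
  induction k with
  | zero =>
    rintro f a b ⟨w, rfl, hw, hd⟩ hc t ht
    have hab := ht.1.trans ht.2
    obtain ⟨C, hC⟩ := ae_eq_integral_of_weakDeriv hab (hw 0 (by simp)) (hw 1 le_rfl)
      (hd 0 (by simp))
    have h1 : W1On (fun t => C + ∫ s in a..t, w 1 s) a b :=
      W1On.of_integral hab.le (hw 1 le_rfl) fun x _ => rfl
    have h2 := h1.1.continuousOn
    rw [uIcc_of_le hab.le] at h2
    have h3 := eqOn_of_ae_eq_Ioo hC hc (h2.mono Ioo_subset_Icc_self)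
    exact (h1.w1At ht).congr (Filter.eventuallyEq_of_mem (Ioo_mem_nhds ht.1 ht.2) h3.symm)
  | succ k ih =>
    rintro f a b ⟨w, rfl, hw, hd⟩ hc t ht
    have hab := ht.1.trans ht.2
    obtain ⟨C, hC⟩ := ae_eq_integral_of_weakDeriv hab (hw 0 (by simp)) (hw 1 (by omega))
      (hd 0 (by simp))
    obtain ⟨C', hC'⟩ := ae_eq_integral_of_weakDeriv hab (hw 1 (by omega)) (hw 2 (by omega))
      (hd 1 (by omega))
    set g : ℝ → ℝ := fun t => C' + ∫ s in a..t, w 2 s with hg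
    have hcont : ∀ (C : ℝ) (j : ℕ), j ≤ k + 1 + 1 →
        ContinuousOn (fun t => C + ∫ s in a..t, w j s) (Icc a b) := by
      intro C j hj
      have h1 : W1On (fun t => C + ∫ s in a..t, w j s) a b :=
        W1On.of_integral hab.le (hw j hj) fun x _ => rfl
      have h2 := h1.1.continuousOn
      rwa [uIcc_of_le hab.le] at h2
    have hgc : ContinuousOn g (Icc a b) := hcont C' 2 (by omega)
    have h3 := eqOn_of_ae_eq_Ioo hC hc ((hcont C 1 (by omega)).mono Ioo_subset_Icc_self)
    have hder : ∀ x ∈ Ioo a b, HasDerivAt (w 0) (g x) x := by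
      intro x hx
      have e1 : ∀ y ∈ Icc a b, ∫ s in a..y, w 1 s = ∫ s in a..y, g s := by
        intro y hy
        refine intervalIntegral.integral_congr_ae ?_
        have := (ae_restrict_iff' measurableSet_Ioo).1 hC'
        have hne : ∀ᵐ s : ℝ, s ≠ b := by
          simp [ae_iff]
        filter_upwards [this, hne] with s hs hsb hsI
        rw [uIoc_of_le hy.1] at hsI
        exact hs ⟨hsI.1, lt_of_le_of_ne (hsI.2.trans hy.2) hsb⟩
      have e2 : w 0 =ᶠ[𝓝 x] fun y => C + ∫ s in a..y, g s := by
        filter_upwards [Ioo_mem_nhds hx.1 hx.2] with y hy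
        rw [← e1 y (Ioo_subset_Icc_self hy)]
        exact h3 hy
      refine HasDerivAt.congr_of_eventuallyEq ?_ e2
      refine (intervalIntegral.integral_hasDerivAt_right ?_ ?_ ?_).const_add C
      · refine ContinuousOn.intervalIntegrable (hgc.mono ?_)
        rw [uIcc_of_le hx.1.le]
        exact Icc_subset_Icc_right hx.2.le
      · exact ContinuousOn.stronglyMeasurableAtFilter isOpen_Ioo
          (hgc.mono Ioo_subset_Icc_self) x hx
      · exact hgc.continuousAt (Icc_mem_nhds hx.1 hx.2)
    have hmem := Ioo_mem_nhds ht.1 ht.2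
    refine ⟨by filter_upwards [hmem] with x hx using (hder x hx).differentiableAt, ?_⟩
    have hS : IsSobolevOn (k + 1) g a b := by
      -- The weak derivatives are shifted by one, with `w 1` replaced by its continuous
      -- representative `g`.
      refine ⟨fun j => if j = 0 then g else w (j + 1), by simp, fun j hj => ?_,
        fun j hj φ hφ hφc hs => ?_⟩
      · rcases j with _ | j
        · exact memLp_Ioo_of_continuousOn hgc
        · exact hw (j + 2) (by omega)
      · rcases j with _ | j
        · refine Eq.trans ?_ (hd 1 (by omega) φ hφ hφc hs)
          refine integral_congr_ae (hC'.mono fun x hx => ?_)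
          simp only [if_true, hx]
        · exact hd (j + 2) (by omega) φ hφ hφc hs
    refine (ih hS (hgc.mono Ioo_subset_Icc_self) t ht).congr ?_
    filter_upwards [hmem] with x hx using (hder x hx).deriv.symm

end LengthFunctional
end

noncomputable section
namespace LengthFunctional

open Filter Topology

/-! ### Calculus in the spaces `W^{k,2}(S¹, ℝ)` -/

theorem memLp_lift_Ioc (w : Lp ℝ 2 (volume : Measure S1)) (a : ℝ) :
    MemLp (fun t : ℝ => w (t : S1)) 2 (volume.restrict (Ioc a (a + 1))) :=
  (Lp.memLp w).comp_measurePreserving (AddCircle.measurePreserving_mk (1 : ℝ) a)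

theorem lift_periodic {β : Type*} (w : S1 → β) : Function.Periodic (fun t : ℝ => w (t : S1)) 1 := by
  intro t
  simp only [AddCircle.coe_add_period]

theorem intervalIntegrable_lift (w : Lp ℝ 2 (volume : Measure S1)) (a b : ℝ) :
    IntervalIntegrable (fun t : ℝ => w (t : S1)) volume a b := by
  refine (lift_periodic (w : S1 → ℝ)).intervalIntegrable one_ne_zero (t := 0) ?_ a b
  rw [zero_add]
  simpa using intervalIntegrable_mul continuous_const (φ := fun _ => 1) w

/-- The Cauchy–Schwarz inequality; an interval of length at most 1 is covered at most once by the
circle, so the L² norm on it is at most that on the circle. -/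
theorem integral_norm_lift_le (w : Lp ℝ 2 (volume : Measure S1)) {x y : ℝ} (hxy : x ≤ y)
    (h1 : y ≤ x + 1) : ∫ t in x..y, ‖w (t : S1)‖ ≤ √(y - x) * ‖w‖ := by
  have hm := (memLp_lift_Ioc w x).mono_measure
    (Measure.restrict_mono (Ioc_subset_Ioc_right h1) le_rfl)
  have e1 := eLpNorm_le_eLpNorm_mul_rpow_measure_univ (p := 1) (q := 2) (by norm_num)
    hm.aestronglyMeasurable
  have e2 : eLpNorm (fun t : ℝ => w (t : S1)) 2 (volume.restrict (Ioc x y)) ≤ eLpNorm w 2 volume := by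
    refine (eLpNorm_mono_measure _
      (Measure.restrict_mono (Ioc_subset_Ioc_right h1) le_rfl)).trans ?_
    exact (eLpNorm_comp_measurePreserving (Lp.aestronglyMeasurable w)
      (AddCircle.measurePreserving_mk (1 : ℝ) x)).le
  rw [intervalIntegral.integral_of_le hxy,
    integral_norm_eq_lintegral_enorm hm.aestronglyMeasurable, ← eLpNorm_one_eq_lintegral_enorm]
  have e3 : eLpNorm (fun t : ℝ => w (t : S1)) 1 (volume.restrict (Ioc x y)) ≤
      ENNReal.ofReal (√(y - x) * ‖w‖) := by
    refine e1.trans ((mul_le_mul_left e2 _).trans (le_of_eq ?_))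
    rw [Measure.restrict_apply_univ, Real.volume_Ioc, mul_comm √(y - x),
      ENNReal.ofReal_mul (norm_nonneg _), Lp.norm_def, ENNReal.ofReal_toReal (Lp.eLpNorm_ne_top w),
      Real.sqrt_eq_rpow, ENNReal.ofReal_rpow_of_nonneg (by linarith) (by norm_num)]
    norm_num
  exact ENNReal.toReal_le_of_le_ofReal (by positivity) e3

theorem abs_integral_lift_le (w : Lp ℝ 2 (volume : Measure S1)) {x y : ℝ} (h1 : |y - x| ≤ 1) :
    |∫ t in x..y, w (t : S1)| ≤ √|y - x| * ‖w‖ := by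
  rw [abs_le] at h1
  rcases le_total x y with h | h
  · rw [abs_of_nonneg (sub_nonneg.2 h)]
    exact (intervalIntegral.norm_integral_le_integral_norm h).trans
      (integral_norm_lift_le w h (by linarith))
  · rw [abs_of_nonpos (sub_nonpos.2 h), neg_sub, intervalIntegral.integral_symm, abs_neg]
    exact (intervalIntegral.norm_integral_le_integral_norm h).trans
      (integral_norm_lift_le w h (by linarith))

/-- A function on the circle with a weak derivative in `L²` is the integral of it. -/
theorem exists_continuous_of_isWeakDerivCircle {u w : Lp ℝ 2 (volume : Measure S1)}
    (h : IsWeakDerivCircle u w) : ∃ f : C(S1, ℝ), ⇑u =ᵐ[volume] ⇑f ∧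
      ∀ x y : ℝ, f (y : S1) - f (x : S1) = ∫ t in x..y, w (t : S1) := by
  have hii := intervalIntegrable_lift w
  set v : ℝ → ℝ := fun t => ∫ s in (0 : ℝ)..t, w (s : S1) with hv
  have hvc : Continuous v := intervalIntegral.continuous_primitive hii 0
  -- Testing with the constant function 1 shows that `w` has mean zero; this makes its primitive
  -- periodic.
  have hw0 : ∫ t in (0 : ℝ)..1, w (t : S1) = 0 := by
    have := h (fun _ => 1) contDiff_const (fun _ => rfl)
    simpa using this
  have hv1 : v 1 = 0 := hw0
  have hv0 : v 0 = 0 := intervalIntegral.integral_same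
  have hvp : Function.Periodic v 1 := by
    intro t
    simp only [hv]
    rw [← intervalIntegral.integral_add_adjacent_intervals (hii 0 t) (hii t (t + 1)),
      (lift_periodic (w : S1 → ℝ)).intervalIntegral_add_eq t 0, zero_add, hw0, add_zero]
  let V : C(S1, ℝ) := ⟨hvp.lift, continuous_coinduced_dom.2 hvc⟩
  have hV : ∀ t : ℝ, V (t : S1) = v t := fun t => hvp.lift_coe t
  set c := ∫ t in (0 : ℝ)..1, (u (t : S1) - v t) with hc
  let W : C(S1, ℝ) := V + ContinuousMap.const _ c
  have hWm : MemLp (⇑W) 2 (volume : Measure S1) :=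
    W.continuous.memLp_of_hasCompactSupport (HasCompactSupport.of_compactSpace _)
  have hAC : AbsolutelyContinuousOnInterval v 0 1 :=
    (hii 0 1).absolutelyContinuousOnInterval_intervalIntegral (by simp)
  have hdv : ∀ᵐ t : ℝ, t ∈ Set.uIoc (0 : ℝ) 1 → deriv v t = w (t : S1) := by
    filter_upwards [(hii 0 1).ae_hasDerivAt_integral] with t ht htI
    exact (ht (uIoc_subset_uIcc htI) 0 (by simp)).deriv
  have key : u = hWm.toLp W := by
    refine eq_of_integral_eq _ _ fun η hη hηp => ?_
    have e0 : ∫ t in (0 : ℝ)..1, η t * (hWm.toLp W : S1 → ℝ) (t : S1) =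
        ∫ t in (0 : ℝ)..1, η t * (v t + c) := by
      refine intervalIntegral.integral_congr_ae ?_
      filter_upwards [ae_lift hWm.coeFn_toLp] with t ht htI
      rw [ht htI]
      rfl
    rw [e0]
    set m := ∫ t in (0 : ℝ)..1, η t with hm
    -- Subtracting the mean of η makes the primitive periodic, hence an admissible test function.
    -- The leftover term with `m` is accounted for by the choice of the constant `c`.
    set Φ : ℝ → ℝ := fun t => ∫ s in (0 : ℝ)..t, (η s - m) with hΦ
    have hζ : Continuous fun s => η s - m := hη.continuous.sub continuous_const
    have hΦd : ∀ t, HasDerivAt Φ (η t - m) t := fun t =>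
      intervalIntegral.integral_hasDerivAt_right (hζ.intervalIntegrable _ _)
        (hζ.stronglyMeasurableAtFilter _ _) hζ.continuousAt
    have hΦde : deriv Φ = fun t => η t - m := funext fun t => (hΦd t).deriv
    have hΦs : ContDiff ℝ ∞ Φ := contDiff_infty_iff_deriv.2
      ⟨fun t => (hΦd t).differentiableAt, by rw [hΦde]; exact hη.sub contDiff_const⟩
    have hηi := fun a b => hη.continuous.intervalIntegrable (μ := volume) a b
    have hΦp : Function.Periodic Φ 1 := by
      intro t
      have hp : Function.Periodic (fun s => η s - m) 1 := fun s => by simp only [hηp s]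
      have h0 : ∫ s in (0 : ℝ)..1, (η s - m) = 0 := by
        rw [intervalIntegral.integral_sub (hηi _ _) (continuous_const.intervalIntegrable _ _), ← hm]
        simp
      simp only [hΦ]
      rw [← intervalIntegral.integral_add_adjacent_intervals (hζ.intervalIntegrable 0 t)
        (hζ.intervalIntegrable t (t + 1)), hp.intervalIntegral_add_eq t 0, zero_add, h0, add_zero]
    have e1 := h Φ hΦs hΦp
    have e2 := (hΦs.of_le (by simp : (1 : WithTop ℕ∞) ≤ ∞)).contDiffOn.absolutelyContinuousOnInterval
      (a := 0) (b := 1) |>.integral_mul_deriv_eq_deriv_mul hAC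
    have e3 : ∫ t in (0 : ℝ)..1, Φ t * deriv v t = ∫ t in (0 : ℝ)..1, Φ t * w (t : S1) := by
      refine intervalIntegral.integral_congr_ae ?_
      filter_upwards [hdv] with t ht htI
      rw [ht htI]
    rw [e3, hv1, hv0] at e2
    rw [hΦde] at e1 e2
    have iu := intervalIntegrable_mul hη.continuous u
    have iu' := (intervalIntegrable_lift u 0 1)
    have iv : IntervalIntegrable (fun t => η t * v t) volume 0 1 :=
      (hη.continuous.mul hvc).intervalIntegrable 0 1
    have iv' := hvc.intervalIntegrable (μ := volume) 0 1
    simp only [sub_mul] at e1 e2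
    rw [intervalIntegral.integral_sub iu (iu'.const_mul m), intervalIntegral.integral_const_mul]
      at e1
    rw [intervalIntegral.integral_sub iv (iv'.const_mul m), intervalIntegral.integral_const_mul]
      at e2
    rw [intervalIntegral.integral_sub iu' iv'] at hc
    simp only [mul_add]
    rw [intervalIntegral.integral_add iv ((hηi 0 1).mul_const c),
      intervalIntegral.integral_mul_const, ← hm, hc]
    linarith
  refine ⟨W, ?_, fun x y => ?_⟩
  · rw [key]
    exact hWm.coeFn_toLp
  · have : W (y : S1) - W (x : S1) = v y - v x := by
      simp only [W, ContinuousMap.add_apply, ContinuousMap.const_apply, hV]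
      ring
    rw [this]
    exact intervalIntegral.integral_interval_sub_left (hii 0 y) (hii 0 x)

namespace Sob

variable {k : ℕ}

theorem fn_sub_fn (τ : Sob (k + 1)) (x y : ℝ) :
    τ.fn (y : S1) - τ.fn (x : S1) = ∫ t in x..y, (τ.1.2 1 : S1 → ℝ) (t : S1) := by
  obtain ⟨f, h1, h2⟩ := exists_continuous_of_isWeakDerivCircle (τ.2.2 0)
  have : (⇑τ.fn : S1 → ℝ) = ⇑f := (Continuous.ae_eq_iff_eq volume τ.fn.continuous f.continuous).1
    (τ.2.1.trans h1)
  rw [this]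
  exact h2 x y

theorem norm_jet_le (τ : Sob k) (j : Fin (k + 1)) : ‖τ.1.2 j‖ ≤ ‖τ‖ :=
  PiLp.norm_apply_le (jet τ) j

theorem abs_fn_sub_le (τ : Sob (k + 1)) {x y : ℝ} (h : |y - x| ≤ 1) :
    |τ.fn (y : S1) - τ.fn (x : S1)| ≤ √|y - x| * ‖τ‖ := by
  rw [fn_sub_fn]
  exact (abs_integral_lift_le _ h).trans
    (mul_le_mul_of_nonneg_left (norm_jet_le τ 1) (Real.sqrt_nonneg _))

theorem continuous_lift (τ : Sob k) : Continuous fun t : ℝ => τ.fn (t : S1) :=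
  τ.fn.continuous.comp continuous_quotient_mk'

/-- The value at a point exceeds the value at any other point by at most ‖τ‖. Averaging over the
other point leaves the L¹ norm, which is again at most ‖τ‖. -/
theorem abs_fn_le (τ : Sob (k + 1)) (x : S1) : |τ.fn x| ≤ 2 * ‖τ‖ := by
  obtain ⟨t, ht, rfl⟩ : x ∈ ((↑) : ℝ → S1) '' Ico (0 : ℝ) (0 + 1) := by
    rw [AddCircle.coe_image_Ico_eq]; trivial
  rw [zero_add] at ht
  have h1 : ∫ s in (0 : ℝ)..1, |τ.fn (s : S1)| ≤ ‖τ‖ := by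
    have e1 := integral_norm_lift_le (τ.1.2 0) zero_le_one (by norm_num : (1 : ℝ) ≤ 0 + 1)
    have e2 : ∫ s in (0 : ℝ)..1, |τ.fn (s : S1)| =
        ∫ s in (0 : ℝ)..1, ‖(τ.1.2 0 : S1 → ℝ) (s : S1)‖ := by
      refine intervalIntegral.integral_congr_ae ?_
      filter_upwards [ae_lift τ.2.1] with s hs hsI
      rw [Real.norm_eq_abs, ← hs hsI]
      rfl
    rw [e2]
    refine e1.trans ?_
    simpa using norm_jet_le τ 0
  have h2 : ∫ s in (0 : ℝ)..1, (|τ.fn (t : S1)| - ‖τ‖) ≤ ∫ s in (0 : ℝ)..1, |τ.fn (s : S1)| := by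
    refine intervalIntegral.integral_mono_on zero_le_one (by simp)
      (τ.continuous_lift.abs.intervalIntegrable _ _) fun s hs => ?_
    have h3 : |t - s| ≤ 1 := by
      rw [abs_le]; constructor <;> linarith [hs.1, hs.2, ht.1, ht.2]
    have h4 := abs_fn_sub_le τ h3
    have h5 : √|t - s| * ‖τ‖ ≤ 1 * ‖τ‖ :=
      mul_le_mul_of_nonneg_right (Real.sqrt_le_one.2 h3) (norm_nonneg _)
    have h6 := abs_sub_abs_le_abs_sub (τ.fn (t : S1)) (τ.fn (s : S1))
    linarith
  simp only [intervalIntegral.integral_const, sub_zero, smul_eq_mul, one_mul] at h2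
  linarith

theorem exists_deriv (τ : Sob (k + 2)) : ∃ η : Sob (k + 1), ∀ j, η.1.2 j = τ.1.2 j.succ := by
  obtain ⟨f, h1, -⟩ := exists_continuous_of_isWeakDerivCircle (τ.2.2 1)
  exact ⟨⟨(f, WithLp.toLp 2 fun j => τ.1.2 j.succ), h1.symm, fun j => τ.2.2 j.succ⟩, fun _ => rfl⟩

/-- The derivative `W^{k+2,2}(S¹, ℝ) → W^{k+1,2}(S¹, ℝ)`. -/
def derivL (k : ℕ) : Sob (k + 2) →L[ℝ] Sob (k + 1) :=
  LinearMap.mkContinuous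
    { toFun := fun τ => (exists_deriv τ).choose
      map_add' := fun σ τ => jet_injective (by
        rw [map_add]
        refine PiLp.ext fun j => ?_
        exact ((exists_deriv (σ + τ)).choose_spec j).trans (congrArg₂ (· + ·)
          ((exists_deriv σ).choose_spec j).symm ((exists_deriv τ).choose_spec j).symm)) 
      map_smul' := fun c τ => jet_injective (by
        rw [RingHom.id_apply, map_smul]
        refine PiLp.ext fun j => ?_
        exact ((exists_deriv (c • τ)).choose_spec j).trans (congrArg (c • ·)
          ((exists_deriv τ).choose_spec j).symm)) } 1 (fun τ => by
    rw [one_mul]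
    change ‖jet (exists_deriv τ).choose‖ ≤ ‖jet τ‖
    rw [PiLp.norm_eq_of_L2, PiLp.norm_eq_of_L2]
    apply Real.sqrt_le_sqrt
    rw [Fin.sum_univ_succ (n := k + 2)]
    refine (le_of_eq ?_).trans (le_add_of_nonneg_left (sq_nonneg _))
    exact Finset.sum_congr rfl fun j _ => by
      rw [show (jet (exists_deriv τ).choose) j = (jet τ) j.succ from
        (exists_deriv τ).choose_spec j])

theorem derivL_jet (τ : Sob (k + 2)) (j : Fin (k + 2)) :
    (derivL k τ).1.2 j = τ.1.2 j.succ := (exists_deriv τ).choose_spec j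

/-- The weak derivative now has a continuous representative, so the fundamental theorem of calculus
gives a classical derivative at every point. -/
theorem hasDerivAt (τ : Sob (k + 2)) (t : ℝ) :
    HasDerivAt (fun t : ℝ => τ.fn (t : S1)) ((derivL k τ).fn (t : S1)) t := by
  have h1 : (fun t : ℝ => τ.fn (t : S1)) = fun y : ℝ => τ.fn ((0 : ℝ) : S1) +
      ∫ t in (0 : ℝ)..y, (derivL k τ).fn (t : S1) := by
    funext y
    have e := fn_sub_fn τ 0 y
    have e2 : ∫ t in (0 : ℝ)..y, (τ.1.2 1 : S1 → ℝ) (t : S1) =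
        ∫ t in (0 : ℝ)..y, (derivL k τ).fn (t : S1) := by
      obtain ⟨f, hf, -⟩ := exists_continuous_of_isWeakDerivCircle (τ.2.2 1)
      have e3 := (derivL k τ).2.1
      rw [derivL_jet τ 0] at e3
      have hq : ∀ᵐ s : ℝ, (τ.1.2 1 : S1 → ℝ) (s : S1) = (derivL k τ).fn (s : S1) := by
        -- An almost everywhere identity on the circle lifts to each unit interval, and countably
        -- many of these cover the line.
        have hloc : ∀ n : ℤ, ∀ᵐ s : ℝ, s ∈ Ioc (n : ℝ) (n + 1) →
            (τ.1.2 1 : S1 → ℝ) (s : S1) = (derivL k τ).fn (s : S1) := fun n =>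
          (ae_restrict_iff' measurableSet_Ioc).1
          ((AddCircle.measurePreserving_mk (1 : ℝ) n).quasiMeasurePreserving.ae e3.symm)
        filter_upwards [ae_all_iff.2 hloc] with s hs
        obtain ⟨n, hn⟩ := (existsUnique_add_zsmul_mem_Ioc one_pos s 0).exists
        refine hs (-n) ?_
        simp only [mul_one, zsmul_eq_mul, zero_add] at hn
        push_cast
        constructor <;> linarith [hn.1, hn.2]
      exact intervalIntegral.integral_congr_ae (hq.mono fun s hs _ => hs)
    rw [e2] at e
    linarith
  rw [h1]
  have hc := (derivL k τ).continuous_lift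
  exact (intervalIntegral.integral_hasDerivAt_right (hc.intervalIntegrable _ _)
    (hc.stronglyMeasurableAtFilter _ _) hc.continuousAt).const_add _

theorem hAt (τ : Sob (k + 1)) (t : ℝ) : HAt k (fun t : ℝ => τ.fn (t : S1)) t := by
  induction k generalizing t with
  | zero =>
    refine W1On.w1At (a := t - 1 / 2) (b := t + 1 / 2) ?_ ⟨by linarith, by linarith⟩
    refine W1On.of_integral (w := fun t : ℝ => (τ.1.2 1 : S1 → ℝ) (t : S1))
      (C := τ.fn ((t - 1 / 2 : ℝ) : S1)) (by linarith) ?_ fun x _ => ?_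
    · have := memLp_lift_Ioc (τ.1.2 1) (t - 1 / 2)
      rw [show t - 1 / 2 + 1 = t + 1 / 2 by ring] at this
      exact this.mono_measure (Measure.restrict_mono Ioo_subset_Ioc_self le_rfl)
    · linarith [fn_sub_fn τ (t - 1 / 2) x]
  | succ k ih =>
    refine ⟨Eventually.of_forall fun s => (hasDerivAt τ s).differentiableAt, ?_⟩
    rw [show deriv (fun t : ℝ => τ.fn (t : S1)) = _ from funext fun s => (hasDerivAt τ s).deriv]
    exact ih (derivL k τ) t

/-- The iterated derivatives are periodic and descend to the circle. They are weak derivatives of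
each other because the boundary terms at 0 and 1 cancel in the integration by parts. -/
theorem exists_of_hAt {f : ℝ → ℝ} (hp : Function.Periodic f 1) (h : ∀ t, HAt k f t) :
    ∃ τ : Sob (k + 1), ∀ t : ℝ, τ.fn (t : S1) = f t := by
  have hper : ∀ j, Function.Periodic (deriv^[j] f) 1 := by
    intro j
    induction j with
    | zero => exact hp
    | succ j ih =>
      intro t
      rw [Function.iterate_succ_apply', ← deriv_comp_add_const]
      congr 1
      exact funext ih
  have hW : ∀ j ≤ k, ∀ t, W1At (deriv^[j] f) t := fun j hj t => (h t).iterate_deriv hj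
  have hW1 : ∀ j ≤ k, W1On (deriv^[j] f) 0 1 := fun j hj => W1On.of_forall (hW j hj) zero_le_one
  have hcont : ∀ j ≤ k, Continuous (deriv^[j] f) := fun j hj =>
    continuous_iff_continuousAt.2 fun t => (hW j hj t).continuousAt
  have hmeas : ∀ j ≤ k + 1, Measurable (deriv^[j] f) := by
    intro j hj
    rcases j with _ | j
    · exact (hcont 0 (Nat.zero_le _)).measurable
    · rw [Function.iterate_succ_apply']
      exact measurable_deriv _
  have hmem : ∀ j ≤ k + 1, MemLp (deriv^[j] f) 2 (volume.restrict (Ioc (0 : ℝ) (0 + 1))) := by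
    intro j hj
    rw [zero_add, Measure.restrict_congr_set Ioo_ae_eq_Ioc.symm]
    rcases Nat.lt_or_ge j (k + 1) with h1 | h1
    · exact memLp_Ioo_of_continuousOn (hcont j (by omega)).continuousOn
    · obtain rfl : j = k + 1 := by omega
      rw [Function.iterate_succ_apply']
      exact (hW1 k le_rfl).2
  have hL : ∀ j ≤ k + 1, MemLp (hper j).lift 2 (volume : Measure S1) := by
    intro j hj
    have hm : Measurable (hper j).lift := by
      have e : (hper j).lift = fun x : S1 => deriv^[j] f (AddCircle.measurableEquivIoc 1 0 x) := by
        funext x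
        conv_lhs => rw [← (AddCircle.equivIoc (1 : ℝ) 0).symm_apply_apply x]
        exact (hper j).lift_coe _
      rw [e]
      exact (hmeas j hj).comp (measurable_subtype_coe.comp (MeasurableEquiv.measurable _))
    have hmp := AddCircle.measurePreserving_mk (1 : ℝ) 0
    rw [← hmp.map_eq, memLp_map_measure_iff hm.aestronglyMeasurable hmp.measurable.aemeasurable]
    exact hmem j hj
  have hcl : Continuous (hper 0).lift := continuous_coinduced_dom.2 (hcont 0 (Nat.zero_le _))
  have hco : ∀ j (hj : j ≤ k + 1), ∀ᵐ t : ℝ, t ∈ Set.uIoc (0 : ℝ) 1 →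
      ((hL j hj).toLp _ : S1 → ℝ) (t : S1) = deriv^[j] f t := fun j hj => by
    filter_upwards [ae_lift (hL j hj).coeFn_toLp] with t ht htI
    exact (ht htI).trans ((hper j).lift_coe t)
  refine ⟨⟨(⟨(hper 0).lift, hcl⟩, WithLp.toLp 2 fun j => (hL j (by omega)).toLp _), ?_, ?_⟩,
    fun t => (hper 0).lift_coe t⟩
  · exact (hL 0 (by omega)).coeFn_toLp.symm
  · intro j φ hφ hφp
    have hj : (j : ℕ) ≤ k := by omega
    have e1 : ∫ t in (0 : ℝ)..1, deriv φ t * ((hL j (by omega)).toLp _ : S1 → ℝ) (t : S1) =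
        ∫ t in (0 : ℝ)..1, deriv φ t * deriv^[j] f t := by
      refine intervalIntegral.integral_congr_ae ?_
      filter_upwards [hco j (by omega)] with t ht htI
      rw [ht htI]
    have e2 : ∫ t in (0 : ℝ)..1, φ t * ((hL (j + 1) (by omega)).toLp _ : S1 → ℝ) (t : S1) =
        ∫ t in (0 : ℝ)..1, φ t * deriv (deriv^[j] f) t := by
      refine intervalIntegral.integral_congr_ae ?_
      filter_upwards [hco (j + 1) (by omega)] with t ht htI
      rw [ht htI, Function.iterate_succ_apply']
    refine e1.trans (Eq.trans ?_ (congrArg Neg.neg e2.symm))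
    have e3 := (hφ.of_le (by simp : (1 : WithTop ℕ∞) ≤ ∞)).contDiffOn.absolutelyContinuousOnInterval
      (a := 0) (b := 1) |>.integral_mul_deriv_eq_deriv_mul (hW1 j hj).1
    have e4 : φ 1 = φ 0 := by simpa using hφp 0
    have e5 : deriv^[j] f 1 = deriv^[j] f 0 := by simpa using hper j 0
    rw [e4, e5] at e3
    linarith

end Sob

end LengthFunctional
end

noncomputable section
namespace LengthFunctional

open Filter Topology

/-! ### Smoothness of integral functionals -/

section ParametricIntegral

variable {E Y : Type} [NormedAddCommGroup E] [NormedSpace ℝ E] [NormedAddCommGroup Y]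
  [NormedSpace ℝ Y]

/-- The derivative of the integrand `Φ_t (F (t, L_t τ))` in `τ` is of the same form. -/
def integrandDeriv {W W' : Type} [NormedAddCommGroup W] [NormedSpace ℝ W] [NormedAddCommGroup W']
    [NormedSpace ℝ W'] (L : ℝ → E →L[ℝ] Y) (Φ : ℝ → W →L[ℝ] W') (t : ℝ) :
    (ℝ × Y →L[ℝ] W) →L[ℝ] (E →L[ℝ] W') :=
  (ContinuousLinearMap.compL ℝ E W W' (Φ t)).comp
    ((ContinuousLinearMap.compL ℝ E (ℝ × Y) W).flip
      ((ContinuousLinearMap.inr ℝ ℝ Y).comp (L t)))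

theorem continuous_integrandDeriv {W W' : Type} [NormedAddCommGroup W] [NormedSpace ℝ W]
    [NormedAddCommGroup W'] [NormedSpace ℝ W'] {L : ℝ → E →L[ℝ] Y} {Φ : ℝ → W →L[ℝ] W'}
    (hL : Continuous L) (hΦ : Continuous Φ) : Continuous (integrandDeriv L Φ) := by
  unfold integrandDeriv
  fun_prop

theorem continuousOn_integrand {W W' : Type} [NormedAddCommGroup W] [NormedSpace ℝ W]
    [NormedAddCommGroup W'] [NormedSpace ℝ W'] {L : ℝ → E →L[ℝ] Y} {Φ : ℝ → W →L[ℝ] W'}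
    (hL : Continuous L) (hΦ : Continuous Φ) {Ω : Set (ℝ × Y)} {F : ℝ × Y → W}
    (hF : ContinuousOn F Ω) :
    ContinuousOn (fun z : E × ℝ => Φ z.2 (F (z.2, L z.2 z.1))) {z | (z.2, L z.2 z.1) ∈ Ω} := by
  have h1 : Continuous fun z : E × ℝ => (z.2, L z.2 z.1) := by fun_prop
  exact ((hΦ.comp continuous_snd).continuousOn).clm_apply
    (hF.comp h1.continuousOn fun z hz => hz)

/-- Differentiation under the integral sign; the dominating function is a constant. -/
theorem hasFDerivAt_integral_comp {W W' : Type} [NormedAddCommGroup W] [NormedSpace ℝ W]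
    [NormedAddCommGroup W'] [NormedSpace ℝ W'] {L : ℝ → E →L[ℝ] Y}
    {Φ : ℝ → W →L[ℝ] W'} (hL : Continuous L) (hΦ : Continuous Φ) {Ω : Set (ℝ × Y)}
    (hΩ : IsOpen Ω) {F : ℝ × Y → W} (hF : ContDiffOn ℝ ∞ F Ω) {τ : E}
    (hτ : ∀ t ∈ Icc (0 : ℝ) 1, (t, L t τ) ∈ Ω) :
    HasFDerivAt (fun τ => ∫ t in (0 : ℝ)..1, Φ t (F (t, L t τ)))
      (∫ t in (0 : ℝ)..1, integrandDeriv L Φ t (fderiv ℝ F (t, L t τ))) τ := by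
  have hcz : Continuous fun z : E × ℝ => (z.2, L z.2 z.1) := by fun_prop
  have hopen : IsOpen {z : E × ℝ | (z.2, L z.2 z.1) ∈ Ω} := hΩ.preimage hcz
  have hG := continuousOn_integrand hL hΦ hF.continuousOn
  have hG' := continuousOn_integrand hL (continuous_integrandDeriv hL hΦ)
    (hF.continuousOn_fderiv_of_isOpen hΩ (by simp))
  have hslice : ∀ {V : Type} [NormedAddCommGroup V] {G : E × ℝ → V},
      ContinuousOn G {z : E × ℝ | (z.2, L z.2 z.1) ∈ Ω} → ∀ x : E,
      (∀ t ∈ Icc (0 : ℝ) 1, (t, L t x) ∈ Ω) → ContinuousOn (fun t => G (x, t)) (Icc 0 1) :=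
    fun hG x hx => hG.comp (by fun_prop) fun t ht => hx t ht
  have hbd := isCompact_Icc.exists_bound_of_continuousOn (hslice hG' τ hτ)
  obtain ⟨C, hC⟩ := hbd
  -- Compactness of [0, 1] yields one neighbourhood of τ on which the integrand is defined and its
  -- derivative is bounded, uniformly in t.
  have hev : ∀ᶠ x in 𝓝 τ, ∀ t ∈ Icc (0 : ℝ) 1, (t, L t x) ∈ Ω ∧
      ‖integrandDeriv L Φ t (fderiv ℝ F (t, L t x))‖ < C + 1 := by
    refine isCompact_Icc.eventually_forall_of_forall_eventually fun t ht => ?_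
    have hmem : {z : E × ℝ | (z.2, L z.2 z.1) ∈ Ω} ∈ 𝓝 (τ, t) := hopen.mem_nhds (hτ t ht)
    have h1 := (hG'.continuousAt hmem).norm
    have h2 := h1.eventually (gt_mem_nhds (lt_of_le_of_lt (hC t ht) (lt_add_one C)))
    filter_upwards [hmem, h2] with z hz1 hz2 using ⟨hz1, hz2⟩
  have hIoc : Set.uIoc (0 : ℝ) 1 ⊆ Icc 0 1 := by
    rw [uIoc_of_le zero_le_one]
    exact Ioc_subset_Icc_self
  have hmeas : ∀ {V : Type} [NormedAddCommGroup V] {g : ℝ → V}, ContinuousOn g (Icc 0 1) →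
      AEStronglyMeasurable g (volume.restrict (Set.uIoc (0 : ℝ) 1)) := fun hg => by
    rw [uIoc_of_le zero_le_one]
    exact ((hg.aestronglyMeasurable_of_isCompact isCompact_Icc measurableSet_Icc).mono_measure
      (Measure.restrict_mono Ioc_subset_Icc_self le_rfl))
  refine (intervalIntegral.hasFDerivAt_integral_of_dominated_of_fderiv_le
    (bound := fun _ => C + 1)
    (F' := fun x t => integrandDeriv L Φ t (fderiv ℝ F (t, L t x))) hev ?_ ?_ ?_ ?_ ?_ ?_)
  · filter_upwards [hev] with x hx
    exact hmeas (hslice hG x fun t ht => (hx t ht).1)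
  · refine ContinuousOn.intervalIntegrable ?_
    rw [uIcc_of_le zero_le_one]
    exact hslice hG τ hτ
  · exact hmeas (hslice hG' τ hτ)
  · exact Eventually.of_forall fun t ht x hx => (hx t (hIoc ht)).2.le
  · exact intervalIntegrable_const
  · refine Eventually.of_forall fun t ht x hx => ?_
    have h1 : DifferentiableAt ℝ F (t, L t x) :=
      (hF.contDiffAt (hΩ.mem_nhds (hx t (hIoc ht)).1)).differentiableAt (by simp)
    have h2 : HasFDerivAt (fun x : E => (t, L t x)) ((ContinuousLinearMap.inr ℝ ℝ Y).comp (L t)) x := by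
      exact (hasFDerivAt_const t x).prodMk (L t).hasFDerivAt
    exact (Φ t).hasFDerivAt.comp x (h1.hasFDerivAt.comp x h2)

/-- The derivative of such an integral is an integral of the same kind, with dF in place of F and
`integrandDeriv` in place of Φ. The factor Φ and the arbitrary target spaces are there to make this
induction close. -/
theorem contDiffOn_integral_comp (n : ℕ) : ∀ {W W' : Type} [NormedAddCommGroup W]
    [NormedSpace ℝ W] [NormedAddCommGroup W'] [NormedSpace ℝ W'] {L : ℝ → E →L[ℝ] Y}
    {Φ : ℝ → W →L[ℝ] W'} (_ : Continuous L) (_ : Continuous Φ) {Ω : Set (ℝ × Y)}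
    (_ : IsOpen Ω) {F : ℝ × Y → W} (_ : ContDiffOn ℝ ∞ F Ω) {U : Set E} (_ : IsOpen U)
    (_ : ∀ τ ∈ U, ∀ t ∈ Icc (0 : ℝ) 1, (t, L t τ) ∈ Ω),
    ContDiffOn ℝ n (fun τ => ∫ t in (0 : ℝ)..1, Φ t (F (t, L t τ))) U := by
  induction n with
  | zero =>
    intro W W' _ _ _ _ L Φ hL hΦ Ω hΩ F hF U hU h
    exact contDiffOn_zero.2 fun τ hτ =>
      (hasFDerivAt_integral_comp hL hΦ hΩ hF (h τ hτ)).continuousAt.continuousWithinAt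
  | succ n ih =>
    intro W W' _ _ _ _ L Φ hL hΦ Ω hΩ F hF U hU h
    have hd := fun τ (hτ : τ ∈ U) => hasFDerivAt_integral_comp hL hΦ hΩ hF (h τ hτ)
    rw [show ((n + 1 : ℕ) : WithTop ℕ∞) = (n : WithTop ℕ∞) + 1 by push_cast; rfl,
      contDiffOn_succ_iff_fderiv_of_isOpen hU]
    refine ⟨fun τ hτ => (hd τ hτ).differentiableAt.differentiableWithinAt, by simp, ?_⟩
    exact (ih hL (continuous_integrandDeriv hL hΦ) hΩ (hF.fderiv_of_isOpen hΩ (by simp)) hU h).congr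
      fun τ hτ => (hd τ hτ).fderiv

end ParametricIntegral

/-! ### Smooth maps are sc-smooth -/

/-- The constant scale on a normed space. -/
abbrev constScale (W : Type) [NormedAddCommGroup W] [NormedSpace ℝ W] : ScScale where
  X := fun _ => W
  incl := fun _ => ContinuousLinearMap.id ℝ W
  incl_injective := fun _ => Function.injective_id

theorem constScale_toZero (W : Type) [NormedAddCommGroup W] [NormedSpace ℝ W] (m : ℕ) (w : W) :
    (constScale W).toZero m w = w := by
  induction m with
  | zero => rfl
  | succ m ih => exact ih

/-- Restriction to a finer level preserves continuity and differentiability, and the tangent map (x,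
h) ↦ (f x, df(x) h) is again smooth on an open set. Its target is the constant scale on W × W, so
the induction runs over all normed spaces W. -/
theorem isScClass_of_contDiffOn (k : ℕ) : ∀ (E : ScScale) {W : Type} [NormedAddCommGroup W]
    [NormedSpace ℝ W] {f : E.X 0 → W} {U : Set (E.X 0)}, IsOpen U → ContDiffOn ℝ ∞ f U →
    ScScale.IsScClass k E (constScale W) f U := by
  have h0 : ∀ (E : ScScale) {W : Type} [NormedAddCommGroup W] [NormedSpace ℝ W]
      {f : E.X 0 → W} {U : Set (E.X 0)}, ContDiffOn ℝ ∞ f U →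
      ScScale.IsSc0 E (constScale W) f U := by
    intro E W _ _ f U hf m
    refine ⟨fun x => f (E.toZero m x), ?_, fun x _ => constScale_toZero W m _⟩
    exact hf.continuousOn.comp (E.toZero m).continuous.continuousOn fun x hx => hx
  induction k with
  | zero => exact fun E W _ _ f U _ hf => h0 E hf
  | succ k ih =>
    intro E W _ _ f U hU hf
    refine ⟨h0 E hf, fun x => f (E.incl 0 x), fun x => fderiv ℝ f (E.incl 0 x),
      fun x hx => ⟨rfl, ?_⟩, ?_⟩
    · have h1 : DifferentiableAt ℝ f (E.incl 0 x) :=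
        (hf.contDiffAt (hU.mem_nhds hx)).differentiableAt (by simp)
      exact h1.hasFDerivAt.comp x (E.incl 0).hasFDerivAt
    · have hc : ContDiff ℝ ∞ fun p : E.tangent.X 0 => E.incl 0 p.1 :=
        (E.incl 0).contDiff.comp contDiff_fst
      refine ih E.tangent (W := W × W) (hU.preimage hc.continuous) ?_
      exact (hf.comp hc.contDiffOn fun p hp => hp).prodMk
        (((hf.fderiv_of_isOpen hU (by simp)).comp hc.contDiffOn fun p hp => hp).clm_apply
          contDiffOn_snd)

theorem isScSmoothOn_of_contDiffOn (E : ScScale) {f : E.X 0 → ℝ} {U : Set (E.X 0)}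
    (hU : IsOpen U) (hf : ContDiffOn ℝ ∞ f U) : ScScale.IsScSmoothOn E ScScale.real f U :=
  fun k => isScClass_of_contDiffOn k E hU hf

/-! ### Evaluation of `W^{2,2}` functions and of their derivatives -/

namespace Sob

/-- The evaluation at a point, as a continuous linear functional. -/
def evalL (k : ℕ) (t : ℝ) : Sob (k + 1) →L[ℝ] ℝ :=
  LinearMap.mkContinuous
    { toFun := fun τ => τ.fn (t : S1)
      map_add' := fun _ _ => rfl
      map_smul' := fun _ _ => rfl } 2 fun τ => abs_fn_le τ t

theorem evalL_apply {k : ℕ} (t : ℝ) (τ : Sob (k + 1)) : evalL k t τ = τ.fn (t : S1) := rfl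

/-- The Hölder estimate with exponent 1/2 is uniform on the unit ball, so evaluations depend on the
point continuously in operator norm and not only strongly. -/
theorem continuous_evalL (k : ℕ) : Continuous (evalL k) := by
  rw [continuous_iff_continuousAt]
  intro t
  rw [ContinuousAt, tendsto_iff_norm_sub_tendsto_zero]
  have h1 : Tendsto (fun s : ℝ => √|s - t|) (𝓝 t) (𝓝 0) := by
    have : Continuous fun s : ℝ => √|s - t| := by fun_prop
    simpa using this.tendsto t
  refine squeeze_zero' (Eventually.of_forall fun _ => norm_nonneg _) ?_ h1
  filter_upwards [Metric.closedBall_mem_nhds t one_pos] with s hs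
  exact ContinuousLinearMap.opNorm_le_bound _ (Real.sqrt_nonneg _) fun τ => abs_fn_sub_le τ hs

/-- The evaluation of a function and of its derivative at a point. -/
def jetL (t : ℝ) : Sob 2 →L[ℝ] ℝ × ℝ :=
  (ContinuousLinearMap.inl ℝ ℝ ℝ).comp (evalL 1 t) +
    (ContinuousLinearMap.inr ℝ ℝ ℝ).comp ((evalL 0 t).comp (derivL 0))

theorem jetL_apply (t : ℝ) (τ : Sob 2) :
    jetL t τ = (τ.fn (t : S1), (derivL 0 τ).fn (t : S1)) := by
  simp [jetL, evalL_apply]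

theorem continuous_jetL : Continuous jetL := by
  have h1 := continuous_evalL 1
  have h2 := continuous_evalL 0
  unfold jetL
  fun_prop

theorem continuous_fn (k : ℕ) : Continuous (fn (k := k + 1)) := by
  rw [continuous_iff_continuousAt]
  intro τ
  rw [ContinuousAt, tendsto_iff_norm_sub_tendsto_zero]
  have h1 : Tendsto (fun σ : Sob (k + 1) => 2 * ‖σ - τ‖) (𝓝 τ) (𝓝 0) := by
    have : Continuous fun σ : Sob (k + 1) => 2 * ‖σ - τ‖ := by fun_prop
    simpa using this.tendsto τ
  refine squeeze_zero (fun _ => norm_nonneg _) (fun σ => ?_) h1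
  exact (ContinuousMap.norm_le _ (by positivity)).2 fun x => abs_fn_le (σ - τ) x

end Sob

end LengthFunctional
end

noncomputable section
namespace LengthFunctional

open Filter Topology

/-! ### Christoffel symbols of bilinear forms and change of coordinates -/

section Bilinear

variable {E P : Type*} [NormedAddCommGroup E] [NormedSpace ℝ E] [NormedAddCommGroup P]
  [NormedSpace ℝ P]

/-- The Christoffel symbols of the first kind of a field of bilinear forms. -/
def gammaForm (B : E → E →L[ℝ] E →L[ℝ] ℝ) (y u w z : E) : ℝ :=
  (fderiv ℝ B y u w z + fderiv ℝ B y w u z - fderiv ℝ B y z u w) / 2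

theorem hasFDerivAt_pullback {G : P → P →L[ℝ] P →L[ℝ] ℝ} {σ : E → P} {B : E → E →L[ℝ] E →L[ℝ] ℝ}
    {y : E} (hσ : ContDiffAt ℝ 2 σ y) (hG : DifferentiableAt ℝ G (σ y))
    (hB : DifferentiableAt ℝ B y)
    (hBG : ∀ᶠ x in 𝓝 y, ∀ u w, B x u w = G (σ x) (fderiv ℝ σ x u) (fderiv ℝ σ x w)) (u w z : E) :
    fderiv ℝ B y u w z = fderiv ℝ G (σ y) (fderiv ℝ σ y u) (fderiv ℝ σ y w) (fderiv ℝ σ y z) +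
      G (σ y) (fderiv ℝ (fderiv ℝ σ) y u w) (fderiv ℝ σ y z) +
      G (σ y) (fderiv ℝ σ y w) (fderiv ℝ (fderiv ℝ σ) y u z) := by
  have h1 : HasFDerivAt σ (fderiv ℝ σ y) y := (hσ.differentiableAt (by simp)).hasFDerivAt
  have h2 : HasFDerivAt (fderiv ℝ σ) (fderiv ℝ (fderiv ℝ σ) y) y :=
    ((hσ.fderiv_right (m := 1) (by norm_num)).differentiableAt (by simp)).hasFDerivAt
  have h0 : HasFDerivAt (fun x => G (σ x)) ((fderiv ℝ G (σ y)).comp (fderiv ℝ σ y)) y :=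
    HasFDerivAt.comp (g := G) y hG.hasFDerivAt h1
  have h3 := ((h0.clm_apply (h2.clm_apply (hasFDerivAt_const w y))).clm_apply
    (h2.clm_apply (hasFDerivAt_const z y)))
  have h4 := (hB.hasFDerivAt.clm_apply (hasFDerivAt_const w y)).clm_apply (hasFDerivAt_const z y)
  have h5 := h3.congr_of_eventuallyEq
    (f₁ := fun x => B x w z) (hBG.mono fun x hx => hx w z)
  have h6 := congrArg (fun T : E →L[ℝ] ℝ => T u) (h4.unique h5)
  simp only [add_apply, ContinuousLinearMap.comp_apply, ContinuousLinearMap.flip_apply,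
    zero_apply, map_zero, zero_add] at h6
  rw [h6]
  ring

/-- The transformation law of the Christoffel symbols. The product rule produces six terms with
second derivatives of σ; by the symmetry of d²σ and of G four of them cancel in pairs and the other
two coincide. -/
theorem gammaForm_pullback {G : P → P →L[ℝ] P →L[ℝ] ℝ} {σ : E → P}
    {B : E → E →L[ℝ] E →L[ℝ] ℝ} {y : E} (hσ : ContDiffAt ℝ 2 σ y)
    (hG : DifferentiableAt ℝ G (σ y)) (hB : DifferentiableAt ℝ B y)
    (hsymm : ∀ u w, G (σ y) u w = G (σ y) w u)
    (hBG : ∀ᶠ x in 𝓝 y, ∀ u w, B x u w = G (σ x) (fderiv ℝ σ x u) (fderiv ℝ σ x w)) (u w z : E) :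
    gammaForm B y u w z =
      gammaForm G (σ y) (fderiv ℝ σ y u) (fderiv ℝ σ y w) (fderiv ℝ σ y z) +
      G (σ y) (fderiv ℝ (fderiv ℝ σ) y u w) (fderiv ℝ σ y z) := by
  have hs : ∀ a b, fderiv ℝ (fderiv ℝ σ) y a b = fderiv ℝ (fderiv ℝ σ) y b a := fun a b =>
    (hσ.isSymmSndFDerivAt (by simp)).eq a b
  unfold gammaForm
  rw [hasFDerivAt_pullback hσ hG hB hBG, hasFDerivAt_pullback hσ hG hB hBG,
    hasFDerivAt_pullback hσ hG hB hBG, hs w u, hs z u, hs z w,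
    hsymm (fderiv ℝ (fderiv ℝ σ) y u z) (fderiv ℝ σ y w)]
  ring

end Bilinear

/-! ### Pull-back of the metric -/

variable {M : Type*} [TopologicalSpace M] [ChartedSpace Plane M] [IsManifold (𝓡 2) ∞ M]

/-- The metric at a point, as a bilinear form on the plane. -/
def innerAt (g : RiemMetric M) (p : M) : Plane →L[ℝ] Plane →L[ℝ] ℝ := g.inner p

theorem innerAt_symm (g : RiemMetric M) (p : M) (u w : Plane) :
    innerAt g p u w = innerAt g p w u := g.symm p u w

theorem innerAt_pos (g : RiemMetric M) (p : M) {u : Plane} (hu : u ≠ 0) : 0 < innerAt g p u u :=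
  g.pos p u hu

variable {E : Type*} [NormedAddCommGroup E] [NormedSpace ℝ E]

/-- The derivative of a map into `M`, with values in the model plane. -/
def dM (φ : E → M) (y : E) : E →L[ℝ] Plane := mfderiv 𝓘(ℝ, E) (𝓡 2) φ y

/-- The pull-back of the metric under a map from a vector space to `M`. -/
def pullMetric (g : RiemMetric M) (φ : E → M) (y : E) : E →L[ℝ] E →L[ℝ] ℝ :=
  (innerAt g (φ y)).bilinearComp (dM φ y) (dM φ y)

theorem pullMetric_apply (g : RiemMetric M) (φ : E → M) (y u w : E) :
    pullMetric g φ y u w = innerAt g (φ y) (dM φ y u) (dM φ y w) := rfl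

theorem pullMetric_symm (g : RiemMetric M) (φ : E → M) (y u w : E) :
    pullMetric g φ y u w = pullMetric g φ y w u := innerAt_symm _ _ _ _

theorem chartMetric_eq (g : RiemMetric M) (p : M) (y u w : Plane) :
    chartMetric g p y u w = pullMetric g (extChartAt (𝓡 2) p).symm y u w := rfl

/-- In finite dimension it suffices to test against constant vectors u. The map y ↦ dφ_y(u) is a
smooth map to the tangent bundle, being the tangent map of φ composed with a constant section. -/
theorem contDiffOn_pullMetric [FiniteDimensional ℝ E] (g : RiemMetric M) {φ : E → M} {U : Set E}
    (hU : IsOpen U) (hφ : ContMDiffOn 𝓘(ℝ, E) (𝓡 2) ∞ φ U) :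
    ContDiffOn ℝ ∞ (pullMetric g φ) U := by
  rw [contDiffOn_clm_apply]
  intro u
  rw [contDiffOn_clm_apply]
  intro w
  rw [← contMDiffOn_iff_contDiffOn]
  have hvec : ∀ u : E, ContMDiffOn 𝓘(ℝ, E) ((𝓡 2).prod 𝓘(ℝ, Plane)) ∞
      (fun y => (⟨φ y, mfderiv 𝓘(ℝ, E) (𝓡 2) φ y u⟩ : TangentBundle (𝓡 2) M)) U := by
    intro u
    have h1 := hφ.contMDiffOn_tangentMapWithin (m := ∞) (by simp) hU.uniqueMDiffOn
    have h2 : ContMDiff 𝓘(ℝ, E) (𝓘(ℝ, E).prod 𝓘(ℝ, E)) ∞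
        (fun y => (⟨y, u⟩ : TangentBundle 𝓘(ℝ, E) E)) :=
      contMDiff_vectorSpace_iff_contDiff (V := fun _ => u) |>.2 contDiff_const
    refine (h1.comp h2.contMDiffOn fun y hy => hy).congr fun y hy => ?_
    simp only [Function.comp, tangentMapWithin]
    rw [mfderivWithin_of_isOpen hU hy]
  have h3 : ContMDiffOn 𝓘(ℝ, E) ((𝓡 2).prod 𝓘(ℝ, ℝ)) ∞
      (fun y => Bundle.TotalSpace.mk' ℝ (E := Bundle.Trivial M ℝ) (φ y) (g.inner (φ y)
        (mfderiv 𝓘(ℝ, E) (𝓡 2) φ y u) (mfderiv 𝓘(ℝ, E) (𝓡 2) φ y w))) U := by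
    apply ContMDiffOn.clm_bundle_apply₂ (F₁ := Plane) (F₂ := Plane)
    · exact g.contMDiff.comp_contMDiffOn hφ
    · exact hvec u
    · exact hvec w
  intro y hy
  have h4 := h3 y hy
  simp only [Bundle.contMDiffWithinAt_totalSpace] at h4
  exact h4.2

theorem contDiffOn_chart (p : M) :
    ContMDiffOn 𝓘(ℝ, Plane) (𝓡 2) ∞ (extChartAt (𝓡 2) p).symm (extChartAt (𝓡 2) p).target :=
  contMDiffOn_extChartAt_symm p

theorem christoffel_eq (g : RiemMetric M) (p : M) {y : Plane} (hy : y ∈ (extChartAt (𝓡 2) p).target)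
    (u w z : Plane) :
    christoffel g p y u w z = gammaForm (pullMetric g (extChartAt (𝓡 2) p).symm) y u w z := by
  have hd : DifferentiableAt ℝ (pullMetric g (extChartAt (𝓡 2) p).symm) y :=
    ((contDiffOn_pullMetric g (isOpen_extChartAt_target p) (contDiffOn_chart p)).contDiffAt
      ((isOpen_extChartAt_target p).mem_nhds hy)).differentiableAt (by simp)
  have key : ∀ a b c : Plane, fderiv ℝ (fun y' => chartMetric g p y' a b) y c =
      fderiv ℝ (pullMetric g (extChartAt (𝓡 2) p).symm) y c a b := by
    intro a b c
    have h := (hd.hasFDerivAt.clm_apply (hasFDerivAt_const a y)).clm_apply (hasFDerivAt_const b y)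
    have h' := congrArg (fun T : Plane →L[ℝ] ℝ => T c) h.fderiv
    refine h'.trans ?_
    simp
  unfold christoffel gammaForm
  rw [key, key, key]

/-- The chart at `p` has derivative, with values in the model plane. -/
def dChart (p q : M) : Plane →L[ℝ] Plane := mfderiv (𝓡 2) 𝓘(ℝ, Plane) (extChartAt (𝓡 2) p) q

theorem mdifferentiableAt_extChartAt' {p q : M} (hq : q ∈ (extChartAt (𝓡 2) p).source) :
    MDifferentiableAt (𝓡 2) 𝓘(ℝ, Plane) (extChartAt (𝓡 2) p) q := by
  refine (contMDiffAt_extChartAt' (n := ∞) ?_).mdifferentiableAt (by simp)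
  rwa [extChartAt_source] at hq

/-- A smooth map to `M` read in a chart. -/
theorem chart_facts {φ : E → M} {U : Set E} (hU : IsOpen U)
    (hφ : ContMDiffOn 𝓘(ℝ, E) (𝓡 2) ∞ φ U) {y : E} (hy : y ∈ U) (p : M)
    (hp : φ y ∈ (extChartAt (𝓡 2) p).source) :
    ContDiffAt ℝ ∞ (fun x => extChartAt (𝓡 2) p (φ x)) y ∧
    (∀ u, fderiv ℝ (fun x => extChartAt (𝓡 2) p (φ x)) y u = dChart p (φ y) (dM φ y u)) ∧
    ∀ u, dM φ y u = dM (extChartAt (𝓡 2) p).symm (extChartAt (𝓡 2) p (φ y))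
      (fderiv ℝ (fun x => extChartAt (𝓡 2) p (φ x)) y u) := by
  have hφy : ContMDiffAt 𝓘(ℝ, E) (𝓡 2) ∞ φ y := hφ.contMDiffAt (hU.mem_nhds hy)
  have hmd : MDifferentiableAt 𝓘(ℝ, E) (𝓡 2) φ y := hφy.mdifferentiableAt (by simp)
  have h1 : ContMDiffAt 𝓘(ℝ, E) 𝓘(ℝ, Plane) ∞ (fun x => extChartAt (𝓡 2) p (φ x)) y := by
    have : ContMDiffAt (𝓡 2) 𝓘(ℝ, Plane) ∞ (extChartAt (𝓡 2) p) (φ y) :=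
      contMDiffAt_extChartAt' (by rwa [extChartAt_source] at hp)
    exact this.comp y hφy
  have h2 := h1.contDiffAt
  have h3 : ∀ u, fderiv ℝ (fun x => extChartAt (𝓡 2) p (φ x)) y u =
      dChart p (φ y) (dM φ y u) := by
    intro u
    rw [← mfderiv_eq_fderiv]
    have := mfderiv_comp y (mdifferentiableAt_extChartAt' hp) hmd
    exact congrArg (fun T : E →L[ℝ] Plane => T u) this
  refine ⟨h2, h3, fun u => ?_⟩
  have htgt : extChartAt (𝓡 2) p (φ y) ∈ (extChartAt (𝓡 2) p).target :=
    (extChartAt (𝓡 2) p).map_source hp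
  have hsd : MDifferentiableAt 𝓘(ℝ, Plane) (𝓡 2) (extChartAt (𝓡 2) p).symm
      (extChartAt (𝓡 2) p (φ y)) :=
    ((contDiffOn_chart p).contMDiffAt ((isOpen_extChartAt_target p).mem_nhds htgt)).mdifferentiableAt
      (by simp)
  have hev : φ =ᶠ[𝓝 y] fun x => (extChartAt (𝓡 2) p).symm (extChartAt (𝓡 2) p (φ x)) := by
    have : ∀ᶠ x in 𝓝 y, φ x ∈ (extChartAt (𝓡 2) p).source :=
      hφy.continuousAt.eventually ((isOpen_extChartAt_source p).mem_nhds hp)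
    exact this.mono fun x hx => ((extChartAt (𝓡 2) p).left_inv hx).symm
  have h4 : mfderiv 𝓘(ℝ, E) (𝓡 2) φ y = mfderiv 𝓘(ℝ, E) (𝓡 2)
      (fun x => (extChartAt (𝓡 2) p).symm (extChartAt (𝓡 2) p (φ x))) y := hev.mfderiv_eq
  have h5 := mfderiv_comp y hsd (h1.mdifferentiableAt (by simp))
  have h6 : dM φ y = (dM (extChartAt (𝓡 2) p).symm (extChartAt (𝓡 2) p (φ y))).comp
      (mfderiv 𝓘(ℝ, E) 𝓘(ℝ, Plane) (fun x => extChartAt (𝓡 2) p (φ x)) y) := h4.trans h5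
  rw [h6, mfderiv_eq_fderiv]
  rfl

/-- The covariant derivative of a field `V = dφ(Y)` along a curve `c = φ ∘ y`, in the coordinates
given by `φ`. -/
theorem innerCovDeriv_eq [FiniteDimensional ℝ E] (g : RiemMetric M) {φ : E → M} {U : Set E}
    (hU : IsOpen U) (hφ : ContMDiffOn 𝓘(ℝ, E) (𝓡 2) ∞ φ U) {c : ℝ → M}
    {V : ∀ t, TangentSpace (𝓡 2) (c t)} {y Y : ℝ → E} {t : ℝ} {y' Y' ζ : E}
    {Z : TangentSpace (𝓡 2) (c t)} (hyU : y t ∈ U) (hy : HasDerivAt y y' t)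
    (hY : HasDerivAt Y Y' t)
    (hcV : ∀ᶠ s in 𝓝 t, c s = φ (y s) ∧ (V s : Plane) = dM φ (y s) (Y s)) (hZ : (Z : Plane) = dM φ (y t) ζ) :
    innerCovDeriv g c V t Z =
      pullMetric g φ (y t) Y' ζ + gammaForm (pullMetric g φ) (y t) y' (Y t) ζ := by
  have hc : c t = φ (y t) := hcV.self_of_nhds.1
  -- The centre of the chart gets its own name, so that rewriting the point `c t` does not change
  -- the chart.
  obtain ⟨p, hp⟩ : ∃ p, p = c t := ⟨_, rfl⟩
  set σ : E → Plane := fun x => extChartAt (𝓡 2) p (φ x) with hσ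
  set G := pullMetric g (extChartAt (𝓡 2) p).symm with hG
  have hsrc : φ (y t) ∈ (extChartAt (𝓡 2) p).source := by
    rw [← hc, ← hp]
    exact mem_extChartAt_source p
  have hφc : ContinuousAt φ (y t) := (hφ.contMDiffAt (hU.mem_nhds hyU)).continuousAt
  have hevU : ∀ᶠ x in 𝓝 (y t), x ∈ U ∧ φ x ∈ (extChartAt (𝓡 2) p).source :=
    (hU.eventually_mem hyU).and
      (hφc.eventually ((isOpen_extChartAt_source p).mem_nhds hsrc))
  obtain ⟨hσd, -, -⟩ := chart_facts hU hφ hyU p hsrc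
  have htgt : σ (y t) ∈ (extChartAt (𝓡 2) p).target := (extChartAt (𝓡 2) p).map_source hsrc
  have hGd : DifferentiableAt ℝ G (σ (y t)) :=
    ((contDiffOn_pullMetric g (isOpen_extChartAt_target p) (contDiffOn_chart p)).contDiffAt
      ((isOpen_extChartAt_target p).mem_nhds htgt)).differentiableAt (by simp)
  have hBd : DifferentiableAt ℝ (pullMetric g φ) (y t) :=
    ((contDiffOn_pullMetric g hU hφ).contDiffAt (hU.mem_nhds hyU)).differentiableAt (by simp)
  have hBG : ∀ᶠ x in 𝓝 (y t), ∀ u w,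
      pullMetric g φ x u w = G (σ x) (fderiv ℝ σ x u) (fderiv ℝ σ x w) := by
    filter_upwards [hevU] with x hx u w
    obtain ⟨-, -, h3⟩ := chart_facts hU hφ hx.1 p hx.2
    rw [pullMetric_apply, h3 u, h3 w, hG, pullMetric_apply,
      (extChartAt (𝓡 2) p).left_inv hx.2]
  have hσ1 : HasFDerivAt σ (fderiv ℝ σ (y t)) (y t) := (hσd.differentiableAt (by simp)).hasFDerivAt
  have hσ2 : HasFDerivAt (fderiv ℝ σ) (fderiv ℝ (fderiv ℝ σ) (y t)) (y t) :=
    ((hσd.fderiv_right (m := 1) (by norm_cast)).differentiableAt (by simp)).hasFDerivAt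
  have hc1 : (fun s => extChartAt (𝓡 2) p (c s)) =ᶠ[𝓝 t] fun s => σ (y s) :=
    hcV.mono fun s hs => congrArg (extChartAt (𝓡 2) p) hs.1
  have hd1 : deriv (fun s => extChartAt (𝓡 2) p (c s)) t = fderiv ℝ σ (y t) y' := by
    rw [hc1.deriv_eq]
    exact (hσ1.comp_hasDerivAt t hy).deriv
  have hV1 : (fun s => dChart p (c s) (V s)) =ᶠ[𝓝 t] fun s => fderiv ℝ σ (y s) (Y s) := by
    filter_upwards [hy.continuousAt.eventually hevU, hcV] with s hs hs'
    obtain ⟨-, h2, -⟩ := chart_facts hU hφ hs.1 p hs.2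
    rw [h2 (Y s), ← hs'.2, hs'.1]
  have hd2 : deriv (fun s => dChart p (c s) (V s)) t =
      fderiv ℝ (fderiv ℝ σ) (y t) y' (Y t) + fderiv ℝ σ (y t) Y' := by
    rw [hV1.deriv_eq]
    exact ((hσ2.comp_hasDerivAt t hy).clm_apply hY).deriv
  have hV1t : dChart p (c t) (V t) = fderiv ℝ σ (y t) (Y t) := hV1.self_of_nhds
  have hZ1 : dChart p (c t) Z = fderiv ℝ σ (y t) ζ := by
    obtain ⟨-, h2, -⟩ := chart_facts hU hφ hyU p hsrc
    rw [h2 ζ, ← hc]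
    exact congrArg _ hZ
  have hcp : extChartAt (𝓡 2) p (c t) = σ (y t) := congrArg (extChartAt (𝓡 2) p) hc
  have hdef : innerCovDeriv g c V t Z =
      chartMetric g p (extChartAt (𝓡 2) p (c t)) (deriv (fun s => dChart p (c s) (V s)) t)
        (dChart p (c t) Z) +
      christoffel g p (extChartAt (𝓡 2) p (c t)) (deriv (fun s => extChartAt (𝓡 2) p (c s)) t)
        (dChart p (c t) (V t)) (dChart p (c t) Z) := by
    subst hp
    rfl
  -- The term d²σ(y', Y) in the derivative of the field is exactly the correction term in the
  -- transformation law.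
  rw [hdef, hd1, hd2, hV1t, hZ1, hcp, christoffel_eq g p htgt, chartMetric_eq,
    gammaForm_pullback (hσd.of_le (by norm_cast)) hGd hBd (fun u w => pullMetric_symm _ _ _ _ _) hBG,
    hBG.self_of_nhds, map_add, add_apply]
  ring

end LengthFunctional
end

noncomputable section
namespace LengthFunctional

open Filter Topology

set_option linter.unusedSectionVars false

/-! ### Sobolev loops in terms of germs -/

theorem HAt.exists_w1On {k : ℕ} {f : ℝ → ℝ} {t ε : ℝ} (hε : 0 < ε) (h : HAt k f t) :
    ∃ δ > 0, δ ≤ ε ∧ ∀ j ≤ k, W1On (deriv^[j] f) (t - δ) (t + δ) := by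
  have key : ∀ n ≤ k, ∃ δ > 0, δ ≤ ε ∧ ∀ j ≤ n, W1On (deriv^[j] f) (t - δ) (t + δ) := by
    intro n
    induction n with
    | zero =>
      intro hn
      obtain ⟨δ, h0, h1, h2⟩ := (h.iterate_deriv hn).exists_le hε
      exact ⟨δ, h0, h1, fun j hj => by rwa [Nat.le_zero.1 hj]⟩
    | succ n ih =>
      intro hn
      obtain ⟨δ, h0, h1, h2⟩ := ih (by omega)
      obtain ⟨δ', h0', h1', h2'⟩ := (h.iterate_deriv hn).exists_le h0
      refine ⟨δ', h0', h1'.trans h1, fun j hj => ?_⟩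
      rcases Nat.lt_or_ge n j with hj' | hj'
      · rwa [show j = n + 1 by omega]
      · exact (h2 j hj').mono (by linarith) (by linarith) (by linarith)
  exact key k le_rfl

theorem HAt.comp_plane {k : ℕ} {φ : Plane → ℝ} {c : ℝ → Plane} {t : ℝ}
    (hφ : ContDiffAt ℝ ∞ φ (c t)) (hc : ∀ i, HAt k (fun s => c s i) t) :
    HAt k (fun s => φ (c s)) t := by
  have h1 : ∀ p : Plane, (!₂[p 0, p 1] : Plane) = p := fun p => by
    ext i
    fin_cases i <;> rfl
  have h2 : ContDiff ℝ ∞ fun q : ℝ × ℝ => (!₂[q.1, q.2] : Plane) := by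
    rw [contDiff_euclidean]
    intro i
    fin_cases i
    · exact contDiff_fst
    · exact contDiff_snd
  have h3 := HAt.comp₂ (φ := fun q : ℝ × ℝ => φ !₂[q.1, q.2]) (f := fun s => c s 0)
    (g := fun s => c s 1) (t := t) ?_ (hc 0) (hc 1)
  · simpa only [h1] using h3
  · refine ContDiffAt.comp (g := φ) _ ?_ h2.contDiffAt
    simpa only [h1] using hφ

section Loops

variable {M : Type*} [TopologicalSpace M] [ChartedSpace Plane M]

theorem isSobolevLoop_of_chart {k : ℕ} {v : S1 → M} (hv : Continuous v)
    (h : ∀ (t : ℝ) (i : Fin 2),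
      HAt k (fun s : ℝ => extChartAt (𝓡 2) (v (t : S1)) (v (s : S1)) i) t) :
    IsSobolevLoop (k + 1) v := by
  refine ⟨hv, fun t => ?_⟩
  have hv' : Continuous fun s : ℝ => v (s : S1) := hv.comp (AddCircle.continuous_mk' 1)
  obtain ⟨ε, hε, h0⟩ := Metric.eventually_nhds_iff_ball.1 (hv'.continuousAt.eventually
    ((chartAt Plane (v (t : S1))).open_source.mem_nhds (mem_chart_source _ (v (t : S1)))))
  obtain ⟨δ₀, hδ₀, h1, h2⟩ := (h t 0).exists_w1On hε
  obtain ⟨δ₁, hδ₁, h3, h4⟩ := (h t 1).exists_w1On hδ₀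
  refine ⟨δ₁, hδ₁, fun s hs => h0 s ?_, ?_⟩
  · rw [Real.ball_eq_Ioo]
    exact ⟨by linarith [hs.1], by linarith [hs.2]⟩
  · refine IsSobolevOn.of_coord fun i => isSobolevOn_of_w1On (by linarith) fun j hj => ?_
    fin_cases i
    · exact (h2 j hj).mono (by linarith) (by linarith) (by linarith)
    · exact h4 j hj

theorem IsSobolevLoop.hAt_chart {k : ℕ} {v : S1 → M} (hv : IsSobolevLoop (k + 1) v) (t : ℝ)
    (i : Fin 2) : HAt k (fun s : ℝ => extChartAt (𝓡 2) (v (t : S1)) (v (s : S1)) i) t := by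
  obtain ⟨hc, h⟩ := hv
  obtain ⟨δ, hδ, h1, h2⟩ := h t
  refine hAt_of_isSobolevOn (h2.coord i) ?_ t ⟨by linarith, by linarith⟩
  have hv' : Continuous fun s : ℝ => v (s : S1) := hc.comp (AddCircle.continuous_mk' 1)
  have h3 : ContinuousOn (fun s : ℝ => extChartAt (𝓡 2) (v (t : S1)) (v (s : S1)))
      (Ioo (t - δ) (t + δ)) :=
    (continuousOn_extChartAt _).comp hv'.continuousOn fun s hs => by
      rw [extChartAt_source]
      exact h1 s hs
  exact (EuclideanSpace.proj (𝕜 := ℝ) i).continuous.comp_continuousOn h3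

variable [IsManifold (𝓡 2) ∞ M]

theorem IsSobolevLoop.hAt_comp {k : ℕ} {v : S1 → M} (hv : IsSobolevLoop (k + 1) v) {f : M → ℝ}
    {t : ℝ} (hf : ContMDiffAt (𝓡 2) 𝓘(ℝ, ℝ) ∞ f (v (t : S1))) :
    HAt k (fun s : ℝ => f (v (s : S1))) t := by
  have h1 := (contMDiffAt_iff_source_of_mem_source (mem_chart_source Plane (v (t : S1)))).1 hf
  rw [modelWithCornersSelf_coe, range_id, contMDiffWithinAt_univ] at h1
  have h2 := HAt.comp_plane h1.contDiffAt fun i => hv.hAt_chart t i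
  refine h2.congr ?_
  have hv' : Continuous fun s : ℝ => v (s : S1) := hv.1.comp (AddCircle.continuous_mk' 1)
  filter_upwards [hv'.continuousAt.eventually
    ((isOpen_extChartAt_source (I := 𝓡 2) (v (t : S1))).mem_nhds
      (mem_extChartAt_source (v (t : S1))))] with s hs
  exact congrArg f ((extChartAt (𝓡 2) (v (t : S1))).left_inv hs)

/-- A loop which is locally the image of a Sobolev curve in the plane under a smooth map. -/
theorem isSobolevLoop_of_local {k : ℕ} {v : S1 → M} (hv : Continuous v)
    (h : ∀ t : ℝ, ∃ (φ : ℝ × ℝ → M) (y₁ y₂ : ℝ → ℝ),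
      ContMDiffAt 𝓘(ℝ, ℝ × ℝ) (𝓡 2) ∞ φ (y₁ t, y₂ t) ∧ HAt k y₁ t ∧ HAt k y₂ t ∧
      ∀ᶠ s : ℝ in 𝓝 t, v (s : S1) = φ (y₁ s, y₂ s)) : IsSobolevLoop (k + 1) v := by
  refine isSobolevLoop_of_chart hv fun t i => ?_
  obtain ⟨φ, y₁, y₂, hφ, h1, h2, h3⟩ := h t
  have h4 : ContMDiffAt 𝓘(ℝ, ℝ × ℝ) 𝓘(ℝ, Plane) ∞
      (fun x => extChartAt (𝓡 2) (v (t : S1)) (φ x)) (y₁ t, y₂ t) := by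
    rw [h3.self_of_nhds]
    exact (contMDiffAt_extChartAt (n := ∞)).comp _ hφ
  have h5 : ContDiffAt ℝ ∞ (fun x => extChartAt (𝓡 2) (v (t : S1)) (φ x) i) (y₁ t, y₂ t) :=
    (EuclideanSpace.proj (𝕜 := ℝ) i).contDiff.contDiffAt.comp _ h4.contDiffAt
  refine (HAt.comp₂ h5 h1 h2).congr ?_
  filter_upwards [h3] with s hs
  rw [hs]

end Loops

/-! ### Loops in an annulus -/

variable {M : Type*} [TopologicalSpace M] [ChartedSpace Plane M] [IsManifold (𝓡 2) ∞ M]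

theorem velocity_eq {E : Type*} [NormedAddCommGroup E] [NormedSpace ℝ E] {φ : E → M} {v : S1 → M}
    {y : ℝ → E} {y' : E} {t : ℝ} (hφ : MDifferentiableAt 𝓘(ℝ, E) (𝓡 2) φ (y t))
    (hy : HasDerivAt y y' t) (h : ∀ᶠ s : ℝ in 𝓝 t, v (s : S1) = φ (y s)) :
    (velocity v t : Plane) = dM φ (y t) y' := by
  have h1 : mfderiv 𝓘(ℝ, ℝ) (𝓡 2) (fun s : ℝ => v (s : S1)) t =
      mfderiv 𝓘(ℝ, ℝ) (𝓡 2) (φ ∘ y) t := EventuallyEq.mfderiv_eq h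
  have h2 := mfderiv_comp t hφ hy.differentiableAt.mdifferentiableAt
  have h3 : mfderiv 𝓘(ℝ, ℝ) 𝓘(ℝ, E) y t (1 : ℝ) = y' := by
    rw [mfderiv_eq_fderiv]
    change fderiv ℝ y t 1 = y'
    rw [fderiv_apply_one_eq_deriv, hy.deriv]
  have h4 : (velocity v t : Plane) = dM φ (y t) (mfderiv 𝓘(ℝ, ℝ) 𝓘(ℝ, E) y t (1 : ℝ)) :=
    congrArg (fun T : ℝ →L[ℝ] Plane => T 1) (h1.trans h2)
  rw [h4, h3]

namespace Annulus

/-- The embedding of an annulus, as a map from the plane. -/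
def map (A : Annulus M) (p : ℝ × ℝ) : M := A.σ (p.1 : S1) p.2

/-- The domain of the embedding. -/
def strip (A : Annulus M) : Set (ℝ × ℝ) := {p | |p.2| < A.ε}

variable (A : Annulus M)

theorem isOpen_strip : IsOpen A.strip := isOpen_lt (by fun_prop) continuous_const

theorem contMDiffOn_map : ContMDiffOn 𝓘(ℝ, ℝ × ℝ) (𝓡 2) ∞ A.map A.strip := A.smooth

theorem contMDiffAt_map {p : ℝ × ℝ} (hp : p ∈ A.strip) :
    ContMDiffAt 𝓘(ℝ, ℝ × ℝ) (𝓡 2) ∞ A.map p := A.smooth.contMDiffAt (A.isOpen_strip.mem_nhds hp)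

theorem dM_injective {p : ℝ × ℝ} (hp : p ∈ A.strip) : Function.Injective (dM A.map p) :=
  A.immersive p hp

theorem continuous_graph {τ : S1 → ℝ} (hτ : Continuous τ) (h : ∀ x, |τ x| < A.ε) :
    Continuous (A.graph τ) := by
  refine (isQuotientMap_quotient_mk' (X := ℝ)).continuous_iff.2 ?_
  have h1 : Continuous fun t : ℝ => (t, τ (t : S1)) :=
    continuous_id.prodMk (hτ.comp (AddCircle.continuous_mk' 1))
  exact A.smooth.continuousOn.comp_continuous h1 fun t => h _

/-- The velocity is dσ(1, τ'), which is nonzero since dσ is injective; injectivity of the loop can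
be read off the first coordinate of σ. -/
theorem isEmbeddedLoop_graph {k : ℕ} (τ : Sob (k + 2)) (h : ∀ x, |τ.fn x| < A.ε) :
    IsEmbeddedLoop (k + 2) (A.graph τ.fn) := by
  refine ⟨isSobolevLoop_of_local (A.continuous_graph τ.fn.continuous h) fun t =>
    ⟨A.map, id, fun t => τ.fn (t : S1), A.contMDiffAt_map (h _),
      HAt.of_contDiffAt contDiff_id.contDiffAt, τ.hAt t, Eventually.of_forall fun _ => rfl⟩,
    fun x y hxy => (A.injective _ _ _ _ (h x) (h y) hxy).1, fun t ht => ?_⟩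
  have h1 := velocity_eq (v := A.graph τ.fn) (φ := A.map) (y := fun t : ℝ => (t, τ.fn (t : S1)))
    ((A.contMDiffAt_map (h (t : S1))).mdifferentiableAt (by simp))
    ((hasDerivAt_id t).prodMk (τ.hasDerivAt t)) (Eventually.of_forall fun _ => rfl)
  have h2 := (A.dM_injective (p := (t, τ.fn (t : S1))) (h (t : S1))).ne_iff.2
    (show ((1 : ℝ), (Sob.derivL k τ).fn (t : S1)) ≠ 0 from fun h => one_ne_zero (congrArg Prod.fst h))
  rw [map_zero] at h2
  exact h2 (h1.symm.trans ht)

end Annulus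

/-! ### The Lagrangian -/

/-- The length of the vector `(1, p)` at the point `(x, s)`, in the metric induced by `φ`. -/
def lagr (g : RiemMetric M) (φ : ℝ × ℝ → M) (q : ℝ × ℝ × ℝ) : ℝ :=
  √(pullMetric g φ (q.1, q.2.1) (1, q.2.2) (1, q.2.2))

namespace Annulus

variable (A : Annulus M) (g : RiemMetric M)

/-- The domain of the Lagrangian. -/
def jetDomain : Set (ℝ × ℝ × ℝ) := {q | |q.2.1| < A.ε}

theorem isOpen_jetDomain : IsOpen A.jetDomain := isOpen_lt (by fun_prop) continuous_const

theorem contDiffOn_pullMetric : ContDiffOn ℝ ∞ (pullMetric g A.map) A.strip :=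
  LengthFunctional.contDiffOn_pullMetric g A.isOpen_strip A.contMDiffOn_map

theorem pullMetric_pos {p : ℝ × ℝ} (hp : p ∈ A.strip) {u : ℝ × ℝ} (hu : u ≠ 0) :
    0 < pullMetric g A.map p u u :=
  innerAt_pos g _ ((map_ne_zero_iff _ (A.dM_injective hp)).2 hu)

theorem one_mk_ne_zero (p : ℝ) : ((1 : ℝ), p) ≠ 0 := fun h => one_ne_zero (congrArg Prod.fst h)

theorem contDiffOn_energy : ContDiffOn ℝ ∞ (fun q : ℝ × ℝ × ℝ =>
    pullMetric g A.map (q.1, q.2.1) (1, q.2.2) (1, q.2.2)) A.jetDomain := by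
  have h1 : ContDiffOn ℝ ∞ (fun q : ℝ × ℝ × ℝ => pullMetric g A.map (q.1, q.2.1)) A.jetDomain :=
    (A.contDiffOn_pullMetric g).comp (ContDiff.contDiffOn (by fun_prop)) fun q hq => hq
  have h2 : ContDiffOn ℝ ∞ (fun q : ℝ × ℝ × ℝ => ((1 : ℝ), q.2.2)) A.jetDomain :=
    ContDiff.contDiffOn (by fun_prop)
  exact (h1.clm_apply h2).clm_apply h2

/-- The square root is smooth here because the vector (1, p) never vanishes. This is the advantage
of graphs over arbitrary parametrizations. -/
theorem contDiffOn_lagr : ContDiffOn ℝ ∞ (lagr g A.map) A.jetDomain :=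
  (A.contDiffOn_energy g).sqrt fun q hq =>
    (A.pullMetric_pos g (p := (q.1, q.2.1)) hq (one_mk_ne_zero _)).ne'

theorem lagr_pos {q : ℝ × ℝ × ℝ} (hq : q ∈ A.jetDomain) : 0 < lagr g A.map q :=
  Real.sqrt_pos.2 (A.pullMetric_pos g (p := (q.1, q.2.1)) hq (one_mk_ne_zero _))

theorem isOpen_domain : IsOpen A.domain := by
  have h : A.domain = Sob.fn ⁻¹' {f : C(S1, ℝ) | ∀ x, |f x| < A.ε} := rfl
  rw [h]
  refine IsOpen.preimage (Sob.continuous_fn 1) ?_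
  have h2 : {f : C(S1, ℝ) | ∀ x, |f x| < A.ε} = {f : C(S1, ℝ) | MapsTo f univ {y | |y| < A.ε}} := by
    ext f
    simp [MapsTo]
  rw [h2]
  exact ContinuousMap.isOpen_setOfPred_mapsTo isCompact_univ (isOpen_lt (by fun_prop) continuous_const)

theorem speed_graph {k : ℕ} (τ : Sob (k + 2)) (h : ∀ x, |τ.fn x| < A.ε) (t : ℝ) :
    speed g (A.graph τ.fn) t =
      lagr g A.map (t, τ.fn (t : S1), (Sob.derivL k τ).fn (t : S1)) := by
  have h1 := velocity_eq (v := A.graph τ.fn) (φ := A.map) (y := fun t : ℝ => (t, τ.fn (t : S1)))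
    ((A.contMDiffAt_map (h (t : S1))).mdifferentiableAt (by simp))
    ((hasDerivAt_id t).prodMk (τ.hasDerivAt t)) (Eventually.of_forall fun _ => rfl)
  change √(innerAt g (A.map (t, τ.fn (t : S1))) (velocity (A.graph τ.fn) t)
    (velocity (A.graph τ.fn) t)) = _
  rw [h1]
  rfl

theorem inChart_length {τ : sobScale.X 0} (hτ : τ ∈ A.domain) :
    A.inChart (UnparamLoop.length g) τ =
      ∫ t in (0 : ℝ)..1, lagr g A.map (t, Sob.jetL t τ) := by
  unfold inChart
  rw [dif_pos (A.isEmbeddedLoop_graph τ hτ)]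
  refine intervalIntegral.integral_congr fun t _ => ?_
  rw [Sob.jetL_apply]
  exact A.speed_graph g τ hτ t

theorem contDiffOn_inChart : ContDiffOn ℝ ∞ (A.inChart (UnparamLoop.length g)) A.domain := by
  refine contDiffOn_infty.2 fun n => ?_
  refine (contDiffOn_integral_comp n (L := Sob.jetL) (Φ := fun _ => ContinuousLinearMap.id ℝ ℝ)
    Sob.continuous_jetL continuous_const A.isOpen_jetDomain (A.contDiffOn_lagr g)
    A.isOpen_domain ?_).congr fun τ hτ => A.inChart_length g hτ
  intro τ hτ t _
  rw [Sob.jetL_apply]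
  exact hτ (t : S1)

end Annulus

theorem isScSmooth_length (g : RiemMetric M) : IsScSmooth (UnparamLoop.length g) := fun A =>
  isScSmoothOn_of_contDiffOn sobScale A.isOpen_domain (A.contDiffOn_inChart g)

end LengthFunctional
end

noncomputable section
namespace LengthFunctional

open Filter Topology

/-! ### Homeomorphisms of the circle and their lifts -/

theorem continuous_circle_lift {X : Type*} [TopologicalSpace X] {f : S1 → X}
    (h : Continuous fun t : ℝ => f (t : S1)) : Continuous f :=
  (isQuotientMap_quotient_mk' (X := ℝ)).continuous_iff.2 h

/-- A gain of at least 1 over each unit interval makes θ unbounded in both directions. -/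
theorem surjective_of_le_add_one {θ : ℝ → ℝ} (hθ : Monotone θ) (hc : Continuous θ)
    (h1 : ∀ t, θ t + 1 ≤ θ (t + 1)) : Function.Surjective θ := by
  have hn : ∀ n : ℕ, θ 0 + n ≤ θ n := by
    intro n
    induction n with
    | zero => simp
    | succ n ih =>
      have := h1 n
      push_cast
      linarith
  have hn' : ∀ n : ℕ, θ (-n) ≤ θ 0 - n := by
    intro n
    induction n with
    | zero => simp
    | succ n ih =>
      have := h1 (-n - 1)
      rw [sub_add_cancel] at this
      push_cast
      rw [neg_add, ← sub_eq_add_neg]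
      linarith
  refine hc.surjective ?_ ?_
  · refine tendsto_atTop_atTop_of_monotone hθ fun b => ?_
    obtain ⟨n, h⟩ := exists_nat_ge (b - θ 0)
    exact ⟨n, by linarith [hn n]⟩
  · refine tendsto_atBot_atBot_of_monotone hθ fun b => ?_
    obtain ⟨n, h⟩ := exists_nat_ge (θ 0 - b)
    exact ⟨-n, by linarith [hn' n]⟩

theorem exists_continuous_inverse {θ : ℝ → ℝ} (hθ : StrictMono θ) (hs : Function.Surjective θ) :
    ∃ ξ : ℝ → ℝ, Continuous ξ ∧ (∀ x, θ (ξ x) = x) ∧ ∀ x, ξ (θ x) = x := by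
  let e := (hθ.orderIsoOfSurjective θ hs).toHomeomorph
  exact ⟨e.symm, e.symm.continuous, e.apply_symm_apply, e.symm_apply_apply⟩

theorem exists_homeomorph_of_lift {θ : ℝ → ℝ} (hθ : StrictMono θ) (hc : Continuous θ)
    (h1 : ∀ t, θ (t + 1) = θ t + 1) :
    ∃ (ψ : S1 ≃ₜ S1) (ξ : ℝ → ℝ), Continuous ξ ∧ (∀ x, θ (ξ x) = x) ∧ (∀ x, ξ (θ x) = x) ∧
      (∀ t : ℝ, ψ (t : S1) = (θ t : S1)) ∧ ∀ x : ℝ, ψ.symm (x : S1) = (ξ x : S1) := by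
  obtain ⟨ξ, hξc, hξ, hξ'⟩ := exists_continuous_inverse hθ
    (surjective_of_le_add_one hθ.monotone hc fun t => (h1 t).ge)
  have h2 : ∀ x, ξ (x + 1) = ξ x + 1 := fun x => hθ.injective (by rw [hξ, h1, hξ])
  have hp1 : Function.Periodic (fun t : ℝ => (θ t : S1)) 1 := fun t => by
    simp only [h1, AddCircle.coe_add_period]
  have hp2 : Function.Periodic (fun t : ℝ => (ξ t : S1)) 1 := fun t => by
    simp only [h2, AddCircle.coe_add_period]
  refine ⟨{ toFun := hp1.lift
            invFun := hp2.lift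
            left_inv := fun x => ?_
            right_inv := fun x => ?_
            continuous_toFun := ?_
            continuous_invFun := ?_ }, ξ, hξc, hξ, hξ', fun _ => rfl, fun _ => rfl⟩
  · induction x using QuotientAddGroup.induction_on with
    | H t => exact congrArg ((↑) : ℝ → S1) (hξ' t)
  · induction x using QuotientAddGroup.induction_on with
    | H t => exact congrArg ((↑) : ℝ → S1) (hξ t)
  · exact continuous_circle_lift ((AddCircle.continuous_mk' 1).comp hc)
  · exact continuous_circle_lift ((AddCircle.continuous_mk' 1).comp hξc)

/-- The lift `Ψ` of the homeomorphism `ψ` of the circle is differentiable with nonzero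
derivative. -/
structure IsDiffLift (ψ : S1 ≃ₜ S1) (Ψ : ℝ → ℝ) : Prop where
  coe : ∀ t : ℝ, ((Ψ t : ℝ) : S1) = ψ (t : S1)
  deriv_ne_zero : ∀ t, deriv Ψ t ≠ 0

theorem IsReparam.exists_isDiffLift {k : ℕ} {ψ : S1 ≃ₜ S1} (h : IsReparam k ψ) :
    ∃ Ψ, IsDiffLift ψ Ψ := by
  obtain ⟨Ψ, -, h1, -, h2⟩ := h
  exact ⟨Ψ, h1, h2⟩

namespace IsDiffLift

variable {ψ ψ' : S1 ≃ₜ S1} {Ψ Ψ' : ℝ → ℝ}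

theorem hasDerivAt (h : IsDiffLift ψ Ψ) (t : ℝ) : HasDerivAt Ψ (deriv Ψ t) t :=
  (differentiableAt_of_deriv_ne_zero (h.deriv_ne_zero t)).hasDerivAt

theorem continuous (h : IsDiffLift ψ Ψ) : Continuous Ψ :=
  continuous_iff_continuousAt.2 fun t => (h.hasDerivAt t).continuousAt

/-- Darboux's theorem; continuity of the derivative is not needed. -/
theorem deriv_neg_or_pos (h : IsDiffLift ψ Ψ) : (∀ t, deriv Ψ t < 0) ∨ ∀ t, 0 < deriv Ψ t := by
  have := hasDerivWithinAt_forall_lt_or_forall_gt_of_forall_ne (s := univ) (m := 0) convex_univ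
    (fun t _ => (h.hasDerivAt t).hasDerivWithinAt) fun t _ => h.deriv_ne_zero t
  simpa using this

theorem exists_sign (h : IsDiffLift ψ Ψ) : ∃ s : ℝ, s * s = 1 ∧ ∀ t, |deriv Ψ t| = s * deriv Ψ t := by
  rcases h.deriv_neg_or_pos with h1 | h1
  · exact ⟨-1, by norm_num, fun t => by rw [abs_of_neg (h1 t)]; ring⟩
  · exact ⟨1, by norm_num, fun t => by rw [abs_of_pos (h1 t)]; ring⟩

theorem comp (h : IsDiffLift ψ Ψ) (h' : IsDiffLift ψ' Ψ') : IsDiffLift (ψ.trans ψ') (Ψ' ∘ Ψ) where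
  coe t := by
    rw [Function.comp_apply, h'.coe, h.coe]
    rfl
  deriv_ne_zero t := by
    rw [((h'.hasDerivAt _).comp t (h.hasDerivAt t)).deriv]
    exact mul_ne_zero (h'.deriv_ne_zero _) (h.deriv_ne_zero _)

theorem exists_add_one (h : IsDiffLift ψ Ψ) (t : ℝ) : ∃ n : ℤ, Ψ (t + 1) = Ψ t + n := by
  have h1 : ((Ψ (t + 1) : ℝ) : S1) = ((Ψ t : ℝ) : S1) := by
    rw [h.coe, h.coe, AddCircle.coe_add_period]
  rw [eq_comm, QuotientAddGroup.eq] at h1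
  obtain ⟨n, hn⟩ := h1
  refine ⟨n, ?_⟩
  have : (n : ℝ) = -Ψ t + Ψ (t + 1) := by simpa using hn
  linarith

theorem exists_inverse (h : IsDiffLift ψ Ψ) :
    ∃ Ξ : ℝ → ℝ, Continuous Ξ ∧ (∀ x, Ψ (Ξ x) = x) ∧ ∀ x, Ξ (Ψ x) = x := by
  -- The degree need not be computed: for an increasing lift the integer n is positive, so it is at
  -- least 1. A decreasing lift is treated through its negative.
  have key : ∀ θ : ℝ → ℝ, (∀ t, 0 < deriv θ t) → (∀ t, ∃ n : ℤ, θ (t + 1) = θ t + n) →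
      ∃ Ξ : ℝ → ℝ, Continuous Ξ ∧ (∀ x, θ (Ξ x) = x) ∧ ∀ x, Ξ (θ x) = x := by
    intro θ hpos hn
    have hm := strictMono_of_deriv_pos hpos
    refine exists_continuous_inverse hm (surjective_of_le_add_one hm.monotone ?_ fun t => ?_)
    · exact continuous_iff_continuousAt.2 fun t =>
        (differentiableAt_of_deriv_ne_zero (hpos t).ne').continuousAt
    · obtain ⟨n, hn⟩ := hn t
      have h1 : θ t < θ (t + 1) := hm (lt_add_one t)
      have h2 : (0 : ℝ) < n := by linarith
      have h3 : (1 : ℝ) ≤ n := by exact_mod_cast Int.cast_pos.1 h2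
      linarith
  rcases h.deriv_neg_or_pos with h1 | h1
  · obtain ⟨Ξ, hc, h2, h3⟩ := key (fun t => -Ψ t) (fun t => by simpa [deriv.fun_neg] using h1 t) fun t => by
      obtain ⟨n, hn⟩ := h.exists_add_one t
      exact ⟨-n, by rw [hn]; push_cast; ring⟩
    refine ⟨fun x => Ξ (-x), hc.comp continuous_neg, fun x => ?_, fun x => h3 x⟩
    have := h2 (-x)
    linarith
  · exact key Ψ h1 h.exists_add_one

theorem exists_symm (h : IsDiffLift ψ Ψ) : ∃ Ξ, IsDiffLift ψ.symm Ξ := by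
  obtain ⟨Ξ, hc, h1, h2⟩ := h.exists_inverse
  refine ⟨Ξ, fun t => ?_, fun t => ?_⟩
  · rw [Homeomorph.eq_symm_apply, ← h.coe, h1]
  · rw [(HasDerivAt.of_local_left_inverse hc.continuousAt (h.hasDerivAt _) (h.deriv_ne_zero _)
      (Eventually.of_forall h1)).deriv]
    exact inv_ne_zero (h.deriv_ne_zero _)

theorem injOn (h : IsDiffLift ψ Ψ) : InjOn Ψ (Ico (0 : ℝ) 1) := by
  intro s hs t ht hst
  have h2 := ψ.injective (by rw [← h.coe, ← h.coe, hst] : ψ (s : S1) = ψ (t : S1))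
  rw [← zero_add (1 : ℝ)] at hs ht
  exact (AddCircle.coe_eq_coe_iff_of_mem_Ico hs ht).1 h2

/-- Since ψ is a bijection of the circle, the image of [0, 1) under Ψ is a fundamental domain for
the integers. A periodic function has the same integral over any two fundamental domains, whatever
the direction of Ψ. -/
theorem integral_comp (h : IsDiffLift ψ Ψ) {q : ℝ → ℝ} (hq : Function.Periodic q 1) :
    ∫ t in (0 : ℝ)..1, |deriv Ψ t| * q (Ψ t) = ∫ t in (0 : ℝ)..1, q t := by
  have hL : ∫ t in (0 : ℝ)..1, |deriv Ψ t| * q (Ψ t) =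
      ∫ t in Ico (0 : ℝ) 1, |deriv Ψ t| • q (Ψ t) := by
    rw [intervalIntegral.integral_of_le zero_le_one, ← integral_Ico_eq_integral_Ioc]
    rfl
  rw [hL, ← integral_image_eq_integral_abs_deriv_smul measurableSet_Ico
    (fun t _ => (h.hasDerivAt t).hasDerivWithinAt) h.injOn]
  have hR : ∫ t in (0 : ℝ)..1, q t = ∫ t in Ioc (0 : ℝ) (0 + 1), q t := by
    rw [intervalIntegral.integral_of_le zero_le_one, zero_add]
  rw [hR]
  have hS : IsAddFundamentalDomain (AddSubgroup.zmultiples (1 : ℝ)) (Ψ '' Ico (0 : ℝ) 1)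
      (volume : Measure ℝ) := by
    refine IsAddFundamentalDomain.mk' ?_ ?_
    · exact (measurableSet_Ico.image_of_continuousOn_injOn h.continuous.continuousOn
        h.injOn).nullMeasurableSet
    · intro x
      obtain ⟨y, hy⟩ := ψ.surjective (x : S1)
      have hy' : y ∈ ((↑) : ℝ → S1) '' Ico (0 : ℝ) (0 + 1) := by
        rw [AddCircle.coe_image_Ico_eq]; trivial
      obtain ⟨t, ht, rfl⟩ := hy'
      rw [zero_add] at ht
      rw [← h.coe, QuotientAddGroup.eq] at hy
      have hmem : Ψ t - x ∈ AddSubgroup.zmultiples (1 : ℝ) := by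
        have := neg_mem hy
        rwa [show -(-Ψ t + x) = Ψ t - x by ring] at this
      refine ⟨⟨Ψ t - x, hmem⟩, ⟨t, ht, ?_⟩, ?_⟩
      · simp [AddSubgroup.vadd_def]
      · rintro ⟨a, ha⟩ ⟨s, hs, hsa⟩
        have hsa' : Ψ s = a + x := hsa
        have e1 : ((Ψ s : ℝ) : S1) = ((Ψ t : ℝ) : S1) := by
          rw [QuotientAddGroup.eq]
          have := add_mem (neg_mem ha) hmem
          rwa [show -a + (Ψ t - x) = -Ψ s + Ψ t by rw [hsa']; ring] at this
        rw [h.coe, h.coe] at e1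
        have hst : s = t := by
          have h2 := ψ.injective e1
          rw [← zero_add (1 : ℝ)] at hs ht
          exact (AddCircle.coe_eq_coe_iff_of_mem_Ico hs ht).1 h2
        subst hst
        apply Subtype.ext
        change a = Ψ s - x
        rw [hsa']; ring
  refine hS.setIntegral_eq (isAddFundamentalDomain_Ioc one_pos 0) ?_
  rintro ⟨_, n, rfl⟩ x
  have := hq.int_mul n x
  change q (n • (1 : ℝ) + x) = _
  rw [zsmul_eq_mul, add_comm]
  exact this

end IsDiffLift

end LengthFunctional
end

noncomputable section
namespace LengthFunctional

open Filter Topology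

set_option linter.unusedSectionVars false
set_option maxSynthPendingDepth 3

/-! ### The first variation of the length -/

/-- The Christoffel symbols of the first kind, as a linear form in the last argument. -/
def gammaL {E : Type*} [NormedAddCommGroup E] [NormedSpace ℝ E] (B : E → E →L[ℝ] E →L[ℝ] ℝ)
    (y u w : E) : E →L[ℝ] ℝ :=
  (1 / 2 : ℝ) • (fderiv ℝ B y u w + fderiv ℝ B y w u - ((fderiv ℝ B y).flip u).flip w)

theorem gammaL_apply {E : Type*} [NormedAddCommGroup E] [NormedSpace ℝ E]
    (B : E → E →L[ℝ] E →L[ℝ] ℝ) (y u w z : E) : gammaL B y u w z = gammaForm B y u w z := by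
  simp only [gammaL, gammaForm, smul_apply, sub_apply, add_apply, ContinuousLinearMap.flip_apply,
    smul_eq_mul]
  ring

theorem hasDerivAt_line {E : Type*} [NormedAddCommGroup E] [NormedSpace ℝ E] (y w : E) :
    HasDerivAt (fun r : ℝ => y + r • w) w 0 := by
  simpa using ((hasDerivAt_id (0 : ℝ)).smul_const w).const_add y

theorem hasDerivAt_sqrt_line {E : Type*} [NormedAddCommGroup E] [NormedSpace ℝ E]
    {B : E → E →L[ℝ] E →L[ℝ] ℝ} {y u : E} (hB : DifferentiableAt ℝ B y) (w : E)
    (hpos : 0 < B y u u) (w' : E) :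
    HasDerivAt (fun r : ℝ => √(B (y + r • w) (u + r • w') (u + r • w')))
      ((fderiv ℝ B y w u u + B y w' u + B y u w') / (2 * √(B y u u))) 0 := by
  have h3 : HasFDerivAt B (fderiv ℝ B y) (y + (0 : ℝ) • w) := by
    simpa using hB.hasFDerivAt
  have h4 := h3.comp_hasDerivAt (0 : ℝ) (hasDerivAt_line y w)
  have h5 := (h4.clm_apply (hasDerivAt_line u w')).clm_apply (hasDerivAt_line u w')
  have h6 : HasDerivAt (fun r : ℝ => B (y + r • w) (u + r • w') (u + r • w'))
      (fderiv ℝ B y w u u + B y w' u + B y u w') 0 := by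
    refine h5.congr_deriv ?_
    simp only [Function.comp_apply, zero_smul, add_zero, add_apply]
  have h7 := h6.sqrt (by simpa using hpos.ne')
  simpa only [zero_smul, add_zero] using h7

namespace Sob

/-- The point `(x, τ(x))` of the graph of `τ`. -/
def point (τ : Sob 3) (x : ℝ) : ℝ × ℝ := (x, τ.fn (x : S1))

/-- The tangent vector `(1, τ'(x))` of the graph of `τ`. -/
def tangent (τ : Sob 3) (x : ℝ) : ℝ × ℝ := (1, (derivL 1 τ).fn (x : S1))

theorem hasDerivAt_point (τ : Sob 3) (x : ℝ) : HasDerivAt τ.point (τ.tangent x) x :=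
  (hasDerivAt_id x).prodMk (τ.hasDerivAt x)

theorem contDiff_tangent (τ : Sob 3) : ContDiff ℝ 1 τ.tangent :=
  contDiff_const.prodMk (contDiff_iff_contDiffAt.2 fun x => ((derivL 1 τ).hAt x).contDiffAt)

theorem contDiff_point (τ : Sob 3) : ContDiff ℝ 1 τ.point := by
  refine contDiff_id.prodMk (contDiff_iff_contDiffAt.2 fun x => ?_)
  exact (τ.hAt x).contDiffAt.of_le (by norm_cast)

theorem incl_fn {k : ℕ} (τ : Sob (k + 1)) : (incl k τ).fn = τ.fn := rfl

theorem derivL_incl (τ : Sob 3) (x : ℝ) :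
    (derivL 0 (incl 2 τ)).fn (x : S1) = (derivL 1 τ).fn (x : S1) :=
  ((incl 2 τ).hasDerivAt x).unique (τ.hasDerivAt x)

end Sob

variable {M : Type*} [TopologicalSpace M] [ChartedSpace Plane M] [IsManifold (𝓡 2) ∞ M]

theorem fderiv_pullMetric_symm {E : Type*} [NormedAddCommGroup E] [NormedSpace ℝ E]
    (g : RiemMetric M) {φ : E → M} {y : E} (h : DifferentiableAt ℝ (pullMetric g φ) y)
    (a b c : E) :
    fderiv ℝ (pullMetric g φ) y a b c = fderiv ℝ (pullMetric g φ) y a c b := by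
  have key : ∀ b c, fderiv ℝ (fun x => pullMetric g φ x b c) y a =
      fderiv ℝ (pullMetric g φ) y a b c := by
    intro b c
    have h1 := (h.hasFDerivAt.clm_apply (hasFDerivAt_const b y)).clm_apply (hasFDerivAt_const c y)
    rw [h1.fderiv]
    simp
  rw [← key b c, ← key c b]
  simp_rw [pullMetric_symm g φ _ b c]

namespace Annulus

variable (A : Annulus M) (g : RiemMetric M)

theorem differentiableAt_pullMetric {p : ℝ × ℝ} (hp : p ∈ A.strip) :
    DifferentiableAt ℝ (pullMetric g A.map) p :=
  ((A.contDiffOn_pullMetric g).contDiffAt (A.isOpen_strip.mem_nhds hp)).differentiableAt (by simp)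

theorem gammaForm_self {p : ℝ × ℝ} (hp : p ∈ A.strip) (u w : ℝ × ℝ) :
    gammaForm (pullMetric g A.map) p u w u = fderiv ℝ (pullMetric g A.map) p w u u / 2 := by
  unfold gammaForm
  rw [fderiv_pullMetric_symm g (A.differentiableAt_pullMetric g hp) u w u]
  ring

/-- Half the derivative of g(u, u) in the direction w, for constant u, is Γ(u, w; u). The variation
of the norm of u = (1, p) is therefore g(∇W, u)/|u| for a field W with value (0, a) and derivative
(0, b). -/
theorem fderiv_lagr {x s p : ℝ} (h : |s| < A.ε) (a b : ℝ) :
    fderiv ℝ (lagr g A.map) (x, s, p) (0, a, b) =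
      (pullMetric g A.map (x, s) (0, b) (1, p) +
        gammaForm (pullMetric g A.map) (x, s) (1, p) (0, a) (1, p)) / lagr g A.map (x, s, p) := by
  have hs : (x, s) ∈ A.strip := h
  have h4 := hasDerivAt_sqrt_line (A.differentiableAt_pullMetric g hs) (0, a)
    (A.pullMetric_pos g hs (one_mk_ne_zero p)) (0, b)
  have h5 : HasDerivAt (fun r : ℝ => ((x, s, p) : ℝ × ℝ × ℝ) + r • ((0 : ℝ), a, b)) (0, a, b) 0 :=
    hasDerivAt_line _ _
  have h6 : HasFDerivAt (lagr g A.map) (fderiv ℝ (lagr g A.map) (x, s, p))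
      ((x, s, p) + (0 : ℝ) • ((0 : ℝ), a, b)) := by
    have := ((A.contDiffOn_lagr g).contDiffAt (A.isOpen_jetDomain.mem_nhds
      (show (x, s, p) ∈ A.jetDomain from h))).differentiableAt (by simp)
    rw [zero_smul, add_zero]
    exact this.hasFDerivAt
  have h7 := (h6.comp_hasDerivAt (0 : ℝ) h5).unique (h4.congr_of_eventuallyEq
    (Eventually.of_forall fun r => by simp [lagr, Function.comp]))
  rw [h7, A.gammaForm_self g hs, pullMetric_symm g A.map (x, s) (1, p) (0, b), lagr]
  ring

/-! ### The curvature of a graph -/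

variable (τ : Sob 3)

/-- The speed of the parametrization of a graph. -/
def graphSpeed (x : ℝ) : ℝ := lagr g A.map (x, τ.fn (x : S1), (Sob.derivL 1 τ).fn (x : S1))

/-- The unit tangent vector of a graph. -/
def unitTangent (x : ℝ) : ℝ × ℝ := (A.graphSpeed g τ x)⁻¹ • τ.tangent x

/-- The covariant derivative of the unit tangent vector, as a linear form. -/
def curvature (x : ℝ) : ℝ × ℝ →L[ℝ] ℝ :=
  pullMetric g A.map (τ.point x) (deriv (A.unitTangent g τ) x) +
    gammaL (pullMetric g A.map) (τ.point x) (τ.tangent x) (A.unitTangent g τ x)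

/-- The first variation of the length of a graph. -/
def firstVariation (h : Sob 2) (x : ℝ) : ℝ :=
  (pullMetric g A.map (τ.point x) (0, (Sob.derivL 0 h).fn (x : S1)) (τ.tangent x) +
    gammaForm (pullMetric g A.map) (τ.point x) (τ.tangent x) (0, h.fn (x : S1)) (τ.tangent x)) /
      A.graphSpeed g τ x

variable {τ} {A}

/-- The sc-differential is the Fréchet derivative on W^{2,2} itself, restricted along the inclusion
of level 1; hence it is bounded on level 0. -/
theorem hasScDifferentialAt_length (hτ : ∀ x, |τ.fn x| < A.ε) :
    ∃ D : Sob 2 →L[ℝ] ℝ, ScScale.HasScDifferentialAt sobScale ScScale.real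
        (A.inChart (UnparamLoop.length g)) D τ ∧
      ∀ h : Sob 2, D h = ∫ x in (0 : ℝ)..1, A.firstVariation g τ h x := by
  have hmem : sobScale.incl 0 τ ∈ A.domain := hτ
  have hΩ : ∀ t ∈ Icc (0 : ℝ) 1, (t, Sob.jetL t (Sob.incl 2 τ)) ∈ A.jetDomain := by
    intro t _
    rw [Sob.jetL_apply]
    exact hτ _
  have h1 := hasFDerivAt_integral_comp (L := Sob.jetL) (Φ := fun _ => ContinuousLinearMap.id ℝ ℝ)
    Sob.continuous_jetL continuous_const A.isOpen_jetDomain (A.contDiffOn_lagr g) hΩ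
  have h2 : A.inChart (UnparamLoop.length g) =ᶠ[𝓝 (Sob.incl 2 τ)]
      fun τ => ∫ t in (0 : ℝ)..1, lagr g A.map (t, Sob.jetL t τ) := by
    filter_upwards [A.isOpen_domain.mem_nhds hmem] with σ hσ
    exact A.inChart_length g hσ
  have h3 := h1.congr_of_eventuallyEq h2
  refine ⟨_, h3.comp τ (sobScale.incl 0).hasFDerivAt, fun h => ?_⟩
  rw [ContinuousLinearMap.intervalIntegral_apply]
  · refine intervalIntegral.integral_congr fun t _ => ?_
    change fderiv ℝ (lagr g A.map) (t, Sob.jetL t (Sob.incl 2 τ)) (0, Sob.jetL t h) = _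
    rw [Sob.jetL_apply, Sob.jetL_apply, Sob.derivL_incl, Sob.incl_fn, A.fderiv_lagr g (hτ _)]
    rfl
  · refine ContinuousOn.intervalIntegrable ?_
    rw [uIcc_of_le zero_le_one]
    have h4 := continuousOn_integrand Sob.continuous_jetL
      (continuous_integrandDeriv (Φ := fun _ => ContinuousLinearMap.id ℝ ℝ) Sob.continuous_jetL
        continuous_const) ((A.contDiffOn_lagr g).continuousOn_fderiv_of_isOpen A.isOpen_jetDomain
          (by simp))
    exact h4.comp (g := fun z : Sob 2 × ℝ => _) (f := fun t => (Sob.incl 2 τ, t))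
      (by fun_prop) fun t ht => hΩ t ht

section

variable (hτ : ∀ x, |τ.fn x| < A.ε)
include hτ

theorem point_mem (x : ℝ) : τ.point x ∈ A.strip := hτ _

theorem graphSpeed_pos (x : ℝ) : 0 < A.graphSpeed g τ x :=
  A.lagr_pos g (show (x, _, _) ∈ A.jetDomain from hτ _)

theorem graphSpeed_sq (x : ℝ) : A.graphSpeed g τ x ^ 2 =
    pullMetric g A.map (τ.point x) (τ.tangent x) (τ.tangent x) :=
  Real.sq_sqrt (A.pullMetric_pos g (point_mem hτ x) (one_mk_ne_zero _)).le

theorem contDiff_graphSpeed : ContDiff ℝ 1 (A.graphSpeed g τ) :=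
  ((A.contDiffOn_lagr g).of_le (by norm_cast)).comp_contDiff
    (contDiff_id.prodMk (τ.contDiff_point.snd.prodMk τ.contDiff_tangent.snd)) fun _ => hτ _

theorem contDiff_unitTangent : ContDiff ℝ 1 (A.unitTangent g τ) :=
  ((contDiff_graphSpeed g hτ).inv fun x => (graphSpeed_pos g hτ x).ne').smul τ.contDiff_tangent

theorem hasDerivAt_unitTangent (x : ℝ) :
    HasDerivAt (A.unitTangent g τ) (deriv (A.unitTangent g τ) x) x :=
  ((contDiff_unitTangent g hτ).differentiable (by simp) x).hasDerivAt

theorem tangent_eq (x : ℝ) : τ.tangent x = A.graphSpeed g τ x • A.unitTangent g τ x :=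
  (smul_inv_smul₀ (graphSpeed_pos g hτ x).ne' _).symm

theorem hasDerivAt_pullMetric (x : ℝ) : HasDerivAt (fun x => pullMetric g A.map (τ.point x))
    (fderiv ℝ (pullMetric g A.map) (τ.point x) (τ.tangent x)) x :=
  (A.differentiableAt_pullMetric g (point_mem hτ x)).hasFDerivAt.comp_hasDerivAt x
    (τ.hasDerivAt_point x)

theorem continuous_pullMetric : Continuous fun x => pullMetric g A.map (τ.point x) :=
  (A.contDiffOn_pullMetric g).continuousOn.comp_continuous τ.contDiff_point.continuous
    (point_mem hτ)

theorem continuous_fderiv_pullMetric :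
    Continuous fun x => fderiv ℝ (pullMetric g A.map) (τ.point x) :=
  ((A.contDiffOn_pullMetric g).continuousOn_fderiv_of_isOpen A.isOpen_strip
    (by simp)).comp_continuous τ.contDiff_point.continuous (point_mem hτ)

theorem continuous_curvature {w : ℝ → ℝ × ℝ} (hw : Continuous w) :
    Continuous fun x => A.curvature g τ x (w x) := by
  have h1 := continuous_pullMetric g hτ
  have h2 := continuous_fderiv_pullMetric g hτ
  have h3 := τ.contDiff_tangent.continuous
  have h4 := (contDiff_unitTangent g hτ).continuous
  have h5 := (contDiff_unitTangent g hτ).continuous_deriv (by simp)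
  simp only [curvature, gammaL_apply, add_apply, gammaForm]
  fun_prop

theorem continuous_firstVariation (h : Sob 2) : Continuous (A.firstVariation g τ h) := by
  have h1 := continuous_pullMetric g hτ
  have h2 := continuous_fderiv_pullMetric g hτ
  have h3 := τ.contDiff_tangent.continuous
  have h4 := (contDiff_graphSpeed g hτ).continuous
  have h5 := h.continuous_lift
  have h6 := (Sob.derivL 0 h).continuous_lift
  have h7 := fun x => (graphSpeed_pos g hτ x).ne'
  unfold firstVariation gammaForm
  fun_prop (disch := exact h7 _)

/-- Compatibility of the connection with the metric: the derivative of g(T, V) is g(∇T, V) + g(T,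
∇V). With T the unit tangent, the second term is the first variation. -/
theorem hasDerivAt_inner (h : Sob 2) (x : ℝ) :
    HasDerivAt (fun x => pullMetric g A.map (τ.point x) (A.unitTangent g τ x) (0, h.fn (x : S1)))
      (A.curvature g τ x (0, h.fn (x : S1)) + A.firstVariation g τ h x) x := by
  have h1 := ((hasDerivAt_pullMetric g hτ x).clm_apply (hasDerivAt_unitTangent g hτ x)).clm_apply
    ((hasDerivAt_const x (0 : ℝ)).prodMk (h.hasDerivAt x))
  refine h1.congr_deriv ?_
  have hpos := graphSpeed_pos g hτ x
  have hsymm := fderiv_pullMetric_symm g (A.differentiableAt_pullMetric g (point_mem hτ x))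
  rw [curvature, firstVariation, A.gammaForm_self g (point_mem hτ x), add_apply, add_apply,
    gammaL_apply, gammaForm, tangent_eq g hτ x,
    pullMetric_symm g A.map (τ.point x) (0, (Sob.derivL 0 h).fn (x : S1))]
  simp only [map_smul, smul_apply, smul_eq_mul]
  field_simp
  ring

/-- Differentiating g(T, T) = 1 shows that ∇T is orthogonal to T. -/
theorem curvature_tangent (x : ℝ) : A.curvature g τ x (τ.tangent x) = 0 := by
  have hpos := graphSpeed_pos g hτ x
  have h1 : ∀ x, pullMetric g A.map (τ.point x) (A.unitTangent g τ x) (A.unitTangent g τ x) = 1 := by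
    intro x
    have hpos := graphSpeed_pos g hτ x
    rw [unitTangent, map_smul, map_smul, smul_apply, ← graphSpeed_sq g hτ]
    simp only [smul_eq_mul]
    field_simp
  have h2 := ((hasDerivAt_pullMetric g hτ x).clm_apply (hasDerivAt_unitTangent g hτ x)).clm_apply
    (hasDerivAt_unitTangent g hτ x)
  have h3 := h2.unique ((hasDerivAt_const x (1 : ℝ)).congr_of_eventuallyEq (Eventually.of_forall h1))
  have hsymm := fderiv_pullMetric_symm g (A.differentiableAt_pullMetric g (point_mem hτ x))
  rw [curvature, add_apply, gammaL_apply, A.gammaForm_self g (point_mem hτ x), tangent_eq g hτ x]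
  rw [tangent_eq g hτ x, add_apply, pullMetric_symm g A.map (τ.point x)
    (A.unitTangent g τ x)] at h3
  simp only [map_smul, smul_apply, smul_eq_mul] at h3 ⊢
  linear_combination (A.graphSpeed g τ x / 2) * h3

/-- The tangent (1, τ') and the vector (0, 1) span the plane. -/
theorem curvature_eq_zero {x : ℝ} (h : A.curvature g τ x (0, 1) = 0) (w : ℝ × ℝ) :
    A.curvature g τ x w = 0 := by
  have h1 : w = w.1 • τ.tangent x +
      (w.2 - w.1 * (Sob.derivL 1 τ).fn (x : S1)) • ((0 : ℝ), (1 : ℝ)) := by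
    ext
    · simp [Sob.tangent]
    · simp [Sob.tangent]
  rw [h1, map_add, map_smul, map_smul, h, curvature_tangent g hτ]
  simp

end

/-! ### Periodicity -/

variable (A) in
theorem map_add_one (p : ℝ × ℝ) : A.map (p + (1, 0)) = A.map p := by
  simp [map]

variable (A) in
theorem pullMetric_add_one {p : ℝ × ℝ} (hp : p ∈ A.strip) :
    pullMetric g A.map (p + (1, 0)) = pullMetric g A.map p := by
  have hp' : p + (1, 0) ∈ A.strip := by simpa [strip] using hp
  have h1 : dM A.map p = dM A.map (p + (1, 0)) := by
    have h2 := mfderiv_comp p ((A.contMDiffAt_map hp').mdifferentiableAt (by simp))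
      (show MDifferentiableAt 𝓘(ℝ, ℝ × ℝ) 𝓘(ℝ, ℝ × ℝ) (fun q : ℝ × ℝ => q + (1, 0)) p from
        (differentiableAt_id.add_const _).mdifferentiableAt)
    rw [show A.map ∘ (fun q : ℝ × ℝ => q + (1, 0)) = A.map from funext A.map_add_one,
      mfderiv_eq_fderiv, fderiv_add_const, fderiv_fun_id] at h2
    exact h2
  unfold pullMetric
  rw [map_add_one, h1]

variable (A) in
theorem fderiv_pullMetric_add_one {p : ℝ × ℝ} (hp : p ∈ A.strip) :
    fderiv ℝ (pullMetric g A.map) (p + (1, 0)) = fderiv ℝ (pullMetric g A.map) p := by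
  rw [← fderiv_comp_add_right (f := pullMetric g A.map) (1, 0)]
  refine Filter.EventuallyEq.fderiv_eq ?_
  filter_upwards [A.isOpen_strip.mem_nhds hp] with q hq
  exact A.pullMetric_add_one g hq

theorem point_add_one (x : ℝ) : τ.point (x + 1) = τ.point x + (1, 0) := by
  simp [Sob.point]

theorem tangent_add_one (x : ℝ) : τ.tangent (x + 1) = τ.tangent x := by
  simp [Sob.tangent]

section

variable (hτ : ∀ x, |τ.fn x| < A.ε)
include hτ

theorem graphSpeed_add_one (x : ℝ) : A.graphSpeed g τ (x + 1) = A.graphSpeed g τ x := by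
  rw [← Real.sqrt_sq (graphSpeed_pos g hτ (x + 1)).le, graphSpeed_sq g hτ, point_add_one,
    tangent_add_one, A.pullMetric_add_one g (point_mem hτ x), ← graphSpeed_sq g hτ,
    Real.sqrt_sq (graphSpeed_pos g hτ x).le]

theorem unitTangent_add_one (x : ℝ) : A.unitTangent g τ (x + 1) = A.unitTangent g τ x := by
  rw [unitTangent, graphSpeed_add_one g hτ, tangent_add_one, unitTangent]

theorem curvature_add_one (x : ℝ) : A.curvature g τ (x + 1) = A.curvature g τ x := by
  have h1 : deriv (A.unitTangent g τ) (x + 1) = deriv (A.unitTangent g τ) x := by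
    rw [← deriv_comp_add_const]
    simp_rw [unitTangent_add_one g hτ]
  unfold curvature gammaL
  rw [h1, unitTangent_add_one g hτ, point_add_one, tangent_add_one,
    A.pullMetric_add_one g (point_mem hτ x), A.fderiv_pullMetric_add_one g (point_mem hτ x)]

theorem periodic_curvature (h : Sob 2) :
    Function.Periodic (fun x => A.curvature g τ x (0, h.fn (x : S1))) 1 := fun x => by
  simp only [curvature_add_one g hτ, AddCircle.coe_add_period]

theorem periodic_firstVariation (h : Sob 2) :
    Function.Periodic (A.firstVariation g τ h) 1 := fun x => by
  unfold firstVariation gammaForm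
  simp only [graphSpeed_add_one g hτ, point_add_one, tangent_add_one,
    A.pullMetric_add_one g (point_mem hτ x), A.fderiv_pullMetric_add_one g (point_mem hτ x),
    AddCircle.coe_add_period]

/-- Integration of `hasDerivAt_inner` over a period; the boundary values agree. -/
theorem integral_firstVariation (h : Sob 2) :
    ∫ x in (0 : ℝ)..1, A.firstVariation g τ h x =
      -∫ x in (0 : ℝ)..1, A.curvature g τ x (0, h.fn (x : S1)) := by
  have hc := continuous_curvature g hτ (w := fun x => ((0 : ℝ), h.fn (x : S1)))
    (continuous_const.prodMk h.continuous_lift)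
  have h1 := intervalIntegral.integral_eq_sub_of_hasDerivAt (a := 0) (b := 1)
    (fun x _ => hasDerivAt_inner g hτ h x)
    ((hc.add (continuous_firstVariation g hτ h)).intervalIntegrable 0 1)
  rw [intervalIntegral.integral_add (hc.intervalIntegrable 0 1)
    ((continuous_firstVariation g hτ h).intervalIntegrable 0 1)] at h1
  have h2 := A.pullMetric_add_one g (point_mem hτ 0)
  have h3 := unitTangent_add_one g hτ 0
  rw [← point_add_one] at h2
  rw [zero_add] at h2 h3
  rw [h2, h3, show ((1 : ℝ) : S1) = ((0 : ℝ) : S1) by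
    simp, sub_self] at h1
  linarith

end

end Annulus

end LengthFunctional
end

/-! ### Reparametrized graphs and parametrizations of constant speed -/

noncomputable section
namespace LengthFunctional

open Filter Topology

set_option linter.unusedSectionVars false
set_option maxSynthPendingDepth 3

variable {M : Type*} [TopologicalSpace M] [ChartedSpace Plane M] [IsManifold (𝓡 2) ∞ M]

namespace Annulus

variable {A : Annulus M} (g : RiemMetric M) {τ : Sob 3} (hτ : ∀ x, |τ.fn x| < A.ε)
  {ψ : S1 ≃ₜ S1} {Ψ : ℝ → ℝ} (hψ : IsDiffLift ψ Ψ)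

include hψ

theorem graph_comp_eq (t : ℝ) : (A.graph τ.fn ∘ ψ) (t : S1) = A.map (τ.point (Ψ t)) := by
  rw [Function.comp_apply, ← hψ.coe]
  rfl

theorem hasDerivAt_point_comp (t : ℝ) :
    HasDerivAt (fun s => τ.point (Ψ s)) (deriv Ψ t • τ.tangent (Ψ t)) t :=
  (τ.hasDerivAt_point (Ψ t)).scomp t (hψ.hasDerivAt t)

include hτ

theorem velocity_graph_comp (t : ℝ) : (velocity (A.graph τ.fn ∘ ψ) t : Plane) =
    dM A.map (τ.point (Ψ t)) (deriv Ψ t • τ.tangent (Ψ t)) :=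
  velocity_eq (y := fun s => τ.point (Ψ s))
    ((A.contMDiffAt_map (point_mem hτ _)).mdifferentiableAt (by simp))
    (hasDerivAt_point_comp hψ t) (Eventually.of_forall fun s => graph_comp_eq hψ s)

theorem field_graph_comp (h : S1 → ℝ) (t : ℝ) : (A.field τ.fn h ψ t : Plane) =
    dM A.map (τ.point (Ψ t)) (0, h (Ψ t : S1)) := by
  have h1 := mfderiv_comp (τ.fn (Ψ t : S1)) (f := fun r : ℝ => (Ψ t, r)) (g := A.map)
    (I := 𝓘(ℝ, ℝ))
    ((A.contMDiffAt_map (point_mem hτ (Ψ t))).mdifferentiableAt (by simp))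
    ((hasDerivAt_const _ (Ψ t)).prodMk (hasDerivAt_id _)).differentiableAt.mdifferentiableAt
  have h2 : mfderiv 𝓘(ℝ, ℝ) 𝓘(ℝ, ℝ × ℝ) (fun r : ℝ => (Ψ t, r)) (τ.fn (Ψ t : S1)) =
      ContinuousLinearMap.inr ℝ ℝ ℝ := by
    rw [mfderiv_eq_fderiv]
    exact ((hasFDerivAt_const (Ψ t) _).prodMk (hasFDerivAt_id _)).fderiv
  have h3 : A.map ∘ (fun r : ℝ => (Ψ t, r)) = A.σ (Ψ t : S1) := rfl
  rw [h2, h3] at h1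
  have h4 : ∀ x : S1, x = (Ψ t : S1) → (mfderiv 𝓘(ℝ, ℝ) (𝓡 2) (A.σ x) (τ.fn x) (h x) : Plane) =
      dM A.map (τ.point (Ψ t)) (0, h (Ψ t : S1)) := by
    rintro _ rfl
    exact congrArg (fun T : ℝ →L[ℝ] Plane => T (h (Ψ t : S1))) h1
  exact h4 (ψ t) (hψ.coe t).symm

theorem speed_graph_comp (t : ℝ) :
    speed g (A.graph τ.fn ∘ ψ) t = |deriv Ψ t| * A.graphSpeed g τ (Ψ t) := by
  have h1 : speed g (A.graph τ.fn ∘ ψ) t = √(innerAt g ((A.graph τ.fn ∘ ψ) (t : S1))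
      (velocity (A.graph τ.fn ∘ ψ) t) (velocity (A.graph τ.fn ∘ ψ) t)) := rfl
  rw [h1, velocity_graph_comp hτ hψ, graph_comp_eq hψ, ← pullMetric_apply, map_smul, map_smul,
    smul_apply, ← graphSpeed_sq g hτ, smul_eq_mul, smul_eq_mul, ← mul_assoc,
    Real.sqrt_mul (mul_self_nonneg _), Real.sqrt_mul_self_eq_abs,
    Real.sqrt_sq (graphSpeed_pos g hτ _).le]

/-- Both terms of g(∇V, v') are quadratic in Ψ', while the speed contributes |Ψ'| to the
denominator. What remains is the Jacobian factor. -/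
theorem innerCovDeriv_field (h : Sob 2) (t : ℝ) :
    (1 / speed g (A.graph τ.fn ∘ ψ) t) *
      innerCovDeriv g (fun s : ℝ => (A.graph τ.fn ∘ ψ) (s : S1)) (A.field τ.fn h.fn ψ) t
        (velocity (A.graph τ.fn ∘ ψ) t) = |deriv Ψ t| * A.firstVariation g τ h (Ψ t) := by
  have hpos := graphSpeed_pos g hτ (Ψ t)
  rw [innerCovDeriv_eq g A.isOpen_strip A.contMDiffOn_map (point_mem hτ (Ψ t))
    (y := fun s => τ.point (Ψ s)) (Y := fun s => (0, h.fn (Ψ s : S1)))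
    (Y' := deriv Ψ t • ((0 : ℝ), (Sob.derivL 0 h).fn (Ψ t : S1)))
    (hasDerivAt_point_comp hψ t)
    (((hasDerivAt_const (Ψ t) (0 : ℝ)).prodMk (h.hasDerivAt (Ψ t))).scomp t (hψ.hasDerivAt t))
    (Eventually.of_forall fun s => ⟨graph_comp_eq hψ s, field_graph_comp hτ hψ h.fn s⟩)
    (velocity_graph_comp hτ hψ t), speed_graph_comp g hτ hψ, firstVariation]
  have h1 : ∀ (c : ℝ) (y u w z : ℝ × ℝ), gammaForm (pullMetric g A.map) y (c • u) w (c • z) =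
      c * c * gammaForm (pullMetric g A.map) y u w z := by
    intro c y u w z
    simp only [gammaForm, map_smul, smul_apply, smul_eq_mul]
    ring
  have h2 : |deriv Ψ t| ≠ 0 := abs_ne_zero.2 (hψ.deriv_ne_zero t)
  rw [h1, map_smul, map_smul, smul_apply, smul_eq_mul, smul_eq_mul]
  have h3 : deriv Ψ t * deriv Ψ t = |deriv Ψ t| * |deriv Ψ t| := (abs_mul_abs_self _).symm
  rw [← mul_assoc, h3]
  field_simp

theorem integral_innerCovDeriv_field (h : Sob 2) :
    ∫ t in (0 : ℝ)..1, (1 / speed g (A.graph τ.fn ∘ ψ) t) *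
      innerCovDeriv g (fun s : ℝ => (A.graph τ.fn ∘ ψ) (s : S1)) (A.field τ.fn h.fn ψ) t
        (velocity (A.graph τ.fn ∘ ψ) t) = ∫ x in (0 : ℝ)..1, A.firstVariation g τ h x := by
  simp_rw [innerCovDeriv_field g hτ hψ h]
  exact hψ.integral_comp (periodic_firstVariation g hτ h)

section ConstantSpeed

variable {ℓ : ℝ} (hℓ : ∀ t, speed g (A.graph τ.fn ∘ ψ) t = ℓ)
include hℓ

theorem constantSpeed_pos : 0 < ℓ := by
  rw [← hℓ 0, speed_graph_comp g hτ hψ]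
  exact mul_pos (abs_pos.2 (hψ.deriv_ne_zero 0)) (graphSpeed_pos g hτ _)

theorem velocity_constantSpeed {s : ℝ} (hs : s * s = 1)
    (hs' : ∀ t, |deriv Ψ t| = s * deriv Ψ t) (t : ℝ) :
    (velocity (A.graph τ.fn ∘ ψ) t : Plane) =
      dM A.map (τ.point (Ψ t)) ((s * ℓ) • A.unitTangent g τ (Ψ t)) := by
  rw [velocity_graph_comp hτ hψ, ← hℓ t, speed_graph_comp g hτ hψ, hs', tangent_eq g hτ (Ψ t),
    smul_smul]
  congr 2
  rw [← mul_assoc, ← mul_assoc, hs, one_mul]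

/-- At constant speed the velocity in the coordinates of σ is ± ℓ T(Ψ), with T the unit tangent of
the graph. Since T is `C^1`, the velocity is differentiable at every t, although no second
derivative of Ψ is assumed. -/
theorem innerCovDeriv_velocity (t : ℝ) (ζ : ℝ × ℝ)
    {Z : TangentSpace (𝓡 2) ((A.graph τ.fn ∘ ψ) (t : S1))}
    (hZ : (Z : Plane) = dM A.map (τ.point (Ψ t)) ζ) :
    innerCovDeriv g (fun s : ℝ => (A.graph τ.fn ∘ ψ) (s : S1)) (velocity (A.graph τ.fn ∘ ψ)) t Z =
      ℓ * (|deriv Ψ t| * A.curvature g τ (Ψ t) ζ) := by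
  obtain ⟨s, hs, hs'⟩ := hψ.exists_sign
  rw [innerCovDeriv_eq g A.isOpen_strip A.contMDiffOn_map (point_mem hτ (Ψ t))
    (y := fun s => τ.point (Ψ s)) (Y := fun r => (s * ℓ) • A.unitTangent g τ (Ψ r))
    (hasDerivAt_point_comp hψ t)
    (((hasDerivAt_unitTangent g hτ (Ψ t)).scomp t (hψ.hasDerivAt t)).const_smul (s * ℓ))
    (Eventually.of_forall fun r => ⟨graph_comp_eq hψ r,
      velocity_constantSpeed g hτ hψ hℓ hs hs' r⟩) hZ, curvature, add_apply, gammaL_apply, hs']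
  simp only [gammaForm, map_smul, smul_apply, smul_eq_mul]
  ring

theorem integral_innerCovDeriv_velocity (h : Sob 2) :
    ∫ t in (0 : ℝ)..1, (1 / speed g (A.graph τ.fn ∘ ψ) t) *
      innerCovDeriv g (fun s : ℝ => (A.graph τ.fn ∘ ψ) (s : S1))
        (velocity (A.graph τ.fn ∘ ψ)) t (A.field τ.fn h.fn ψ t) =
      -∫ x in (0 : ℝ)..1, A.firstVariation g τ h x := by
  have h1 : ∀ t, (1 / speed g (A.graph τ.fn ∘ ψ) t) *
      innerCovDeriv g (fun s : ℝ => (A.graph τ.fn ∘ ψ) (s : S1))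
        (velocity (A.graph τ.fn ∘ ψ)) t (A.field τ.fn h.fn ψ t) =
      |deriv Ψ t| * A.curvature g τ (Ψ t) (0, h.fn (Ψ t : S1)) := by
    intro t
    have hpos := constantSpeed_pos g hτ hψ hℓ
    rw [innerCovDeriv_velocity g hτ hψ hℓ t _ (field_graph_comp hτ hψ h.fn t), hℓ]
    field_simp
  simp_rw [h1]
  rw [integral_firstVariation g hτ, neg_neg]
  exact hψ.integral_comp (q := fun x => A.curvature g τ x (0, h.fn (x : S1)))
    (periodic_curvature g hτ h)

end ConstantSpeed

omit hψ

/-- The parametrization of a graph with constant speed. -/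
theorem exists_constantSpeed : ∃ ψ : S1 ≃ₜ S1, IsReparam 2 ψ ∧
    ∃ ℓ : ℝ, ∀ t, speed g (A.graph τ.fn ∘ ψ) t = ℓ := by
  set f := A.graphSpeed g τ with hf
  have hfpos : ∀ x, 0 < f x := graphSpeed_pos g hτ
  have hfc : ContDiff ℝ 1 f := contDiff_graphSpeed g hτ
  have hfp : Function.Periodic f 1 := graphSpeed_add_one g hτ
  have hint : ∀ a b, IntervalIntegrable f volume a b := fun a b =>
    hfc.continuous.intervalIntegrable a b
  set ℓ := ∫ x in (0 : ℝ)..1, f x with hℓ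
  have hℓpos : 0 < ℓ := intervalIntegral.intervalIntegral_pos_of_pos (hint 0 1) hfpos one_pos
  -- Normalized arc length. It increases by 1 over a period, and its inverse is the desired
  -- parametrization.
  set θ : ℝ → ℝ := fun x => (∫ y in (0 : ℝ)..x, f y) / ℓ with hθ
  have hθd : ∀ x, HasDerivAt θ (f x / ℓ) x := fun x =>
    (intervalIntegral.integral_hasDerivAt_right (hint 0 x)
      (hfc.continuous.stronglyMeasurableAtFilter _ _) hfc.continuous.continuousAt).div_const ℓ
  have hpos : ∀ x, 0 < f x / ℓ := fun x => div_pos (hfpos x) hℓpos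
  have hcont : Continuous fun x => f x / ℓ := hfc.continuous.div_const ℓ
  have hmono : StrictMono θ := strictMono_of_deriv_pos fun x => by
    rw [(hθd x).deriv]
    exact hpos x
  have h1 : ∀ t, θ (t + 1) = θ t + 1 := by
    intro t
    have h2 := hfp.intervalIntegral_add_eq t 0
    rw [zero_add] at h2
    rw [hθ]
    simp only
    rw [← intervalIntegral.integral_add_adjacent_intervals (hint 0 t) (hint t (t + 1)), h2, ← hℓ,
      add_div, div_self hℓpos.ne']
  obtain ⟨ψ, ξ, hξc, hξ, hξ', hψ, hψ'⟩ := exists_homeomorph_of_lift hmono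
    (continuous_iff_continuousAt.2 fun x => (hθd x).continuousAt) h1
  have hdθ : deriv θ = fun x => f x / ℓ := funext fun x => (hθd x).deriv
  -- Since τ has class W^{3,2}, the speed `f` is `C^1`, so θ and its inverse are of class W^{2,2}.
  have hH : ∀ x, HAt 1 θ x := fun x =>
    ⟨Eventually.of_forall fun x => (hθd x).differentiableAt, by
      rw [hdθ]
      exact W1At.of_contDiffAt (hfc.div_const ℓ).contDiffAt⟩
  have hξd : ∀ x, HasDerivAt ξ (f (ξ x) / ℓ)⁻¹ x := fun x =>
    HasDerivAt.of_local_left_inverse hξc.continuousAt (hθd (ξ x)) (hpos _).ne'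
      (Eventually.of_forall hξ)
  have hlift : IsDiffLift ψ.symm ξ := by
    refine ⟨fun x => (hψ' x).symm, fun x => ?_⟩
    rw [(hξd x).deriv]
    exact inv_ne_zero (hpos _).ne'
  refine ⟨ψ.symm, ⟨ξ, hξc, hlift.coe, isSobolevOn_of_forall_hAt
    fun x => HAt.inverse hθd hcont hpos hξc hξ hH x, hlift.deriv_ne_zero⟩, ℓ, fun t => ?_⟩
  rw [speed_graph_comp g hτ hlift, (hξd t).deriv, abs_of_pos (inv_pos.2 (hpos _)), ← hf]
  have := hfpos (ξ t)
  field_simp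

end Annulus

end LengthFunctional
end

/-! ### Stationary graphs are smooth geodesics -/

noncomputable section
namespace LengthFunctional

open Filter Topology

set_option linter.unusedSectionVars false
set_option maxSynthPendingDepth 3

/-- Solutions of a smooth autonomous differential equation are smooth. -/
theorem contDiff_of_hasDerivAt_comp {X : Type*} [NormedAddCommGroup X] [NormedSpace ℝ X]
    {H : X → X} {W : ℝ → X} (hH : ∀ t, ContDiffAt ℝ ∞ H (W t))
    (hW : ∀ t, HasDerivAt W (H (W t)) t) : ContDiff ℝ ∞ W := by
  refine contDiff_infty.2 fun n => ?_
  induction n with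
  | zero =>
    exact contDiff_zero.2 (continuous_iff_continuousAt.2 fun t => (hW t).continuousAt)
  | succ n ih =>
    have h1 : deriv W = fun t => H (W t) := funext fun t => (hW t).deriv
    push_cast
    refine contDiff_succ_iff_deriv.2 ⟨fun t => (hW t).differentiableAt, by simp, ?_⟩
    rw [h1]
    exact contDiff_iff_contDiffAt.2 fun t =>
      ((hH t).of_le (by exact_mod_cast le_top)).comp t ih.contDiffAt

variable {M : Type*} [TopologicalSpace M] [ChartedSpace Plane M] [IsManifold (𝓡 2) ∞ M]

namespace Annulus

variable {A : Annulus M} (g : RiemMetric M)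

theorem exists_equiv_pullMetric {p : ℝ × ℝ} (hp : p ∈ A.strip) :
    ∃ e : (ℝ × ℝ) ≃L[ℝ] (ℝ × ℝ →L[ℝ] ℝ), (e : ℝ × ℝ →L[ℝ] ℝ × ℝ →L[ℝ] ℝ) = pullMetric g A.map p := by
  have hinj : Function.Injective (pullMetric g A.map p : ℝ × ℝ →ₗ[ℝ] ℝ × ℝ →L[ℝ] ℝ) := by
    refine (injective_iff_map_eq_zero _).2 fun u hu => ?_
    by_contra hne
    have h1 := A.pullMetric_pos g hp hne
    have h2 : pullMetric g A.map p u = 0 := hu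
    rw [h2] at h1
    exact lt_irrefl _ h1
  have hdim : Module.finrank ℝ (ℝ × ℝ) = Module.finrank ℝ (ℝ × ℝ →L[ℝ] ℝ) := by
    rw [← (LinearMap.toContinuousLinearMap (𝕜 := ℝ) (E := ℝ × ℝ) (F' := ℝ)).finrank_eq,
      ← Subspace.dual_finrank_eq (K := ℝ) (V := ℝ × ℝ)]
  exact ⟨(LinearMap.linearEquivOfInjective _ hinj hdim).toContinuousLinearEquiv, rfl⟩

theorem dM_surjective {p : ℝ × ℝ} (hp : p ∈ A.strip) : Function.Surjective (dM A.map p) := by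
  have h1 : Module.finrank ℝ (ℝ × ℝ) = Module.finrank ℝ Plane := by simp
  exact (LinearMap.injective_iff_surjective_of_finrank_eq_finrank h1
    (f := (dM A.map p : ℝ × ℝ →ₗ[ℝ] Plane))).1 (A.dM_injective hp)

/-- The acceleration of a geodesic, in the coordinates of an annulus. -/
def acceleration (A : Annulus M) (g : RiemMetric M) (W : (ℝ × ℝ) × (ℝ × ℝ)) : ℝ × ℝ :=
  -(pullMetric g A.map W.1).inverse (gammaL (pullMetric g A.map) W.1 W.2 W.2)

/-- The metric is an isomorphism of the plane onto its dual, and inversion of operators is smooth at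
isomorphisms. -/
theorem contDiffAt_acceleration {W : (ℝ × ℝ) × (ℝ × ℝ)} (hW : W.1 ∈ A.strip) :
    ContDiffAt ℝ ∞ (A.acceleration g) W := by
  obtain ⟨e, he⟩ := exists_equiv_pullMetric g hW
  have h1 : ContDiffAt ℝ ∞ (pullMetric g A.map) W.1 :=
    (A.contDiffOn_pullMetric g).contDiffAt (A.isOpen_strip.mem_nhds hW)
  have h2 : ContDiffAt ℝ ∞ (fun W : (ℝ × ℝ) × (ℝ × ℝ) => pullMetric g A.map W.1) W :=
    h1.comp W contDiffAt_fst
  have h3 : ContDiffAt ℝ ∞ (fun W : (ℝ × ℝ) × (ℝ × ℝ) => fderiv ℝ (pullMetric g A.map) W.1) W :=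
    (h1.fderiv_right (m := ∞) (by simp)).comp W contDiffAt_fst
  have h4 : ContDiffAt ℝ ∞ (fun W : (ℝ × ℝ) × (ℝ × ℝ) => (pullMetric g A.map W.1).inverse) W := by
    refine ContDiffAt.comp (g := ContinuousLinearMap.inverse) W ?_ h2
    rw [← he]
    exact contDiffAt_map_inverse e
  have h5 : ContDiffAt ℝ ∞ (fun W : (ℝ × ℝ) × (ℝ × ℝ) =>
      gammaL (pullMetric g A.map) W.1 W.2 W.2) W := by
    have hs : ContDiffAt ℝ ∞ (fun W : (ℝ × ℝ) × (ℝ × ℝ) => W.2) W := contDiffAt_snd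
    have hflip : ∀ {F : Type} [NormedAddCommGroup F] [NormedSpace ℝ F]
        {f : (ℝ × ℝ) × (ℝ × ℝ) → ℝ × ℝ →L[ℝ] ℝ × ℝ →L[ℝ] F}, ContDiffAt ℝ ∞ f W →
        ContDiffAt ℝ ∞ (fun W => (f W).flip) W := fun {F} _ _ _ hf =>
      (ContinuousLinearMap.flipₗᵢ ℝ (ℝ × ℝ) (ℝ × ℝ) F).contDiff.contDiffAt.comp W hf
    unfold gammaL
    exact ContDiffAt.const_smul (1 / 2 : ℝ) ((((h3.clm_apply hs).clm_apply hs).add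
      ((h3.clm_apply hs).clm_apply hs)).sub (hflip ((hflip h3).clm_apply hs) |>.clm_apply hs))
  exact (h4.clm_apply h5).neg

variable {τ : Sob 3} (hτ : ∀ x, |τ.fn x| < A.ε)
include hτ

/-- The fundamental lemma of the calculus of variations. Smooth periodic functions are of class
W^{3,2}, so testing on level 1 already annihilates the component of ∇T in the direction (0, 1); the
component along the graph is always zero. -/
theorem curvature_eq_zero_of_integral
    (h : ∀ η : Sob 3, ∫ x in (0 : ℝ)..1, A.firstVariation g τ (Sob.incl 2 η) x = 0) (x : ℝ) :
    A.curvature g τ x = 0 := by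
  have hper : Function.Periodic (fun x => A.curvature g τ x (0, 1)) 1 := fun x => by
    simp only [curvature_add_one g hτ]
  have hc : Continuous fun x => A.curvature g τ x (0, 1) :=
    continuous_curvature g hτ continuous_const
  let K : C(S1, ℝ) := ⟨hper.lift, continuous_circle_lift hc⟩
  have hK : ∀ x : ℝ, K (x : S1) = A.curvature g τ x (0, 1) := fun x => rfl
  have hmem : MemLp K 2 (volume : Measure S1) :=
    K.continuous.memLp_of_hasCompactSupport (HasCompactSupport.of_compactSpace _)
  have h0 : hmem.toLp K = 0 := by
    refine eq_of_integral_eq _ _ fun φ hφ hφp => ?_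
    have h1 : ∀ᵐ t ∂(volume : Measure ℝ), t ∈ Set.uIoc (0 : ℝ) 1 →
        φ t * (hmem.toLp K : S1 → ℝ) (t : S1) = A.curvature g τ t (0, φ t) := by
      filter_upwards [ae_lift hmem.coeFn_toLp] with t ht hI
      rw [ht hI, hK, show ((0 : ℝ), φ t) = φ t • ((0 : ℝ), (1 : ℝ)) by simp, map_smul, smul_eq_mul]
    have h2 : ∀ᵐ t ∂(volume : Measure ℝ), t ∈ Set.uIoc (0 : ℝ) 1 →
        φ t * (0 : Lp ℝ 2 (volume : Measure S1)) (t : S1) = 0 := by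
      filter_upwards [ae_lift (Lp.coeFn_zero ℝ 2 (volume : Measure S1))] with t ht hI
      rw [ht hI]
      simp
    rw [intervalIntegral.integral_congr_ae h1, intervalIntegral.integral_congr_ae h2,
      intervalIntegral.integral_zero]
    obtain ⟨η, hη⟩ := Sob.exists_of_hAt (k := 2) hφp fun t =>
      HAt.of_contDiffAt (contDiffAt_infty.1 hφ.contDiffAt _)
    have h3 := integral_firstVariation g hτ (Sob.incl 2 η)
    rw [h η, Sob.incl_fn] at h3
    simp_rw [hη] at h3
    linarith
  have h1 : (K : S1 → ℝ) =ᵐ[volume] (fun _ => 0 : S1 → ℝ) := by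
    refine hmem.coeFn_toLp.symm.trans ?_
    rw [h0]
    exact Lp.coeFn_zero ℝ 2 _
  have h2 : (K : S1 → ℝ) = fun _ => 0 :=
    (Continuous.ae_eq_iff_eq volume K.continuous continuous_const).1 h1
  ext1
  all_goals
    ext
    exact curvature_eq_zero g hτ (congrFun h2 (x : S1)) _

/-- A graph whose curvature vanishes is a geodesic. -/
theorem isEmbeddedGeodesic_of_curvature_eq_zero (hK : ∀ x, A.curvature g τ x = 0)
    {x : UnparamLoop M} (hx : x.IsParamBy (A.graph τ.fn)) : IsEmbeddedGeodesic g x := by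
  obtain ⟨ψ, hψ, ℓ, hℓ⟩ := exists_constantSpeed g hτ
  obtain ⟨Ψ, hΨ⟩ := hψ.exists_isDiffLift
  obtain ⟨s, hs, hs'⟩ := hΨ.exists_sign
  have hz' : ∀ t, deriv Ψ t • τ.tangent (Ψ t) = (s * ℓ) • A.unitTangent g τ (Ψ t) := by
    intro t
    exact A.dM_injective (point_mem hτ (Ψ t)) ((velocity_graph_comp hτ hΨ t).symm.trans
      (velocity_constantSpeed g hτ hΨ hℓ hs hs' t))
  -- Position and velocity, the latter written through the `C^1` unit tangent. This pair solves a
  -- first order autonomous equation with smooth right-hand side, and bootstrapping makes it smooth.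
  set W : ℝ → (ℝ × ℝ) × (ℝ × ℝ) :=
    fun t => (τ.point (Ψ t), (s * ℓ) • A.unitTangent g τ (Ψ t)) with hWdef
  have hW : ∀ t, HasDerivAt W ((W t).2, A.acceleration g (W t)) t := by
    intro t
    have h1 := hasDerivAt_point_comp (τ := τ) hΨ t
    have h2 := ((hasDerivAt_unitTangent g hτ (Ψ t)).scomp t (hΨ.hasDerivAt t)).const_smul (s * ℓ)
    rw [hz' t] at h1
    refine (h1.prodMk h2).congr_deriv (Prod.ext rfl ?_)
    obtain ⟨e, he⟩ := exists_equiv_pullMetric g (point_mem hτ (Ψ t))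
    have h3 : pullMetric g A.map (τ.point (Ψ t))
        ((s * ℓ) • deriv Ψ t • deriv (A.unitTangent g τ) (Ψ t)) =
        -gammaL (pullMetric g A.map) (W t).1 (W t).2 (W t).2 := by
      -- Vanishing curvature says that the metric applied to T' is -Γ(τ-tangent, T; ·). Multiplying
      -- by sℓΨ' and using `hz'` replaces both arguments by the velocity.
      have h4 := hK (Ψ t)
      rw [curvature, ← eq_neg_iff_add_eq_zero] at h4
      rw [map_smul, map_smul, h4, smul_neg, smul_neg, neg_inj]
      have h5 : gammaL (pullMetric g A.map) (W t).1 (W t).2 (W t).2 =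
          gammaL (pullMetric g A.map) (τ.point (Ψ t)) (deriv Ψ t • τ.tangent (Ψ t))
            ((s * ℓ) • A.unitTangent g τ (Ψ t)) := by rw [hz']
      rw [h5]
      ext1
      all_goals
        ext
        simp only [gammaL, map_smul, smul_apply, add_apply, sub_apply, smul_eq_mul,
          ContinuousLinearMap.comp_apply, ContinuousLinearMap.flip_apply]
        ring
    unfold acceleration
    rw [show (W t).1 = τ.point (Ψ t) from rfl, ← he, ContinuousLinearMap.inverse_equiv]
    rw [← he] at h3
    rw [← map_neg]
    exact (e.symm_apply_eq.2 h3.symm).symm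
  have hsmooth : ContDiff ℝ ∞ fun t => τ.point (Ψ t) := by
    have h1 := contDiff_of_hasDerivAt_comp (H := fun W => (W.2, A.acceleration g W))
      (fun t => contDiffAt_snd.prodMk (contDiffAt_acceleration g (point_mem hτ (Ψ t)))) hW
    exact h1.fst
  have hcont : Continuous (A.graph τ.fn ∘ ψ) :=
    (A.continuous_graph τ.fn.continuous hτ).comp ψ.continuous
  -- The Sobolev class of the composite comes from the smoothness just obtained, so no statement
  -- about compositions of Sobolev maps is needed.
  have hemb : IsEmbeddedLoop 2 (A.graph τ.fn ∘ ψ) := by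
    obtain ⟨hv, hx⟩ := hx
    refine ⟨isSobolevLoop_of_local hcont fun t => ⟨A.map, _, _,
      A.contMDiffAt_map (point_mem hτ (Ψ t)),
      HAt.of_contDiffAt (contDiffAt_infty.1 hsmooth.fst.contDiffAt _),
      HAt.of_contDiffAt (contDiffAt_infty.1 hsmooth.snd.contDiffAt _),
      Eventually.of_forall fun r => graph_comp_eq hΨ r⟩,
      hv.2.1.comp ψ.injective, fun t ht => ?_⟩
    have h1 := (velocity_graph_comp hτ hΨ t).symm.trans ht
    have h2 : deriv Ψ t • τ.tangent (Ψ t) = 0 :=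
      (map_eq_zero_iff _ (A.dM_injective (point_mem hτ (Ψ t)))).1 h1
    exact (smul_ne_zero (hΨ.deriv_ne_zero t) (one_mk_ne_zero _)) h2
  refine ⟨A.graph τ.fn ∘ ψ, ⟨hemb, ?_⟩, ?_, fun t Z => ?_⟩
  · obtain ⟨hv, rfl⟩ := hx
    exact (Quot.sound ⟨ψ, hψ, rfl⟩).symm
  · have h1 : (fun t : ℝ => (A.graph τ.fn ∘ ψ) (t : S1)) = A.map ∘ fun t => τ.point (Ψ t) :=
      funext fun t => graph_comp_eq hΨ t
    rw [h1]
    exact fun t => (A.contMDiffAt_map (point_mem hτ (Ψ t))).comp t hsmooth.contMDiff.contMDiffAt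
  · obtain ⟨ζ, hζ⟩ := dM_surjective (point_mem hτ (Ψ t)) Z
    rw [innerCovDeriv_velocity g hτ hΨ hℓ t ζ hζ.symm, hK]
    simp

/-- Only the chart at hand is used: there the sc-differential is zero on level 1, and uniqueness of
derivatives identifies it with the integral of the first variation. -/
theorem isEmbeddedGeodesic_of_isCriticalPoint {x : UnparamLoop M}
    (hx : x.IsParamBy (A.graph τ.fn))
    (hcrit : IsCriticalPoint (UnparamLoop.length g) x) : IsEmbeddedGeodesic g x := by
  refine isEmbeddedGeodesic_of_curvature_eq_zero g hτ
    (curvature_eq_zero_of_integral g hτ fun η => ?_) hx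
  obtain ⟨D, hD, hD'⟩ := hasScDifferentialAt_length g hτ
  have h1 := hD.unique (hcrit.2 A τ hτ hx)
  have h2 := congrArg (fun T : Sob 3 →L[ℝ] ℝ => T η) h1
  rw [← hD']
  exact h2

end Annulus

/-! ### Geodesics are critical points -/

/-- A loop with vanishing acceleration has constant speed. -/
theorem speed_eq_of_geodesic (g : RiemMetric M) {v : S1 → M}
    (hv : ContMDiff 𝓘(ℝ, ℝ) (𝓡 2) ∞ (fun t : ℝ => v (t : S1)))
    (h : ∀ (t : ℝ) (Z : TangentSpace (𝓡 2) (v (t : S1))),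
      innerCovDeriv g (fun s : ℝ => v (s : S1)) (velocity v) t Z = 0) (t : ℝ) :
    speed g v t = speed g v 0 := by
  have key : ∀ t, HasDerivAt (fun s : ℝ =>
      innerAt g (v (s : S1)) (velocity v s) (velocity v s)) 0 t := by
    intro t
    obtain ⟨p, hp⟩ : ∃ p, p = v (t : S1) := ⟨_, rfl⟩
    set φ := (extChartAt (𝓡 2) p).symm with hφ
    set y : ℝ → Plane := fun s => extChartAt (𝓡 2) p (v (s : S1)) with hy
    have hU := isOpen_extChartAt_target (I := 𝓡 2) p
    have hev : ∀ᶠ s : ℝ in 𝓝 t, v (s : S1) ∈ (extChartAt (𝓡 2) p).source :=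
      hv.continuous.continuousAt.eventually ((isOpen_extChartAt_source p).mem_nhds
        (by rw [hp]; exact mem_extChartAt_source _))
    have hys : ∀ s : ℝ, v (s : S1) ∈ (extChartAt (𝓡 2) p).source → ContDiffAt ℝ ∞ y s := by
      intro s hs
      have h1 : ContMDiffAt (𝓡 2) 𝓘(ℝ, Plane) ∞ (extChartAt (𝓡 2) p) (v (s : S1)) :=
        contMDiffAt_extChartAt' (by rwa [extChartAt_source] at hs)
      exact (h1.comp s hv.contMDiffAt).contDiffAt
    have hmap : ∀ s : ℝ, v (s : S1) ∈ (extChartAt (𝓡 2) p).source →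
        y s ∈ (extChartAt (𝓡 2) p).target := fun s hs => (extChartAt (𝓡 2) p).map_source hs
    have hvφ : ∀ᶠ s : ℝ in 𝓝 t, v (s : S1) = φ (y s) ∧
        (velocity v s : Plane) = dM φ (y s) (deriv y s) := by
      filter_upwards [hev.eventually_nhds] with s hs
      have h1 : ∀ᶠ r : ℝ in 𝓝 s, v (r : S1) = φ (y r) :=
        hs.mono fun r hr => ((extChartAt (𝓡 2) p).left_inv hr).symm
      refine ⟨h1.self_of_nhds, velocity_eq ?_
        ((hys s hs.self_of_nhds).differentiableAt (by simp)).hasDerivAt h1⟩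
      exact ((contDiffOn_chart p).contMDiffAt
        (hU.mem_nhds (hmap s hs.self_of_nhds))).mdifferentiableAt (by simp)
    have hyt := hys t hev.self_of_nhds
    have hy1 : HasDerivAt y (deriv y t) t := (hyt.differentiableAt (by simp)).hasDerivAt
    have hy2 : HasDerivAt (deriv y) (deriv (deriv y) t) t :=
      (((hyt.fderiv_right (m := 1) (by norm_cast)).clm_apply
        contDiffAt_const).differentiableAt (by simp)).hasDerivAt
    have h1 := innerCovDeriv_eq g hU (contDiffOn_chart p) (hmap t hev.self_of_nhds) hy1 hy2 hvφ
      hvφ.self_of_nhds.2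
    rw [h] at h1
    have hQ : DifferentiableAt ℝ (pullMetric g φ) (y t) :=
      ((contDiffOn_pullMetric g hU (contDiffOn_chart p)).contDiffAt
        (hU.mem_nhds (hmap t hev.self_of_nhds))).differentiableAt (by simp)
    -- The derivative of g(v', v') is 2 g(∇v', v'), which vanishes by assumption.
    have h2 := ((hQ.hasFDerivAt.comp_hasDerivAt t hy1).clm_apply hy2).clm_apply hy2
    refine (h2.congr_of_eventuallyEq ?_).congr_deriv ?_
    · filter_upwards [hvφ] with s hs
      rw [hs.2, hs.1]
      rfl
    · rw [gammaForm] at h1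
      simp only [Function.comp_apply, add_apply] at h1 ⊢
      rw [pullMetric_symm g φ (y t) (deriv y t)]
      linarith
  have h1 := is_const_of_deriv_eq_zero (fun t => (key t).differentiableAt)
    (fun t => (key t).deriv) t 0
  exact congrArg Real.sqrt h1

/-- Equality in the quotient is the equivalence relation generated by reparametrization.
Differentiable lifts with nonzero derivative are closed under composition and inversion for
elementary reasons, and the Sobolev class of the reparametrization is not needed later. -/
theorem exists_isDiffLift_of_isParamBy {x : UnparamLoop M} {v w : S1 → M} (hv : x.IsParamBy v)
    (hw : x.IsParamBy w) : ∃ (ψ : S1 ≃ₜ S1) (Ψ : ℝ → ℝ), IsDiffLift ψ Ψ ∧ w = v ∘ ψ := by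
  obtain ⟨hv', rfl⟩ := hv
  obtain ⟨hw', hw⟩ := hw
  have key : ∀ a b : EmbeddedLoop M, Relation.EqvGen
      (fun v w : EmbeddedLoop M => ∃ ψ : S1 ≃ₜ S1, IsReparam 2 ψ ∧ w.1 = v.1 ∘ ψ) a b →
      ∃ (ψ : S1 ≃ₜ S1) (Ψ : ℝ → ℝ), IsDiffLift ψ Ψ ∧ b.1 = a.1 ∘ ψ := by
    intro a b hab
    induction hab with
    | rel a b h =>
      obtain ⟨ψ, hψ, h⟩ := h
      obtain ⟨Ψ, hΨ⟩ := hψ.exists_isDiffLift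
      exact ⟨ψ, Ψ, hΨ, h⟩
    | refl a =>
      exact ⟨Homeomorph.refl _, id, ⟨fun _ => rfl, fun t => by simp⟩, rfl⟩
    | symm a b _ ih =>
      obtain ⟨ψ, Ψ, hΨ, h⟩ := ih
      obtain ⟨Ξ, hΞ⟩ := hΨ.exists_symm
      refine ⟨ψ.symm, Ξ, hΞ, ?_⟩
      rw [h]
      funext t
      simp
    | trans a b c _ _ ih₁ ih₂ =>
      obtain ⟨ψ₁, Ψ₁, h₁, e₁⟩ := ih₁
      obtain ⟨ψ₂, Ψ₂, h₂, e₂⟩ := ih₂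
      exact ⟨ψ₂.trans ψ₁, _, h₂.comp h₁, by rw [e₂, e₁]; rfl⟩
  exact key ⟨v, hv'⟩ ⟨w, hw'⟩ (Quot.eqvGen_exact hw.symm)

/-- The geodesic is a constant speed reparametrization of the graph in any chart at `x`, so the
variation formula with ∇v' applies and its integrand is zero. The level 1 condition follows from
smoothness. -/
theorem isCriticalPoint_of_isEmbeddedGeodesic (g : RiemMetric M) {x : UnparamLoop M}
    (hx : IsEmbeddedGeodesic g x) : IsCriticalPoint (UnparamLoop.length g) x := by
  obtain ⟨v, hxv, hv, hgeo⟩ := hx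
  refine ⟨⟨v, ?_, hxv⟩, fun A τ hτ hxτ => ?_⟩
  · obtain ⟨hemb, -⟩ := hxv
    refine ⟨isSobolevLoop_of_chart hemb.1.1 fun t i => HAt.of_contDiffAt ?_, hemb.2⟩
    have h1 : ContMDiffAt 𝓘(ℝ, ℝ) 𝓘(ℝ, Plane) ∞
        (fun s : ℝ => extChartAt (𝓡 2) (v (t : S1)) (v (s : S1))) t :=
      (contMDiffAt_extChartAt (n := ∞)).comp t hv.contMDiffAt
    exact contDiffAt_infty.1
      ((EuclideanSpace.proj (𝕜 := ℝ) i).contDiff.contDiffAt.comp t h1.contDiffAt) _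
  · obtain ⟨ψ, Ψ, hΨ, rfl⟩ := exists_isDiffLift_of_isParamBy hxτ hxv
    obtain ⟨D, hD, hD'⟩ := Annulus.hasScDifferentialAt_length g hτ
    have h0 : D = 0 := by
      ext h
      have h1 := Annulus.integral_innerCovDeriv_velocity g hτ hΨ
        (fun t => speed_eq_of_geodesic g hv hgeo t) h
      simp_rw [hgeo] at h1
      rw [hD']
      simp only [mul_zero, intervalIntegral.integral_zero] at h1
      simpa using h1.symm
    rwa [h0] at hD

end LengthFunctional
end

noncomputable section
namespace LengthFunctional

open Filter Topology

set_option linter.unusedSectionVars false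
set_option maxSynthPendingDepth 3

/-! ### Smooth functions close to a given parameter along a curve -/

/-- The Stone–Weierstrass theorem for the algebra generated by `X`, which separates points by
injectivity. -/
theorem exists_polynomial_comp_near {X h : ℝ → ℝ} {a b ε : ℝ} (hX : ContinuousOn X (Icc a b))
    (hinj : InjOn X (Icc a b)) (hh : ContinuousOn h (Icc a b)) (hε : 0 < ε) :
    ∃ p : Polynomial ℝ, ∀ t ∈ Icc a b, |p.eval (X t) - h t| < ε := by
  let X₁ : C(Icc a b, ℝ) := ⟨(Icc a b).domRestrict X, hX.domRestrict⟩
  let h₁ : C(Icc a b, ℝ) := ⟨(Icc a b).domRestrict h, hh.domRestrict⟩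
  obtain ⟨⟨f, hf⟩, hfε⟩ := ContinuousMap.exists_mem_subalgebra_near_continuousMap_of_separatesPoints
    (Algebra.adjoin ℝ {X₁}) (fun s t hst => ⟨X₁, ⟨X₁, Algebra.subset_adjoin rfl, rfl⟩, fun h =>
      hst (Subtype.ext (hinj s.2 t.2 h))⟩) h₁ ε hε
  rw [Algebra.adjoin_singleton_eq_range_aeval] at hf
  obtain ⟨p, rfl⟩ := hf
  refine ⟨p, fun t ht => ?_⟩
  have h1 := (ContinuousMap.norm_coe_le_norm _ (⟨t, ht⟩ : Icc a b)).trans_lt hfε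
  have h2 : (Polynomial.aeval X₁ p : C(Icc a b, ℝ)) ⟨t, ht⟩ = p.eval (X t) := by
    rw [Polynomial.aeval_continuousMap_apply]
    exact Polynomial.coe_aeval_eq_eval (X t) ▸ rfl
  have h3 : ‖(Polynomial.aeval X₁ p : C(Icc a b, ℝ)) ⟨t, ht⟩ - h t‖ < ε := h1
  rwa [h2] at h3

/-- The inverse function of `X` would serve, but it is only as regular as `X`. Instead 1/X' is
approximated by a polynomial in `X`, and E is a primitive of this polynomial. -/
theorem exists_contDiff_comp_near {X X' : ℝ → ℝ} {a b ε : ℝ} (hab : a < b)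
    (hX : ∀ t ∈ Icc a b, HasDerivAt X (X' t) t) (hX' : ContinuousOn X' (Icc a b))
    (h0 : ∀ t ∈ Icc a b, X' t ≠ 0) (hε : 0 < ε) :
    ∃ E : ℝ → ℝ, ContDiff ℝ ∞ E ∧ ∀ t ∈ Icc a b, |E (X t) - t| ≤ ε ∧
      |deriv E (X t) * X' t - 1| ≤ ε := by
  have hXc : ContinuousOn X (Icc a b) := fun t ht => (hX t ht).continuousAt.continuousWithinAt
  have hlt : ∀ s ∈ Icc a b, ∀ t ∈ Icc a b, s < t → X s ≠ X t := by
    intro s hs t ht hst h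
    have hsub : Icc s t ⊆ Icc a b := Icc_subset_Icc hs.1 ht.2
    obtain ⟨c, hc, hc'⟩ := exists_hasDerivAt_eq_zero hst (hXc.mono hsub) h fun x hx =>
      hX x (hsub (Ioo_subset_Icc_self hx))
    exact h0 c (hsub (Ioo_subset_Icc_self hc)) hc'
  have hinj : InjOn X (Icc a b) := by
    intro s hs t ht h
    by_contra hne
    rcases lt_or_gt_of_ne hne with h1 | h1
    · exact hlt s hs t ht h1 h
    · exact hlt t ht s hs h1 h.symm
  obtain ⟨C, hC⟩ := isCompact_Icc.exists_bound_of_continuousOn hX'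
  have hC0 : 0 ≤ C := (norm_nonneg _).trans (hC a ⟨le_rfl, hab.le⟩)
  have hba : 0 < b - a := sub_pos.2 hab
  -- The derivative error is at most ηC and the error of the values at most ηC(b - a), by the mean
  -- value inequality from the left endpoint.
  set η := ε / ((C + 1) * (b - a + 1)) with hη
  have hηpos : 0 < η := by positivity
  have hηC : η * C * (b - a) ≤ ε ∧ η * C ≤ ε := by
    have h1 : η * ((C + 1) * (b - a + 1)) = ε := by
      rw [hη]
      field_simp
    have h2 : 0 ≤ η * C := by positivity
    have h3 : 0 ≤ η * C * (b - a) := by positivity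
    constructor <;> nlinarith
  obtain ⟨p, hp⟩ := exists_polynomial_comp_near hXc hinj (hX'.inv₀ h0) hηpos
  have hpc : ContDiff ℝ ∞ fun x => p.eval x := by
    simpa using p.contDiff_aeval (𝕜 := ℝ) ∞
  set E : ℝ → ℝ := fun x => a + ∫ s in (X a)..x, p.eval s with hE
  have hEd : ∀ x, HasDerivAt E (p.eval x) x := fun x =>
    (intervalIntegral.integral_hasDerivAt_right (p.continuous.intervalIntegrable _ _)
      (p.continuous.stronglyMeasurableAtFilter _ _) p.continuous.continuousAt).const_add a
  have hdE : deriv E = fun x => p.eval x := funext fun x => (hEd x).deriv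
  have hb : ∀ t ∈ Icc a b, |p.eval (X t) * X' t - 1| ≤ η * C := by
    intro t ht
    have h1 : p.eval (X t) * X' t - 1 = (p.eval (X t) - (X' t)⁻¹) * X' t := by
      rw [sub_mul, inv_mul_cancel₀ (h0 t ht)]
    rw [h1, abs_mul]
    exact mul_le_mul (hp t ht).le (hC t ht) (abs_nonneg _) hηpos.le
  refine ⟨E, ?_, fun t ht => ⟨?_, ?_⟩⟩
  · refine contDiff_infty_iff_deriv.2 ⟨fun x => (hEd x).differentiableAt, ?_⟩
    rw [hdE]
    exact hpc
  · have h1 := (convex_Icc a b).norm_image_sub_le_of_norm_hasDerivWithin_le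
      (f := fun t => E (X t) - t) (fun s hs => (((hEd (X s)).comp s (hX s hs)).sub
        (hasDerivAt_id s)).hasDerivWithinAt) hb ⟨le_rfl, hab.le⟩ ht
    have h2 : E (X a) - a = 0 := by simp [hE]
    rw [h2, sub_zero] at h1
    refine h1.trans (le_trans ?_ hηC.1)
    refine mul_le_mul_of_nonneg_left ?_ (by positivity)
    rw [Real.norm_eq_abs, abs_of_nonneg (by linarith [ht.1])]
    linarith [ht.2]
  · rw [hdE]
    exact (hb t ht).trans hηC.2

/-- The point `exp (2 π i t)` of the unit circle. -/
def circ (t : ℝ) : ℂ := Complex.exp (Complex.I * ((2 * Real.pi * t : ℝ) : ℂ))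

theorem norm_circ (t : ℝ) : ‖circ t‖ = 1 := Complex.norm_exp_I_mul_ofReal _

theorem circ_ne_zero (t : ℝ) : circ t ≠ 0 := Complex.exp_ne_zero _

theorem circ_add (s t : ℝ) : circ (s + t) = circ s * circ t := by
  unfold circ
  rw [← Complex.exp_add]
  congr 1
  push_cast
  ring

theorem circ_zero : circ 0 = 1 := by simp [circ]

theorem circ_eq_circ_iff {s t : ℝ} : circ s = circ t ↔ (s : S1) = (t : S1) := by
  unfold circ
  rw [Complex.exp_eq_exp_iff_exists_int, eq_comm (a := (s : S1)), QuotientAddGroup.eq]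
  constructor
  · rintro ⟨n, hn⟩
    refine ⟨n, ?_⟩
    have h1 : Complex.I * (2 * Real.pi * (s : ℂ)) = Complex.I * (2 * Real.pi * ((t : ℂ) + n)) := by
      push_cast at hn
      rw [hn]
      ring
    have h2 : (s : ℂ) = t + n := by
      have h3 : (2 * Real.pi : ℂ) ≠ 0 := by
        exact_mod_cast Real.two_pi_pos.ne'
      exact mul_left_cancel₀ h3 (mul_left_cancel₀ Complex.I_ne_zero h1)
    have h4 : s = t + n := by exact_mod_cast h2
    simp [h4]
  · rintro ⟨n, hn⟩
    refine ⟨n, ?_⟩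
    have h4 : s = t + n := by
      have : (n : ℝ) = -t + s := by simpa using hn
      linarith
    rw [h4]
    push_cast
    ring

theorem circ_add_one (t : ℝ) : circ (t + 1) = circ t :=
  circ_eq_circ_iff.2 (AddCircle.coe_add_period 1 t)

theorem norm_circ_sub_one_le (t : ℝ) : ‖circ t - 1‖ ≤ 2 * Real.pi * |t| := by
  refine (Real.norm_exp_I_mul_ofReal_sub_one_le).trans ?_
  rw [Real.norm_eq_abs, abs_mul, abs_of_pos Real.two_pi_pos]

theorem hasDerivAt_circ {g : ℝ → ℝ} {g' t : ℝ} (hg : HasDerivAt g g' t) :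
    HasDerivAt (fun s => circ (g s)) (circ (g t) * (Complex.I * ((2 * Real.pi * g' : ℝ) : ℂ))) t :=
  (((hg.const_mul (2 * Real.pi)).ofReal_comp).const_mul Complex.I).cexp

theorem contDiff_circ : ContDiff ℝ ∞ circ := by
  unfold circ
  exact (contDiff_const.mul (Complex.ofRealCLM.contDiff.comp
    (contDiff_const.mul contDiff_id))).cexp

variable {M : Type*} [TopologicalSpace M] [ChartedSpace Plane M] [IsManifold (𝓡 2) ∞ M]

theorem IsEmbeddedLoop.mdifferentiableAt {k : ℕ} {v : S1 → M} (hv : IsEmbeddedLoop k v) (t : ℝ) :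
    MDifferentiableAt 𝓘(ℝ, ℝ) (𝓡 2) (fun s : ℝ => v (s : S1)) t := by
  by_contra hn
  apply hv.2.2 t
  have h0 := mfderiv_zero_of_not_mdifferentiableAt hn
  change mfderiv 𝓘(ℝ, ℝ) (𝓡 2) (fun s : ℝ => v (s : S1)) t (1 : ℝ) = 0
  rw [h0]
  rfl

theorem IsEmbeddedLoop.continuous_lift {k : ℕ} {v : S1 → M} (hv : IsEmbeddedLoop k v) :
    Continuous fun t : ℝ => v (t : S1) := hv.1.1.comp (AddCircle.continuous_mk' 1)

/-- Some coordinate function has nonzero derivative along an embedded loop. -/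
theorem IsEmbeddedLoop.exists_deriv_ne_zero {k : ℕ} {v : S1 → M} (hv : IsEmbeddedLoop k v)
    (t : ℝ) : ∃ f : M → ℝ, ContMDiffOn (𝓡 2) 𝓘(ℝ, ℝ) ∞ f (chartAt Plane (v (t : S1))).source ∧
      deriv (fun s : ℝ => f (v (s : S1))) t ≠ 0 := by
  by_contra! hcon
  apply hv.2.2 t
  have hd : MDifferentiableAt 𝓘(ℝ, ℝ) 𝓘(ℝ, Plane)
      (fun s : ℝ => extChartAt (𝓡 2) (v (t : S1)) (v (s : S1))) t :=
    (mdifferentiableAt_extChartAt (mem_chart_source Plane (v (t : S1)))).comp t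
      (hv.mdifferentiableAt t)
  have hy := hd.differentiableAt.hasDerivAt
  have hy0 : deriv (fun s : ℝ => extChartAt (𝓡 2) (v (t : S1)) (v (s : S1))) t = 0 := by
    ext i
    have h1 := hcon (fun x => extChartAt (𝓡 2) (v (t : S1)) x i) ?_
    · have h2 := ((EuclideanSpace.proj (𝕜 := ℝ) i).hasFDerivAt.comp_hasDerivAt t hy).deriv
      exact h2.symm.trans h1
    · exact (EuclideanSpace.proj (𝕜 := ℝ) i).contDiff.contMDiff.comp_contMDiffOn
        contMDiffOn_extChartAt
  rw [hy0] at hy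
  have h3 : (velocity v t : Plane) = dM (extChartAt (𝓡 2) (v (t : S1))).symm
      (extChartAt (𝓡 2) (v (t : S1)) (v (t : S1))) 0 := by
    refine velocity_eq ?_ hy ?_
    · exact ((contDiffOn_chart _).contMDiffAt ((isOpen_extChartAt_target _).mem_nhds
        (mem_extChartAt_target _))).mdifferentiableAt (by simp)
    · filter_upwards [hv.continuous_lift.continuousAt.eventually
        (extChartAt_source_mem_nhds (I := 𝓡 2) (v (t : S1)))] with s hs
      exact ((extChartAt (𝓡 2) (v (t : S1))).left_inv hs).symm
  rw [map_zero] at h3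
  exact h3

section Approximation

variable [T2Space M]

/-- The image of the complement of `N` is compact, hence closed in the Hausdorff space M. -/
theorem exists_open_inter_range {v : S1 → M} (hv : Continuous v) (hinj : Function.Injective v)
    {N : Set S1} (hN : IsOpen N) : ∃ U : Set M, IsOpen U ∧ v ⁻¹' U = N := by
  refine ⟨(v '' Nᶜ)ᶜ, (hN.isClosed_compl.isCompact.image hv).isClosed.isOpen_compl, ?_⟩
  rw [preimage_compl, preimage_image_eq _ hinj, compl_compl]

/-- A coordinate f is a regular parameter on a short arc of the loop, so a smooth function E(f) can
be `C^1`-close to t there. The set U meets the loop only in this arc and does not depend on ε; the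
partition of unity can therefore be chosen before ε. -/
theorem IsEmbeddedLoop.exists_local_angle {k : ℕ} {v : S1 → M} (hv : IsEmbeddedLoop (k + 2) v)
    (t₀ : ℝ) : ∃ U : Set M, IsOpen U ∧ v (t₀ : S1) ∈ U ∧ ∀ ε > 0, ∃ z : M → ℂ,
      ContMDiffOn (𝓡 2) 𝓘(ℝ, ℂ) ∞ z U ∧ ∀ t : ℝ, v (t : S1) ∈ U →
        ‖z (v (t : S1)) * circ (-t) - 1‖ ≤ ε ∧
        ‖deriv (fun s : ℝ => z (v (s : S1)) * circ (-s)) t‖ ≤ ε := by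
  obtain ⟨f, hf, hft⟩ := hv.exists_deriv_ne_zero t₀
  set S := (chartAt Plane (v (t₀ : S1))).source with hS
  have hSo : IsOpen S := (chartAt Plane (v (t₀ : S1))).open_source
  have hSt : v (t₀ : S1) ∈ S := mem_chart_source _ _
  set X : ℝ → ℝ := fun s => f (v (s : S1)) with hX
  have hXd : ∀ s : ℝ, v (s : S1) ∈ S → ContDiffAt ℝ 1 X s := fun s hs =>
    (hv.1.hAt_comp (hf.contMDiffAt (hSo.mem_nhds hs))).contDiffAt.of_le (by
      exact_mod_cast Nat.le_add_left 1 k)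
  have hdc : ∀ s : ℝ, v (s : S1) ∈ S → ContinuousAt (deriv X) s := fun s hs =>
    (((hXd s hs).fderiv_right (m := 0) (by norm_num)).clm_apply contDiffAt_const).continuousAt
  have hev : ∀ᶠ s : ℝ in 𝓝 t₀, v (s : S1) ∈ S ∧ deriv X s ≠ 0 :=
    (hv.continuous_lift.continuousAt.eventually (hSo.mem_nhds hSt)).and
      ((hdc t₀ hSt).eventually_ne hft)
  obtain ⟨δ, hδ, hball⟩ := Metric.eventually_nhds_iff_ball.1 hev
  have hI : ∀ s ∈ Icc (t₀ - δ / 2) (t₀ + δ / 2), v (s : S1) ∈ S ∧ deriv X s ≠ 0 := by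
    intro s hs
    refine hball s ?_
    rw [Real.ball_eq_Ioo]
    exact ⟨by linarith [hs.1], by linarith [hs.2]⟩
  obtain ⟨U, hU, hUv⟩ := exists_open_inter_range hv.1.1 hv.2.1
    (QuotientAddGroup.isOpenMap_coe (Ioo (t₀ - δ / 2) (t₀ + δ / 2)) isOpen_Ioo :
      IsOpen (((↑) : ℝ → S1) '' Ioo (t₀ - δ / 2) (t₀ + δ / 2)))
  refine ⟨U ∩ S, hU.inter hSo, ⟨?_, hSt⟩, fun ε hε => ?_⟩
  · change (t₀ : S1) ∈ v ⁻¹' U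
    rw [hUv]
    exact ⟨t₀, ⟨by linarith, by linarith⟩, rfl⟩
  have hεπ : 0 < ε / (2 * Real.pi) := div_pos hε Real.two_pi_pos
  obtain ⟨E, hE, hEX⟩ := exists_contDiff_comp_near (a := t₀ - δ / 2) (b := t₀ + δ / 2)
    (by linarith) (fun s hs => ((hXd s (hI s hs).1).differentiableAt (by simp)).hasDerivAt)
    (fun s hs => (hdc s (hI s hs).1).continuousWithinAt) (fun s hs => (hI s hs).2) hεπ
  refine ⟨fun x => circ (E (f x)), (contDiff_circ.comp hE).contMDiff.comp_contMDiffOn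
    (hf.mono inter_subset_right), fun t ht => ?_⟩
  set w : ℝ → ℂ := fun s => circ (E (f (v (s : S1)))) * circ (-s) with hw
  have hwp : Function.Periodic w 1 := fun s => by
    have h1 : circ (-(s + 1)) = circ (-s) := by
      rw [← circ_add_one (-(s + 1))]
      congr 1
      ring
    rw [hw]
    simp only [AddCircle.coe_add_period, h1]
  have hwd : Function.Periodic (deriv w) 1 := fun s => by
    rw [← deriv_comp_add_const]
    simp_rw [hwp _]
  have ht1 : (t : S1) ∈ ((↑) : ℝ → S1) '' Ioo (t₀ - δ / 2) (t₀ + δ / 2) := by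
    rw [← hUv]
    exact ht.1
  -- The parameter t is known only modulo 1; periodicity moves it to the arc around t₀.
  obtain ⟨s, hs, hst⟩ := ht1
  rw [QuotientAddGroup.eq] at hst
  obtain ⟨n, hn⟩ := hst
  have hts : t = s + n * 1 := by
    have : (n : ℝ) = -s + t := by simpa using hn
    linarith
  have hs' := Ioo_subset_Icc_self hs
  obtain ⟨h1, h2⟩ := hEX s hs'
  have hweq : w = fun s => circ (E (X s) - s) := funext fun s => by
    rw [sub_eq_add_neg, circ_add]
  have hd : HasDerivAt (fun s => E (X s) - s) (deriv E (X s) * deriv X s - 1) s :=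
    ((hE.differentiable (by simp) (X s)).hasDerivAt.comp s
      ((hXd s (hI s hs').1).differentiableAt (by simp)).hasDerivAt).sub (hasDerivAt_id s)
  change ‖w t - 1‖ ≤ ε ∧ ‖deriv w t‖ ≤ ε
  rw [hts, hwp.int_mul n s, hwd.int_mul n s, hweq, (hasDerivAt_circ hd).deriv]
  have h3 : ∀ r : ℝ, |r| ≤ ε / (2 * Real.pi) → 2 * Real.pi * |r| ≤ ε := by
    intro r hr
    have := mul_le_mul_of_nonneg_left hr Real.two_pi_pos.le
    rwa [mul_div_cancel₀ _ Real.two_pi_pos.ne'] at this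
  refine ⟨(norm_circ_sub_one_le _).trans (h3 _ h1), ?_⟩
  rw [norm_mul, norm_circ, one_mul, norm_mul, Complex.norm_I, one_mul, Complex.norm_real,
    Real.norm_eq_abs, abs_mul, abs_of_pos Real.two_pi_pos]
  exact h3 _ h2

theorem exists_bound_deriv_of_periodic {f : ℝ → ℝ} (hf : ContDiff ℝ 1 f)
    (hp : Function.Periodic f 1) : ∃ C, ∀ t, |deriv f t| ≤ C := by
  have hd : Function.Periodic (deriv f) 1 := fun s => by
    rw [← deriv_comp_add_const]
    simp_rw [hp _]
  obtain ⟨C, hC⟩ := isCompact_Icc.exists_bound_of_continuousOn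
    (hf.continuous_deriv (by simp)).continuousOn (s := Icc (0 : ℝ) 1)
  refine ⟨C, fun t => ?_⟩
  obtain ⟨s, hs, hst⟩ := hd.exists_mem_Ico₀ one_pos t
  rw [hst]
  exact hC s (Ico_subset_Icc_self hs)

variable [SecondCountableTopology M]

/-- A smooth function which is close to `exp (2 π i t)` along an embedded loop. -/
theorem IsEmbeddedLoop.exists_angle {k : ℕ} {v : S1 → M} (hv : IsEmbeddedLoop (k + 2) v) :
    ∃ z : M → ℂ, ContMDiff (𝓡 2) 𝓘(ℝ, ℂ) ∞ z ∧ ∀ t : ℝ,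
        ‖z (v (t : S1)) * circ (-t) - 1‖ ≤ 1 / 2 ∧
        ‖deriv (fun s : ℝ => z (v (s : S1)) * circ (-s)) t‖ ≤ 1 := by
  have : LocallyCompactSpace M := ChartedSpace.locallyCompactSpace Plane M
  choose U hU hUt hUz using hv.exists_local_angle
  have hK : IsCompact (range v) := isCompact_range hv.1.1
  obtain ⟨S, hS⟩ := hK.elim_finite_subcover U hU (by
    rintro _ ⟨x, rfl⟩
    induction x using QuotientAddGroup.induction_on with
    | H t => exact mem_iUnion.2 ⟨t, hUt t⟩)
  obtain ⟨ρ, hρ⟩ := SmoothPartitionOfUnity.exists_isSubordinate (𝓡 2) hK.isClosed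
    (fun i : S => U i) (fun i => hU i) (by rwa [iUnion_subtype])
  set r : S → ℝ → ℝ := fun i t => ρ i (v (t : S1)) with hr
  have hrc : ∀ i, ContDiff ℝ 1 (r i) := fun i => contDiff_iff_contDiffAt.2 fun t =>
    (hv.1.hAt_comp ((ρ i).contMDiff.contMDiffAt)).contDiffAt.of_le (by
      exact_mod_cast Nat.le_add_left 1 k)
  have hrp : ∀ i, Function.Periodic (r i) 1 := fun i t => by
    simp only [hr, AddCircle.coe_add_period]
  choose C hC using fun i => exists_bound_deriv_of_periodic (hrc i) (hrp i)
  have hC0 : ∀ i, 0 ≤ C i := fun i => (abs_nonneg _).trans (hC i 0)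
  set B := ∑ i, (C i + 1) with hB
  have hB0 : 0 ≤ B := Finset.sum_nonneg fun i _ => by linarith [hC0 i]
  -- The derivative of ∑ rᵢ (wᵢ - 1) is at most ∑ (Cᵢ + 1) ε, since |rᵢ'| ≤ Cᵢ and rᵢ ≤ 1. This ε
  -- brings it below 1, and also satisfies ε ≤ 1/2.
  set ε := 1 / (2 * (B + 1)) with hε
  have hεpos : 0 < ε := by positivity
  have hεB : B * ε ≤ 1 := by
    rw [hε, mul_one_div, div_le_one (by positivity)]
    linarith
  have hε2 : ε ≤ 1 / 2 := by
    rw [hε]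
    exact one_div_le_one_div_of_le (by norm_num) (by linarith)
  choose z hz hzw using fun i : S => hUz i ε hεpos
  have hsum : ∀ t : ℝ, ∑ i, r i t = 1 := fun t => by
    have h1 := ρ.sum_eq_one (x := v (t : S1)) ⟨_, rfl⟩
    rwa [finsum_eq_sum_of_fintype] at h1
  have hr0 : ∀ i t, 0 ≤ r i t := fun i t => ρ.nonneg i _
  have hr1 : ∀ i t, r i t ≤ 1 := fun i t => by
    rw [← hsum t]
    exact Finset.single_le_sum (fun j _ => hr0 j t) (Finset.mem_univ i)
  have hzero : ∀ (i : S) (t : ℝ), v (t : S1) ∉ U i → ∀ᶠ s in 𝓝 t, r i s = 0 := by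
    intro i t ht
    have h1 : v (t : S1) ∉ tsupport (ρ i) := fun h => ht (hρ i h)
    filter_upwards [hv.continuous_lift.continuousAt.eventually
      ((isClosed_tsupport (ρ i)).isOpen_compl.mem_nhds h1)] with s hs
    exact image_eq_zero_of_notMem_tsupport (f := ρ i) hs
  set w : S → ℝ → ℂ := fun i t => z i (v (t : S1)) * circ (-t) with hw
  refine ⟨fun x => ∑ᶠ i, ρ i x • z i x, hρ.contMDiff_finsum_smul (fun i => hU i) hz, fun t => ?_⟩
  have hform : ∀ s : ℝ, (∑ᶠ i, ρ i (v (s : S1)) • z i (v (s : S1))) * circ (-s) =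
      1 + ∑ i, r i s • (w i s - 1) := by
    intro s
    rw [finsum_eq_sum_of_fintype, Finset.sum_mul]
    have h1 := hsum s
    simp only [hr] at h1
    simp only [smul_sub, Finset.sum_sub_distrib, ← Finset.sum_smul, hw, hr, smul_mul_assoc, h1,
      one_smul, add_sub_cancel]
  have hterm : ∀ i : S, ∃ d : ℂ, HasDerivAt (fun s => r i s • (w i s - 1)) d t ∧
      ‖d‖ ≤ (C i + 1) * ε := by
    intro i
    by_cases ht : v (t : S1) ∈ U i
    · have h1 : DifferentiableAt ℝ (w i) t := by
        have h2 : MDifferentiableAt 𝓘(ℝ, ℝ) 𝓘(ℝ, ℂ) (fun s : ℝ => z i (v (s : S1))) t :=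
          (((hz i).contMDiffAt ((hU i).mem_nhds ht)).mdifferentiableAt (by simp)).comp t
            (hv.mdifferentiableAt t)
        exact h2.differentiableAt.mul
          (((contDiff_circ.differentiable (by simp)).comp differentiable_neg) t)
      refine ⟨_, ((hrc i).differentiable (by simp) t).hasDerivAt.smul
        (h1.hasDerivAt.sub_const 1), ?_⟩
      obtain ⟨h3, h4⟩ := hzw i t ht
      refine (norm_add_le _ _).trans ?_
      rw [norm_smul, norm_smul, add_mul, add_comm]
      refine add_le_add (mul_le_mul (hC i t) h3 (norm_nonneg _) (hC0 i)) ?_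
      refine mul_le_mul ?_ h4 (norm_nonneg _) zero_le_one
      rw [Real.norm_eq_abs, abs_of_nonneg (hr0 i t)]
      exact hr1 i t
    · refine ⟨0, (hasDerivAt_const t (0 : ℂ)).congr_of_eventuallyEq ?_, ?_⟩
      · filter_upwards [hzero i t ht] with s hs
        rw [hs, zero_smul]
      · rw [norm_zero]
        have := hC0 i
        positivity
  constructor
  · rw [hform, add_sub_cancel_left]
    refine (norm_sum_le _ _).trans (le_trans ?_ hε2)
    have h1 : ∀ i ∈ Finset.univ, ‖r i t • (w i t - 1)‖ ≤ r i t * ε := by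
      intro i _
      rw [norm_smul, Real.norm_eq_abs, abs_of_nonneg (hr0 i t)]
      by_cases ht : v (t : S1) ∈ U i
      · exact mul_le_mul_of_nonneg_left (hzw i t ht).1 (hr0 i t)
      · rw [(hzero i t ht).self_of_nhds]
        simp
    refine (Finset.sum_le_sum h1).trans ?_
    rw [← Finset.sum_mul, hsum, one_mul]
  · choose d hd hdn using hterm
    simp_rw [hform]
    rw [((HasDerivAt.fun_sum fun i (_ : i ∈ Finset.univ) => hd i).const_add 1).deriv]
    refine (norm_sum_le _ _).trans ((Finset.sum_le_sum fun i _ => hdn i).trans ?_)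
    rw [← Finset.sum_mul]
    exact hεB

end Approximation

end LengthFunctional
end

noncomputable section
namespace LengthFunctional

open Filter Topology

set_option linter.unusedSectionVars false
set_option maxSynthPendingDepth 3

/-! ### Area forms -/

/-- The standard area form of the plane. -/
def area (a : Plane) : Plane →L[ℝ] ℝ :=
  a 0 • EuclideanSpace.proj (𝕜 := ℝ) 1 - a 1 • EuclideanSpace.proj (𝕜 := ℝ) 0

theorem area_apply (a b : Plane) : area a b = a 0 * b 1 - a 1 * b 0 := rfl

theorem plane_eq (a : Plane) : a = a 0 • EuclideanSpace.single (0 : Fin 2) (1 : ℝ) +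
    a 1 • EuclideanSpace.single (1 : Fin 2) (1 : ℝ) := by
  ext i
  fin_cases i <;> simp

theorem area_map (T : Plane →L[ℝ] Plane) (a b : Plane) : area (T a) (T b) = T.det * area a b := by
  have hdet : T.det = T (EuclideanSpace.single 0 1) 0 * T (EuclideanSpace.single 1 1) 1 -
      T (EuclideanSpace.single 1 1) 0 * T (EuclideanSpace.single 0 1) 1 := by
    rw [ContinuousLinearMap.det,
      ← LinearMap.det_toMatrix (EuclideanSpace.basisFun (Fin 2) ℝ).toBasis, Matrix.det_fin_two]
    simp [LinearMap.toMatrix_apply]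
  rw [hdet, plane_eq a, plane_eq b]
  simp only [map_add, map_smul, area_apply, PiLp.add_apply, PiLp.smul_apply, smul_eq_mul]
  simp
  ring

/-- Vectors on which a linear form is positive lie on the same side of its kernel. -/
theorem sum_area_ne_zero {ι : Type*} {S : Finset ι} {ℓ : Plane →L[ℝ] ℝ} {w : Plane}
    (hw : w ≠ 0) (hℓ : ℓ w = 0) {b : ι → ℝ} {p : ι → Plane} (hb : ∀ i ∈ S, 0 ≤ b i)
    (hp : ∀ i ∈ S, b i ≠ 0 → 0 < ℓ (p i)) (h : ∃ i ∈ S, 0 < b i) :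
    ∑ i ∈ S, b i * area (p i) w ≠ 0 := by
  set ℓ₀ := ℓ (EuclideanSpace.single 0 1) with hℓ₀
  set ℓ₁ := ℓ (EuclideanSpace.single 1 1) with hℓ₁
  have hform : ∀ q : Plane, ℓ q = q 0 * ℓ₀ + q 1 * ℓ₁ := by
    intro q
    conv_lhs => rw [plane_eq q]
    rw [map_add, map_smul, map_smul]
    rfl
  rw [hform] at hℓ
  have key : ∀ q : Plane, (ℓ₀ * w 1 - ℓ₁ * w 0) * area q w = (w 0 ^ 2 + w 1 ^ 2) * ℓ q := by
    intro q
    rw [hform, area_apply]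
    linear_combination (-q 1 * w 1 - q 0 * w 0) * hℓ
  -- By `key`, the forms `area · w` and ℓ are proportional, as both vanish on w. A vanishing sum of
  -- areas would thus force a vanishing sum of nonnegative terms, one of which is positive.
  have hpos : 0 < w 0 ^ 2 + w 1 ^ 2 := by
    by_contra hn
    apply hw
    have h0 : w 0 = 0 := by nlinarith [sq_nonneg (w 0), sq_nonneg (w 1)]
    have h1 : w 1 = 0 := by nlinarith [sq_nonneg (w 0), sq_nonneg (w 1)]
    ext i
    fin_cases i
    · exact h0
    · exact h1
  intro hsum
  have h1 : ∑ i ∈ S, b i * ((w 0 ^ 2 + w 1 ^ 2) * ℓ (p i)) = 0 := by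
    have h2 := congrArg (fun r => (ℓ₀ * w 1 - ℓ₁ * w 0) * r) hsum
    simp only [mul_zero, Finset.mul_sum] at h2
    rw [← h2]
    refine Finset.sum_congr rfl fun i _ => ?_
    rw [← key]
    ring
  have hnn : ∀ i ∈ S, 0 ≤ b i * ((w 0 ^ 2 + w 1 ^ 2) * ℓ (p i)) := by
    intro i hi
    by_cases h0 : b i = 0
    · rw [h0, zero_mul]
    · exact mul_nonneg (hb i hi) (mul_nonneg hpos.le (hp i hi h0).le)
  obtain ⟨i, hi, hbi⟩ := h
  have h3 := (Finset.sum_eq_zero_iff_of_nonneg hnn).1 h1 i hi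
  exact (mul_pos hbi (mul_pos hpos (hp i hi hbi.ne'))).ne' h3

/-! ### The angle along an embedded loop -/

variable {M : Type*} [TopologicalSpace M] [ChartedSpace Plane M] [IsManifold (𝓡 2) ∞ M]

/-- A smooth map `Z` from a neighbourhood of the loop `v` to the unit circle, with
`Z (v t) = exp (2 π i Ψ(t))` for a lift `Ψ` of a diffeomorphism of the circle. -/
structure AngleMap (k : ℕ) (v : S1 → M) where
  O : Set M
  Z : M → ℂ
  Ψ : ℝ → ℝ
  isOpen : IsOpen O
  mem : ∀ x, v x ∈ O
  smooth : ContMDiffOn (𝓡 2) 𝓘(ℝ, ℂ) ∞ Z O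
  norm_eq : ∀ x ∈ O, ‖Z x‖ = 1
  hAt : ∀ t, HAt k Ψ t
  deriv_pos : ∀ t, 0 < deriv Ψ t
  add_one : ∀ t, Ψ (t + 1) = Ψ t + 1
  map_eq : ∀ t : ℝ, Z (v (t : S1)) = circ (Ψ t)

/-- The quotient w of z(v(t)) and exp(2πit) is within 1/2 of 1, so its argument is a smooth function
of w without jumps, and Ψ = t + arg(w)/2π. Moreover |w'/w| ≤ 2 < 2π keeps Ψ' positive, and
periodicity of w gives degree one. The map Z itself is z/|z|. -/
theorem IsEmbeddedLoop.nonempty_angleMap [T2Space M] [SecondCountableTopology M] {k : ℕ}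
    {v : S1 → M} (hv : IsEmbeddedLoop (k + 2) v) : Nonempty (AngleMap (k + 1) v) := by
  obtain ⟨z, hz, hw⟩ := hv.exists_angle
  set w : ℝ → ℂ := fun t => z (v (t : S1)) * circ (-t) with hwdef
  have hwz : ∀ t : ℝ, z (v (t : S1)) = w t * circ t := by
    intro t
    rw [hwdef]
    simp only
    rw [mul_assoc, ← circ_add, neg_add_cancel, circ_zero, mul_one]
  have hre : ∀ t, 1 / 2 ≤ (w t).re := by
    intro t
    have h1 := (Complex.abs_re_le_norm (w t - 1)).trans (hw t).1
    rw [abs_le] at h1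
    have h2 := h1.1
    simp only [Complex.sub_re, Complex.one_re] at h2
    linarith
  have hslit : ∀ t, w t ∈ Complex.slitPlane := fun t => Or.inl (by linarith [hre t])
  have hnorm : ∀ t, 1 / 2 ≤ ‖w t‖ := fun t =>
    (hre t).trans ((le_abs_self _).trans (Complex.abs_re_le_norm _))
  have hw0 : ∀ t, w t ≠ 0 := fun t h => by
    have := hnorm t
    rw [h, norm_zero] at this
    linarith
  have hwd : ∀ t, HasDerivAt w (deriv w t) t := fun t => by
    have h2 : MDifferentiableAt 𝓘(ℝ, ℝ) 𝓘(ℝ, ℂ) (fun s : ℝ => z (v (s : S1))) t :=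
      (hz.contMDiffAt.mdifferentiableAt (by simp)).comp t (hv.mdifferentiableAt t)
    exact (h2.differentiableAt.mul
      (((contDiff_circ.differentiable (by simp)).comp differentiable_neg) t)).hasDerivAt
  have hwp : ∀ t, w (t + 1) = w t := by
    intro t
    have h1 : circ (-(t + 1)) = circ (-t) := by
      rw [← circ_add_one (-(t + 1))]
      congr 1
      ring
    simp only [hwdef, AddCircle.coe_add_period, h1]
  have hlog : ∀ t, HasDerivAt (fun s => Complex.arg (w s)) (deriv w t / w t).im t := fun t =>
    (Complex.imCLM.hasFDerivAt.comp_hasDerivAt t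
      ((hwd t).clog_real (hslit t))).congr_of_eventuallyEq
        (Eventually.of_forall fun s => (Complex.log_im (w s)).symm)
  have hΨd : ∀ t, HasDerivAt (fun s => s + Complex.arg (w s) / (2 * Real.pi))
      (1 + (deriv w t / w t).im / (2 * Real.pi)) t := fun t =>
    (hasDerivAt_id t).add ((hlog t).div_const _)
  have hsmooth : ∀ {f : ℂ →L[ℝ] ℝ} (t : ℝ), HAt (k + 1) (fun s : ℝ => f (z (v (s : S1)))) t ∧
      HAt (k + 1) (fun s => f (circ (-s))) t := fun {f} t =>
    ⟨hv.1.hAt_comp (f := fun x => f (z x)) ((f.contDiff.contMDiff.comp hz).contMDiffAt),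
      HAt.of_contDiffAt (contDiffAt_infty.1
        (f.contDiff.comp (contDiff_circ.comp contDiff_neg)).contDiffAt _)⟩
  have hφ : ∀ t, ContDiffAt ℝ ∞ (fun q : ℝ × ℝ => Complex.arg (q.1 + q.2 * Complex.I))
      ((w t).re, (w t).im) := by
    intro t
    have h1 : ContDiff ℝ ∞ fun q : ℝ × ℝ => (q.1 + q.2 * Complex.I : ℂ) :=
      (Complex.ofRealCLM.contDiff.comp contDiff_fst).add
        ((Complex.ofRealCLM.contDiff.comp contDiff_snd).mul contDiff_const)
    have h2 : ContDiffAt ℝ ∞ Complex.log (((w t).re : ℂ) + (w t).im * Complex.I) := by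
      rw [Complex.re_add_im]
      exact (Complex.contDiffAt_log (hslit t)).restrict_scalars ℝ
    exact (Complex.imCLM.contDiff.contDiffAt.comp _
      (ContDiffAt.comp (g := Complex.log) ((w t).re, (w t).im) h2
        h1.contDiffAt)).congr_of_eventuallyEq
          (Eventually.of_forall fun q => (Complex.log_im _).symm)
  refine ⟨{ O := {x | z x ≠ 0}
            Z := fun x => z x / (‖z x‖ : ℂ)
            Ψ := fun t => t + Complex.arg (w t) / (2 * Real.pi)
            isOpen := isOpen_ne_fun hz.continuous continuous_const
            mem := fun x => ?_
            smooth := ?_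
            norm_eq := fun x hx => ?_
            hAt := fun t => ?_
            deriv_pos := fun t => ?_
            add_one := fun t => ?_
            map_eq := fun t => ?_ }⟩
  · induction x using QuotientAddGroup.induction_on with
    | H t =>
      change z (v (t : S1)) ≠ 0
      rw [hwz]
      exact mul_ne_zero (hw0 t) (circ_ne_zero t)
  · intro x hx
    have h1 : ContDiffAt ℝ ∞ (fun u : ℂ => u / (‖u‖ : ℂ)) (z x) := by
      refine (((contDiffAt_norm ℝ hx).inv (norm_ne_zero_iff.2 hx)).smul
        contDiffAt_id).congr_of_eventuallyEq (Eventually.of_forall fun u => ?_)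
      simp [div_eq_inv_mul]
    exact (h1.contMDiffAt.comp x hz.contMDiffAt).contMDiffWithinAt
  · rw [norm_div, Complex.norm_real, norm_norm, div_self (norm_ne_zero_iff.2 hx)]
  · have h1 : HAt (k + 1) (fun s => (w s).re) t :=
      ((hsmooth (f := Complex.reCLM) t).1.mul (hsmooth (f := Complex.reCLM) t).2).sub
        ((hsmooth (f := Complex.imCLM) t).1.mul (hsmooth (f := Complex.imCLM) t).2)
    have h2 : HAt (k + 1) (fun s => (w s).im) t :=
      ((hsmooth (f := Complex.reCLM) t).1.mul (hsmooth (f := Complex.imCLM) t).2).add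
        ((hsmooth (f := Complex.imCLM) t).1.mul (hsmooth (f := Complex.reCLM) t).2)
    have h3 := HAt.comp₂ (hφ t) h1 h2
    simp only [Complex.re_add_im] at h3
    exact (HAt.of_contDiffAt contDiff_id.contDiffAt).add
      (HAt.comp (φ := fun r => r / (2 * Real.pi)) (by fun_prop) h3)
  · rw [(hΨd t).deriv]
    have h1 : |(deriv w t / w t).im| ≤ 2 := by
      refine (Complex.abs_im_le_norm _).trans ?_
      rw [norm_div, div_le_iff₀ (by linarith [hnorm t])]
      linarith [hnorm t, (hw t).2]
    have h2 : -2 ≤ (deriv w t / w t).im := (abs_le.1 h1).1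
    have h3 : -1 < (deriv w t / w t).im / (2 * Real.pi) := by
      rw [lt_div_iff₀ Real.two_pi_pos]
      linarith [Real.pi_gt_three]
    linarith
  · simp only [hwp]
    ring
  · have h1 : circ (t + Complex.arg (w t) / (2 * Real.pi)) =
        circ t * Complex.exp (Complex.arg (w t) * Complex.I) := by
      rw [circ_add]
      congr 1
      unfold circ
      congr 1
      have h2 : 2 * Real.pi * (Complex.arg (w t) / (2 * Real.pi)) = Complex.arg (w t) :=
        mul_div_cancel₀ _ Real.two_pi_pos.ne'
      rw [h2, mul_comm]
    have h3 : (‖w t‖ : ℂ) ≠ 0 := by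
      exact_mod_cast norm_ne_zero_iff.2 (hw0 t)
    have h4 : w t = ‖w t‖ * Complex.exp (Complex.arg (w t) * Complex.I) :=
      (Complex.norm_mul_exp_arg_mul_I (w t)).symm
    rw [h1, hwz, norm_mul, norm_circ, mul_one, div_eq_iff h3]
    linear_combination (circ t) * h4

namespace AngleMap

variable {k : ℕ} {v : S1 → M} (Z : AngleMap (k + 1) v)

theorem hasDerivAt (t : ℝ) : HasDerivAt Z.Ψ (deriv Z.Ψ t) t :=
  (Z.hAt t).differentiableAt.hasDerivAt

theorem continuous_deriv : Continuous (deriv Z.Ψ) :=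
  continuous_iff_continuousAt.2 fun t => (Z.hAt t).2.continuousAt

theorem continuous : Continuous Z.Ψ := continuous_iff_continuousAt.2 fun t => (Z.hAt t).continuousAt

theorem strictMono : StrictMono Z.Ψ := strictMono_of_deriv_pos Z.deriv_pos

theorem exists_homeomorph : ∃ (ψ : S1 ≃ₜ S1) (ξ : ℝ → ℝ), Continuous ξ ∧ (∀ x, Z.Ψ (ξ x) = x) ∧
    (∀ x, ξ (Z.Ψ x) = x) ∧ (∀ t : ℝ, ψ (t : S1) = (Z.Ψ t : S1)) ∧
    ∀ x : ℝ, ψ.symm (x : S1) = (ξ x : S1) :=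
  exists_homeomorph_of_lift Z.strictMono Z.continuous Z.add_one

theorem injective_comp : Function.Injective fun x => Z.Z (v x) := by
  obtain ⟨ψ, -, -, -, -, hψ, -⟩ := Z.exists_homeomorph
  intro x y hxy
  induction x using QuotientAddGroup.induction_on with
  | H s =>
    induction y using QuotientAddGroup.induction_on with
    | H t =>
      have h1 : circ (Z.Ψ s) = circ (Z.Ψ t) := by
        rw [← Z.map_eq, ← Z.map_eq]
        exact hxy
      rw [circ_eq_circ_iff, ← hψ, ← hψ] at h1
      exact ψ.injective h1

end AngleMap

end LengthFunctional
end

noncomputable section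
namespace LengthFunctional

open Filter Topology

set_option linter.unusedSectionVars false
set_option maxSynthPendingDepth 3

variable {M : Type*} [TopologicalSpace M] [ChartedSpace Plane M] [IsManifold (𝓡 2) ∞ M]

theorem contDiffOn_comp_symm {F : Type*} [NormedAddCommGroup F] [NormedSpace ℝ F] {f : M → F}
    {O : Set M} (hf : ContMDiffOn (𝓡 2) 𝓘(ℝ, F) ∞ f O) {e : OpenPartialHomeomorph M Plane}
    (he : e ∈ IsManifold.maximalAtlas (𝓡 2) ∞ M) :
    ContDiffOn ℝ ∞ (fun y => f (e.symm y)) (e.target ∩ e.symm ⁻¹' O) := by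
  rw [← contMDiffOn_iff_contDiffOn]
  exact hf.comp ((contMDiffOn_symm_of_mem_maximalAtlas he).mono inter_subset_left)
    inter_subset_right

theorem mem_target_inter {O : Set M} {e : OpenPartialHomeomorph M Plane} {x : M}
    (hx : x ∈ e.source) (hxO : x ∈ O) : e x ∈ e.target ∩ e.symm ⁻¹' O :=
  ⟨e.map_source hx, by rwa [mem_preimage, e.left_inv hx]⟩

theorem contDiffAt_comp_symm {F : Type*} [NormedAddCommGroup F] [NormedSpace ℝ F] {f : M → F}
    {O : Set M} (hO : IsOpen O) (hf : ContMDiffOn (𝓡 2) 𝓘(ℝ, F) ∞ f O)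
    {e : OpenPartialHomeomorph M Plane} (he : e ∈ IsManifold.maximalAtlas (𝓡 2) ∞ M) {x : M}
    (hx : x ∈ e.source) (hxO : x ∈ O) : ContDiffAt ℝ ∞ (fun y => f (e.symm y)) (e x) :=
  (contDiffOn_comp_symm hf he).contDiffAt
    ((e.isOpen_inter_preimage_symm hO).mem_nhds (mem_target_inter hx hxO))

/-! ### A function transverse to the angle -/

namespace AngleMap

variable {k : ℕ} {v : S1 → M} (Z : AngleMap (k + 1) v)

theorem continuous_comp (hv : Continuous v) : Continuous fun x => Z.Z (v x) :=
  Z.smooth.continuousOn.comp_continuous hv Z.mem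

/-- The vector `p` is the velocity of the loop in the chart at time `t`, along which the angle
increases; this persists for nearby points with `p` fixed. Since Z is injective along the loop, a
cutoff in the value of Z localizes near this point of the loop. -/
theorem exists_local_transverse (hv : IsEmbeddedLoop (k + 2) v)
    {e : OpenPartialHomeomorph M Plane} (he : e ∈ IsManifold.maximalAtlas (𝓡 2) ∞ M) {t : ℝ}
    (ht : v (t : S1) ∈ e.source) :
    ∃ (p : Plane) (b : ℂ → ℝ) (B : Set ℂ), ContDiff ℝ ∞ b ∧ (∀ z, 0 ≤ b z) ∧ IsClosed B ∧
      (∀ z ∉ B, b z = 0) ∧ 0 < b (Z.Z (v (t : S1))) ∧ ∀ x : S1, Z.Z (v x) ∈ B → v x ∈ e.source ∧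
        0 < (starRingEnd ℂ (Z.Z (v x)) *
          fderiv ℝ (fun y => Z.Z (e.symm y)) (e (v x)) p).im := by
  set p : Plane := deriv (fun s : ℝ => e (v (s : S1))) t with hp
  have hZt : ContDiffAt ℝ ∞ (fun y => Z.Z (e.symm y)) (e (v (t : S1))) :=
    contDiffAt_comp_symm Z.isOpen Z.smooth he ht (Z.mem _)
  have hpos : 0 < (starRingEnd ℂ (Z.Z (v (t : S1))) *
      fderiv ℝ (fun y => Z.Z (e.symm y)) (e (v (t : S1))) p).im := by
    have h1 : MDifferentiableAt 𝓘(ℝ, ℝ) 𝓘(ℝ, Plane) (fun s : ℝ => e (v (s : S1))) t :=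
      (((contMDiffOn_of_mem_maximalAtlas he).contMDiffAt
        (e.open_source.mem_nhds ht)).mdifferentiableAt (by simp)).comp t (hv.mdifferentiableAt t)
    have h2 : HasFDerivAt (fun y => Z.Z (e.symm y)) (fderiv ℝ (fun y => Z.Z (e.symm y))
      (e (v (t : S1)))) (e (v (t : S1))) := (hZt.differentiableAt (by simp)).hasFDerivAt
    have h3 := h2.comp_hasDerivAt t h1.differentiableAt.hasDerivAt
    have h4 : (fun y => Z.Z (e.symm y)) ∘ (fun s : ℝ => e (v (s : S1))) =ᶠ[𝓝 t]
        fun s => circ (Z.Ψ s) := by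
      filter_upwards [hv.continuous_lift.continuousAt.eventually
        (e.open_source.mem_nhds ht)] with s hs
      rw [Function.comp_apply, e.left_inv hs, Z.map_eq]
    have h5 := h3.unique ((hasDerivAt_circ (Z.hasDerivAt t)).congr_of_eventuallyEq h4)
    have h6 : starRingEnd ℂ (circ (Z.Ψ t)) * circ (Z.Ψ t) = 1 := by
      rw [mul_comm, Complex.mul_conj, Complex.normSq_eq_norm_sq, norm_circ]
      simp
    rw [hp, h5, Z.map_eq, ← mul_assoc, h6, one_mul, Complex.I_mul_im, Complex.ofReal_re]
    exact mul_pos Real.two_pi_pos (Z.deriv_pos t)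
  have hev : ∀ᶠ x in 𝓝 (t : S1), v x ∈ e.source ∧ 0 < (starRingEnd ℂ (Z.Z (v x)) *
      fderiv ℝ (fun y => Z.Z (e.symm y)) (e (v x)) p).im := by
    refine (hv.1.1.continuousAt.eventually (e.open_source.mem_nhds ht)).and ?_
    have h1 : ContinuousAt (fun x => e (v x)) (t : S1) :=
      ContinuousAt.comp (e.continuousAt ht) hv.1.1.continuousAt
    have h2 : ContinuousAt (fun x => fderiv ℝ (fun y => Z.Z (e.symm y)) (e (v x))) (t : S1) :=
      ContinuousAt.comp (f := fun x => e (v x)) ((hZt.fderiv_right (m := 0)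
        (by norm_cast)).continuousAt) h1
    have h3 : ContinuousAt (fun x => (starRingEnd ℂ (Z.Z (v x)) *
        fderiv ℝ (fun y => Z.Z (e.symm y)) (e (v x)) p).im) (t : S1) :=
      Complex.continuous_im.continuousAt.comp
        (((Complex.continuous_conj.comp (Z.continuous_comp hv.1.1)).continuousAt).mul
          (h2.clm_apply continuousAt_const))
    exact h3.eventually (lt_mem_nhds hpos)
  obtain ⟨N, hN, hNo, htN⟩ := _root_.eventually_nhds_iff.1 hev
  have hC : IsCompact ((fun x => Z.Z (v x)) '' Nᶜ) :=
    hNo.isClosed_compl.isCompact.image (Z.continuous_comp hv.1.1)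
  have htC : Z.Z (v (t : S1)) ∉ (fun x => Z.Z (v x)) '' Nᶜ := by
    rintro ⟨x, hx, hxt⟩
    exact hx (Z.injective_comp hxt ▸ htN)
  obtain ⟨δ, hδ, hball⟩ := Metric.isOpen_iff.1 hC.isClosed.isOpen_compl _ htC
  let f : ContDiffBump (Z.Z (v (t : S1))) := ⟨δ / 4, δ / 2, by positivity, by linarith⟩
  refine ⟨p, f, Metric.closedBall (Z.Z (v (t : S1))) (δ / 2), f.contDiff, fun z => f.nonneg,
    Metric.isClosed_closedBall, fun z hz => f.zero_of_le_dist ?_, ?_, fun x hx => ?_⟩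
  · rw [Metric.mem_closedBall, not_le] at hz
    exact hz.le
  · exact f.pos_of_mem_ball (Metric.mem_ball_self (by positivity))
  · have h1 : Z.Z (v x) ∉ (fun x => Z.Z (v x)) '' Nᶜ :=
      hball (Metric.closedBall_subset_ball (by linarith) hx)
    refine hN x ?_
    by_contra hxN
    exact h1 ⟨x, hxN, rfl⟩

/-- On an oriented surface there is a function `ρ` near the loop `v` such that the differentials
of the angle and of `ρ` are linearly independent along `v`. -/
theorem exists_transverse (hM : IsOrientableSurface M) (hv : IsEmbeddedLoop (k + 2) v) :
    ∃ (W : Set M) (ρ : M → ℝ), IsOpen W ∧ W ⊆ Z.O ∧ (∀ x, v x ∈ W) ∧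
      ContMDiffOn (𝓡 2) 𝓘(ℝ, ℝ) ∞ ρ W ∧ ∀ x : S1, ∃ e ∈ IsManifold.maximalAtlas (𝓡 2) ∞ M,
        v x ∈ e.source ∧ ∀ w : Plane, fderiv ℝ (fun y => Z.Z (e.symm y)) (e (v x)) w = 0 →
          fderiv ℝ (fun y => ρ (e.symm y)) (e (v x)) w = 0 → w = 0 := by
  obtain ⟨A, hA, hAc, hAdet⟩ := hM
  choose e heA het using fun t : ℝ => hAc (v (t : S1))
  choose p b B hb hb0 hB hbB hbt hgood using fun t : ℝ =>
    Z.exists_local_transverse hv (hA (heA t)) (het t)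
  obtain ⟨S, hS⟩ := isCompact_univ.elim_finite_subcover
    (fun t : ℝ => {x : S1 | 0 < b t (Z.Z (v x))})
    (fun t => isOpen_lt continuous_const ((hb t).continuous.comp (Z.continuous_comp hv.1.1)))
    (fun x _ => by
      induction x using QuotientAddGroup.induction_on with
      | H t => exact mem_iUnion.2 ⟨t, hbt t⟩)
  -- At each point of W every summand of ρ either lies in its chart domain or vanishes nearby, so
  -- that the sum is smooth.
  set W : Set M := Z.O ∩ ⋂ t ∈ S, ((e t).source ∪ (Z.O ∩ Z.Z ⁻¹' (B t)ᶜ)) with hW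
  have hBo : ∀ t, IsOpen (Z.O ∩ Z.Z ⁻¹' (B t)ᶜ) := fun t =>
    Z.smooth.continuousOn.isOpen_inter_preimage Z.isOpen (hB t).isOpen_compl
  have hWo : IsOpen W := Z.isOpen.inter (isOpen_biInter_finset fun t _ =>
    (e t).open_source.union (hBo t))
  have hvW : ∀ x, v x ∈ W := by
    intro x
    refine ⟨Z.mem x, mem_iInter₂.2 fun t _ => ?_⟩
    by_cases hx : Z.Z (v x) ∈ B t
    · exact Or.inl (hgood t x hx).1
    · exact Or.inr ⟨Z.mem x, hx⟩
  have hzero : ∀ t, ∀ x ∈ Z.O ∩ Z.Z ⁻¹' (B t)ᶜ,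
      ∀ᶠ y in 𝓝 x, b t (Z.Z y) * area (p t) (e t y) = 0 := fun t x hx => by
    filter_upwards [(hBo t).mem_nhds hx] with y hy
    rw [hbB t _ hy.2, zero_mul]
  have hsm : ∀ t, ContMDiffOn (𝓡 2) 𝓘(ℝ, ℝ) ∞ (fun y => area (p t) (e t y)) (e t).source :=
    fun t => (area (p t)).contDiff.contMDiff.comp_contMDiffOn
      (contMDiffOn_of_mem_maximalAtlas (hA (heA t)))
  have hbZ : ∀ t, ContMDiffOn (𝓡 2) 𝓘(ℝ, ℝ) ∞ (fun y => b t (Z.Z y)) Z.O := fun t =>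
    (hb t).contMDiff.comp_contMDiffOn Z.smooth
  have hterm : ∀ t ∈ S, ContMDiffOn (𝓡 2) 𝓘(ℝ, ℝ) ∞
      (fun y => b t (Z.Z y) * area (p t) (e t y)) W := by
    intro t ht x hx
    rcases mem_iInter₂.1 hx.2 t ht with h | h
    · exact (((hbZ t).contMDiffAt (Z.isOpen.mem_nhds hx.1)).mul
        ((hsm t).contMDiffAt ((e t).open_source.mem_nhds h))).contMDiffWithinAt
    · exact (contMDiffAt_const.congr_of_eventuallyEq (hzero t x h)).contMDiffWithinAt
  refine ⟨W, fun y => ∑ t ∈ S, b t (Z.Z y) * area (p t) (e t y), hWo, inter_subset_left, hvW,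
    contMDiffOn_finsetSum hterm, fun x => ?_⟩
  obtain ⟨ε, hεA, hεx⟩ := hAc (v x)
  refine ⟨ε, hA hεA, hεx, fun w hw hρ => ?_⟩
  by_contra hw0
  set y := ε (v x) with hy
  have hyx : ε.symm y = v x := ε.left_inv hεx
  have hZ : HasFDerivAt (fun y => Z.Z (ε.symm y)) (fderiv ℝ (fun y => Z.Z (ε.symm y)) y) y :=
    ((contDiffAt_comp_symm Z.isOpen Z.smooth (hA hεA) hεx (Z.mem x)).differentiableAt
      (by simp)).hasFDerivAt
  have hT : ∀ t, v x ∈ (e t).source → HasFDerivAt (fun y => e t (ε.symm y))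
      (fderiv ℝ (fun y => e t (ε.symm y)) y) y := fun t ht =>
    ((contDiffAt_comp_symm (e t).open_source (contMDiffOn_of_mem_maximalAtlas (hA (heA t)))
      (hA hεA) hεx ht).differentiableAt (by simp)).hasFDerivAt
  set T : ℝ → Plane →L[ℝ] Plane := fun t => fderiv ℝ (fun y => e t (ε.symm y)) y with hTdef
  have hdet : ∀ t, v x ∈ (e t).source → 0 < (T t).det := fun t ht =>
    hAdet ε hεA (e t) (heA t) (v x) ⟨hεx, ht⟩
  -- On a vector w in the kernel of dZ the derivative of the cutoff drops out, and only the
  -- derivative of the area factor survives.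
  have hd : ∀ t ∈ S, ∃ D : Plane →L[ℝ] ℝ,
      HasFDerivAt (fun y => b t (Z.Z (ε.symm y)) * area (p t) (e t (ε.symm y))) D y ∧
        D w = b t (Z.Z (v x)) * area (p t) (T t w) := by
    intro t ht
    by_cases hxt : v x ∈ (e t).source
    · have h1 : HasFDerivAt (b t) (fderiv ℝ (b t) (Z.Z (ε.symm y))) (Z.Z (ε.symm y)) :=
        ((hb t).differentiable (by simp) _).hasFDerivAt
      have h2 := HasFDerivAt.comp (g := b t) y h1 hZ
      have h3 := (area (p t)).hasFDerivAt.comp y (hT t hxt)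
      refine ⟨_, h2.mul h3, ?_⟩
      simp only [add_apply, smul_apply, ContinuousLinearMap.comp_apply, hw, map_zero, smul_eq_mul,
        Function.comp_apply, hyx, mul_zero, add_zero, hTdef]
    · have hx' : v x ∈ Z.O ∩ Z.Z ⁻¹' (B t)ᶜ :=
        (mem_iInter₂.1 (hvW x).2 t ht).resolve_left hxt
      refine ⟨0, (hasFDerivAt_const (0 : ℝ) y).congr_of_eventuallyEq ?_, ?_⟩
      · have h1 : ContinuousAt ε.symm y := ε.symm.continuousAt (ε.map_source hεx)
        have h2 := hzero t _ hx'
        rw [← hyx] at h2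
        exact h1.eventually h2
      · rw [hbB t _ hx'.2, zero_mul]
        rfl
  have hsum : ∑ t ∈ S, b t (Z.Z (v x)) * area (p t) (T t w) = 0 := by
    choose! D hD hDw using hd
    have h1 := HasFDerivAt.fun_sum hD
    rw [h1.fderiv] at hρ
    rw [sum_apply] at hρ
    rw [← hρ]
    exact Finset.sum_congr rfl fun t ht => (hDw t ht).symm
  set ℓ : Plane →L[ℝ] ℝ := Complex.imCLM.comp
    ((ContinuousLinearMap.mul ℝ ℂ (starRingEnd ℂ (Z.Z (v x)))).comp
      (fderiv ℝ (fun y => Z.Z (ε.symm y)) y)) with hℓ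
  have hp : ∀ t, ∃ q : Plane, v x ∈ (e t).source → T t q = p t := by
    intro t
    by_cases hxt : v x ∈ (e t).source
    · have h1 : IsUnit (LinearMap.det (T t : Plane →ₗ[ℝ] Plane)) :=
        isUnit_iff_ne_zero.2 (hdet t hxt).ne'
      obtain ⟨q, hq⟩ := (LinearMap.equivOfIsUnitDet h1).surjective (p t)
      rw [LinearMap.equivOfIsUnitDet_apply] at hq
      exact ⟨q, fun _ => hq⟩
    · exact ⟨0, fun h => absurd h hxt⟩
  choose q hq using hp
  have hact : ∀ t, b t (Z.Z (v x)) ≠ 0 → v x ∈ (e t).source ∧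
      0 < (starRingEnd ℂ (Z.Z (v x)) *
          fderiv ℝ (fun y => Z.Z ((e t).symm y)) (e t (v x)) (p t)).im := fun t ht =>
    hgood t x (by
      by_contra h
      exact ht (hbB t _ h))
  -- Moving everything to the chart ε turns area(p_t, T_t w) into det T_t · area(q_t, w) with T_t
  -- q_t = p_t. Orientability makes the determinants positive, and ℓ, a positive multiple of the
  -- differential of the angle, is positive on each active q_t; hence the terms cannot cancel.
  have hne := sum_area_ne_zero (S := S) (ℓ := ℓ) hw0
    (b := fun t => b t (Z.Z (v x)) * (T t).det) (p := q) ?_ ?_ ?_ ?_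
  · apply hne
    rw [← hsum]
    refine Finset.sum_congr rfl fun t ht => ?_
    by_cases h0 : b t (Z.Z (v x)) = 0
    · rw [h0]
      ring
    · rw [← hq t (hact t h0).1, area_map]
      ring
  · change (starRingEnd ℂ (Z.Z (v x)) * fderiv ℝ (fun y => Z.Z (ε.symm y)) y w).im = 0
    rw [hw, mul_zero, Complex.zero_im]
  · intro t ht
    by_cases h0 : b t (Z.Z (v x)) = 0
    · rw [h0, zero_mul]
    · exact mul_nonneg (hb0 t _) (hdet t (hact t h0).1).le
  · intro t ht h0
    obtain ⟨hxt, hpos⟩ := hact t (left_ne_zero_of_mul h0)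
    have h1 : HasFDerivAt (fun y => Z.Z ((e t).symm y))
        (fderiv ℝ (fun y => Z.Z ((e t).symm y)) (e t (v x))) (e t (ε.symm y)) := by
      rw [hyx]
      exact ((contDiffAt_comp_symm Z.isOpen Z.smooth (hA (heA t)) hxt
        (Z.mem x)).differentiableAt (by simp)).hasFDerivAt
    have h2 := HasFDerivAt.comp (g := fun y => Z.Z ((e t).symm y)) y h1 (hT t hxt)
    have h3 : (fun y => Z.Z ((e t).symm y)) ∘ (fun y => e t (ε.symm y)) =ᶠ[𝓝 y]
        fun y => Z.Z (ε.symm y) := by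
      have h4 : ContinuousAt ε.symm y := ε.symm.continuousAt (ε.map_source hεx)
      filter_upwards [h4.eventually ((e t).open_source.mem_nhds (by rwa [hyx]))] with r hr
      rw [Function.comp_apply, (e t).left_inv hr]
    have h5 := (h2.congr_of_eventuallyEq h3.symm).unique hZ
    change 0 < (starRingEnd ℂ (Z.Z (v x)) * fderiv ℝ (fun y => Z.Z (ε.symm y)) y (q t)).im
    rw [← h5, ContinuousLinearMap.comp_apply]
    have h6 : fderiv ℝ (fun y => e t (ε.symm y)) y (q t) = p t := hq t hxt
    rwa [h6]
  · obtain ⟨t, ht, hxt⟩ := mem_iUnion₂.1 (hS (mem_univ x))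
    exact ⟨t, ht, mul_pos hxt (hdet t (hact t (ne_of_gt hxt)).1)⟩

end AngleMap

end LengthFunctional
end

noncomputable section
namespace LengthFunctional

open Filter Topology

set_option linter.unusedSectionVars false
set_option maxSynthPendingDepth 3

/-! ### Inverting a local diffeomorphism near a compact set -/

theorem exists_equiv_of_injective {T : Plane →L[ℝ] ℂ} (hT : ∀ w, T w = 0 → w = 0) :
    T ∈ range ((↑) : (Plane ≃L[ℝ] ℂ) → Plane →L[ℝ] ℂ) := by
  have h1 : Function.Injective (T : Plane →ₗ[ℝ] ℂ) :=
    (injective_iff_map_eq_zero (T : Plane →ₗ[ℝ] ℂ)).2 hT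
  refine ⟨(LinearEquiv.ofInjectiveOfFinrankEq (T : Plane →ₗ[ℝ] ℂ) h1
    (by simp [Complex.finrank_real_complex])).toContinuousLinearEquiv, ?_⟩
  ext w
  rfl

variable {M : Type*} [TopologicalSpace M] [ChartedSpace Plane M] [IsManifold (𝓡 2) ∞ M]

/-- The differential of `Q` is invertible at `x`. -/
def IsLocalDiffeoPoint (Q : M → ℂ) (x : M) : Prop :=
  ∃ e ∈ IsManifold.maximalAtlas (𝓡 2) ∞ M, x ∈ e.source ∧
    fderiv ℝ (fun y => Q (e.symm y)) (e x) ∈ range ((↑) : (Plane ≃L[ℝ] ℂ) → Plane →L[ℝ] ℂ)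

variable {Q : M → ℂ} {W : Set M}

theorem IsLocalDiffeoPoint.eventually (hW : IsOpen W) (hQ : ContMDiffOn (𝓡 2) 𝓘(ℝ, ℂ) ∞ Q W)
    {x : M} (hx : x ∈ W) (h : IsLocalDiffeoPoint Q x) : ∀ᶠ y in 𝓝 x, IsLocalDiffeoPoint Q y := by
  obtain ⟨e, he, hxe, h⟩ := h
  have h1 : ContinuousAt (fun y => fderiv ℝ (fun y => Q (e.symm y)) (e y)) x :=
    ContinuousAt.comp (f := e) (((contDiffAt_comp_symm hW hQ he hxe hx).fderiv_right (m := 0)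
      (by norm_cast)).continuousAt) (e.continuousAt hxe)
  filter_upwards [e.open_source.mem_nhds hxe,
    h1.eventually (ContinuousLinearEquiv.isOpen.mem_nhds h)] with y hy hy'
  exact ⟨e, he, hy, hy'⟩

/-- The inverse function theorem in the chart provided by the hypothesis. -/
theorem IsLocalDiffeoPoint.exists_inverse (hW : IsOpen W)
    (hQ : ContMDiffOn (𝓡 2) 𝓘(ℝ, ℂ) ∞ Q W) {x : M} (hx : x ∈ W) (h : IsLocalDiffeoPoint Q x) :
    ∃ g : ℂ → M, ContMDiffAt 𝓘(ℝ, ℂ) (𝓡 2) ∞ g (Q x) ∧ g (Q x) = x ∧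
      (∀ᶠ q in 𝓝 (Q x), Q (g q) = q) ∧ ∀ᶠ y in 𝓝 x, g (Q y) = y := by
  obtain ⟨e, he, hxe, T, hT⟩ := h
  have h1 := contDiffAt_comp_symm hW hQ he hxe hx
  have h2 : HasFDerivAt (fun y => Q (e.symm y)) (T : Plane →L[ℝ] ℂ) (e x) := by
    rw [hT]
    exact (h1.differentiableAt (by simp)).hasFDerivAt
  have h3 := h1.hasStrictFDerivAt' h2 (by simp)
  have h4 := h1.to_localInverse h2 (by simp)
  have h5 := h3.localInverse_apply_image
  have h6 := h3.eventually_right_inverse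
  have h7 := h3.eventually_left_inverse
  simp only [e.left_inv hxe] at h4 h5 h6
  have h8 : ContMDiffAt 𝓘(ℝ, Plane) (𝓡 2) ∞ e.symm (h3.localInverse _ _ _ (Q x)) := by
    rw [h5]
    exact (contMDiffOn_symm_of_mem_maximalAtlas he).contMDiffAt
      (e.open_target.mem_nhds (e.map_source hxe))
  refine ⟨fun q => e.symm (h3.localInverse _ _ _ q), h8.comp (Q x) h4.contMDiffAt, ?_, h6, ?_⟩
  · simp only [h5]
    exact e.left_inv hxe
  · filter_upwards [(e.continuousAt hxe).eventually h7, e.open_source.mem_nhds hxe] with y hy hye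
    rw [e.left_inv hye] at hy
    rw [hy, e.left_inv hye]

/-- A map that is injective on a compact set and locally injective at each of its points is
injective on a neighbourhood of it. The global inverse is smooth because it agrees locally with the
inverses from the inverse function theorem. -/
theorem exists_inverse_nhdsSet (hW : IsOpen W) (hQ : ContMDiffOn (𝓡 2) 𝓘(ℝ, ℂ) ∞ Q W) {K : Set M}
    (hK : IsCompact K) (hne : K.Nonempty)
    (hKW : K ⊆ W) (hinj : InjOn Q K)
    (hloc : ∀ x ∈ K, IsLocalDiffeoPoint Q x) :
    ∃ (V : Set ℂ) (P : ℂ → M), IsOpen V ∧ ContMDiffOn 𝓘(ℝ, ℂ) (𝓡 2) ∞ P V ∧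
      (∀ q ∈ V, P q ∈ W ∧ Q (P q) = q) ∧ ∀ x ∈ K, Q x ∈ V ∧ P (Q x) = x := by
  have hc : ∀ x ∈ W, ContinuousAt Q x := fun x hx =>
    hQ.continuousOn.continuousAt (hW.mem_nhds hx)
  obtain ⟨t, ht, hti⟩ := hinj.exists_mem_nhdsSet hK (fun x hx => hc x (hKW hx)) fun x hx => by
    obtain ⟨g, -, -, -, hg⟩ := (hloc x hx).exists_inverse hW hQ (hKW hx)
    refine ⟨_, hg, fun y hy z hz hyz => ?_⟩
    rw [← (show g (Q y) = y from hy), hyz]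
    exact hz
  obtain ⟨W', hW'o, hKW', hW'⟩ := mem_nhdsSet_iff_exists.1 (inter_mem
    (inter_mem ht (hW.mem_nhdsSet.2 hKW)) (mem_nhdsSet_iff_forall.2 fun x hx =>
      (hloc x hx).eventually hW hQ (hKW hx)))
  have hinj' : InjOn Q W' := hti.mono fun x hx => (hW' hx).1.1
  have : Nonempty M := hne.nonempty
  have hleft : ∀ x ∈ W', Function.invFunOn Q W' (Q x) = x := fun x hx => hinj'.leftInvOn_invFunOn hx
  have key : ∀ x ∈ W', ∃ g : ℂ → M, ContMDiffAt 𝓘(ℝ, ℂ) (𝓡 2) ∞ g (Q x) ∧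
      ∀ᶠ q in 𝓝 (Q x), g q ∈ W' ∧ Q (g q) = q := by
    intro x hx
    obtain ⟨g, hg, hgx, hgQ, -⟩ := IsLocalDiffeoPoint.exists_inverse hW hQ (hW' hx).1.2 (hW' hx).2
    exact ⟨g, hg, (hg.continuousAt.eventually
      (hW'o.mem_nhds (hgx.symm ▸ hx))).and hgQ⟩
  refine ⟨Q '' W', Function.invFunOn Q W', ?_, ?_, ?_, fun x hx =>
    ⟨mem_image_of_mem _ (hKW' hx), hleft x (hKW' hx)⟩⟩
  · refine isOpen_iff_mem_nhds.2 ?_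
    rintro _ ⟨x, hx, rfl⟩
    obtain ⟨g, -, hg⟩ := key x hx
    filter_upwards [hg] with q hq
    exact ⟨g q, hq⟩
  · rintro _ ⟨x, hx, rfl⟩
    obtain ⟨g, hgs, hg⟩ := key x hx
    refine (hgs.congr_of_eventuallyEq ?_).contMDiffWithinAt
    filter_upwards [hg] with q hq
    conv_lhs => rw [← hq.2]
    exact hleft _ hq.1
  · rintro _ ⟨x, hx, rfl⟩
    rw [hleft x hx]
    exact ⟨(hW' hx).1.2, rfl⟩

/-! ### Smooth approximation on the circle -/

/-- Trigonometric polynomials are uniformly dense; the real part of one of them is taken. -/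
theorem exists_contDiff_near (r : C(S1, ℝ)) {η : ℝ} (hη : 0 < η) :
    ∃ τ : C(S1, ℝ), ContDiff ℝ ∞ (fun t : ℝ => τ (t : S1)) ∧ ∀ x, |τ x - r x| < η := by
  let r' : C(S1, ℂ) := ⟨fun x => (r x : ℂ), Complex.continuous_ofReal.comp r.continuous⟩
  have h1 : r' ∈ closure (Submodule.span ℂ (range (@fourier (1 : ℝ))) : Set C(S1, ℂ)) := by
    rw [← Submodule.topologicalClosure_coe, span_fourier_closure_eq_top]
    trivial
  obtain ⟨f, hf, hfr⟩ := Metric.mem_closure_iff.1 h1 η hη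
  have h2 : ContDiff ℝ ∞ (fun t : ℝ => f (t : S1)) := by
    refine Submodule.span_induction (p := fun f _ => ContDiff ℝ ∞ (fun t : ℝ => f (t : S1)))
      ?_ ?_ ?_ ?_ hf
    · rintro _ ⟨n, rfl⟩
      simp only [fourier_coe_apply]
      exact ((((contDiff_const.mul Complex.ofRealCLM.contDiff)).div_const _)).cexp
    · exact contDiff_const
    · exact fun f g _ _ hf hg => hf.add hg
    · exact fun c f _ hf => contDiff_const.mul hf
  refine ⟨⟨fun x => (f x).re, Complex.continuous_re.comp f.continuous⟩,
    Complex.reCLM.contDiff.comp h2, fun x => ?_⟩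
  have h3 := (ContinuousMap.dist_apply_le_dist (f := r') (g := f) x).trans_lt hfr
  rw [dist_comm, Complex.dist_eq] at h3
  have h4 := Complex.abs_re_le_norm (f x - r' x)
  rw [Complex.sub_re] at h4
  exact h4.trans_lt h3

/-! ### The polar coordinate -/

namespace AngleMap

variable {k : ℕ} {v : S1 → M} (Z : AngleMap k v) {ρ : M → ℝ}

/-- The function with angle `Z` and modulus `exp ρ`. -/
def polar (ρ : M → ℝ) (x : M) : ℂ := Real.exp (ρ x) • Z.Z x

theorem contMDiffOn_polar (hWO : W ⊆ Z.O) (hρ : ContMDiffOn (𝓡 2) 𝓘(ℝ, ℝ) ∞ ρ W) :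
    ContMDiffOn (𝓡 2) 𝓘(ℝ, ℂ) ∞ (Z.polar ρ) W :=
  (Real.contDiff_exp.contMDiff.comp_contMDiffOn hρ).smul (Z.smooth.mono hWO)

theorem norm_polar {x : M} (hx : x ∈ Z.O) : ‖Z.polar ρ x‖ = Real.exp (ρ x) := by
  rw [polar, norm_smul, Z.norm_eq x hx, mul_one, Real.norm_eq_abs, Real.abs_exp]

theorem polar_eq {x y : M} (hx : x ∈ Z.O) (hy : y ∈ Z.O) (h : Z.polar ρ x = Z.polar ρ y) :
    Z.Z x = Z.Z y := by
  have h1 : Real.exp (ρ x) = Real.exp (ρ y) := by rw [← Z.norm_polar hx, ← Z.norm_polar hy, h]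
  rw [polar, polar, h1] at h
  exact smul_right_injective ℂ (Real.exp_pos _).ne' h

/-- The differential of exp(ρ) Z on w is exp(ρ) (dZ(w) + dρ(w) Z). As |Z| = 1, the two summands are
orthogonal, so both vanish if the sum does. -/
theorem isLocalDiffeoPoint_polar (hW : IsOpen W) (hWO : W ⊆ Z.O)
    (hρ : ContMDiffOn (𝓡 2) 𝓘(ℝ, ℝ) ∞ ρ W) {x : M} (hx : x ∈ W)
    {e : OpenPartialHomeomorph M Plane} (he : e ∈ IsManifold.maximalAtlas (𝓡 2) ∞ M)
    (hxe : x ∈ e.source) (h : ∀ w : Plane, fderiv ℝ (fun y => Z.Z (e.symm y)) (e x) w = 0 →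
      fderiv ℝ (fun y => ρ (e.symm y)) (e x) w = 0 → w = 0) :
    IsLocalDiffeoPoint (Z.polar ρ) x := by
  refine ⟨e, he, hxe, exists_equiv_of_injective fun w hw => ?_⟩
  have hZ := ((contDiffAt_comp_symm Z.isOpen Z.smooth he hxe
    (hWO hx)).differentiableAt (by simp)).hasFDerivAt
  have hR := ((contDiffAt_comp_symm hW hρ he hxe hx).differentiableAt (by simp)).hasFDerivAt
  have hQ := hR.exp.smul hZ
  have hQ' : fderiv ℝ (fun y => Z.polar ρ (e.symm y)) (e x) = _ := hQ.fderiv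
  rw [hQ'] at hw
  simp only [e.left_inv hxe] at hw
  have h1 : HasFDerivAt (fun y => ‖Z.Z (e.symm y)‖ ^ 2) (0 : Plane →L[ℝ] ℝ) (e x) := by
    refine (hasFDerivAt_const (1 : ℝ) (e x)).congr_of_eventuallyEq ?_
    filter_upwards [(e.isOpen_inter_preimage_symm Z.isOpen).mem_nhds
      (mem_target_inter hxe (hWO hx))] with y hy
    rw [Z.norm_eq _ hy.2, one_pow]
  have h2 : (2 : ℝ) * inner ℝ (Z.Z x) (fderiv ℝ (fun y => Z.Z (e.symm y)) (e x) w) = 0 := by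
    have h3 := congrArg (fun T : Plane →L[ℝ] ℝ => T w) (hZ.norm_sq.unique h1)
    simp only [e.left_inv hxe, smul_apply, ContinuousLinearMap.comp_apply, innerSL_apply_apply,
      zero_apply] at h3
    simpa only [nsmul_eq_mul, smul_eq_mul, Nat.cast_ofNat] using h3
  set a := fderiv ℝ (fun y => Z.Z (e.symm y)) (e x) w with ha
  set b := fderiv ℝ (fun y => ρ (e.symm y)) (e x) w with hb
  have h4 : Real.exp (ρ x) • a + (Real.exp (ρ x) * b) • Z.Z x = 0 := hw
  have h5 : a + b • Z.Z x = 0 := by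
    rw [mul_smul, ← smul_add] at h4
    exact (smul_eq_zero.1 h4).resolve_left (Real.exp_pos _).ne'
  have h6 : b = 0 := by
    have h7 := congrArg (fun q : ℂ => inner ℝ (Z.Z x) q) h5
    simp only [inner_add_right, inner_smul_right, real_inner_self_eq_norm_sq,
      Z.norm_eq x (hWO hx), inner_zero_right] at h7
    linarith
  have h8 : a = 0 := by rwa [h6, zero_smul, add_zero] at h5
  exact h w h8 h6

/-- Near the loop `v`, the surface is parametrized by an open subset of the plane. -/
theorem exists_inverse_polar (hM : IsOrientableSurface M) {Z : AngleMap (k + 1) v}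
    (hv : IsEmbeddedLoop (k + 2) v) :
    ∃ (W : Set M) (ρ : M → ℝ) (V : Set ℂ) (P : ℂ → M), IsOpen W ∧ (∀ x, v x ∈ W) ∧
      ContMDiffOn (𝓡 2) 𝓘(ℝ, ℝ) ∞ ρ W ∧ ContMDiffOn (𝓡 2) 𝓘(ℝ, ℂ) ∞ (Z.polar ρ) W ∧ IsOpen V ∧
      ContMDiffOn 𝓘(ℝ, ℂ) (𝓡 2) ∞ P V ∧ (∀ q ∈ V, P q ∈ W ∧ Z.polar ρ (P q) = q) ∧
      ∀ x, Z.polar ρ (v x) ∈ V ∧ P (Z.polar ρ (v x)) = v x := by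
  obtain ⟨W, ρ, hW, hWO, hvW, hρ, hloc⟩ := Z.exists_transverse hM hv
  have hQ := Z.contMDiffOn_polar hWO hρ
  have hinj : InjOn (Z.polar ρ) (range v) := by
    rintro _ ⟨x, rfl⟩ _ ⟨y, rfl⟩ h
    rw [Z.injective_comp (Z.polar_eq (hWO (hvW x)) (hWO (hvW y)) h)]
  have hloc' : ∀ y ∈ range v, IsLocalDiffeoPoint (Z.polar ρ) y := by
    rintro _ ⟨x, rfl⟩
    obtain ⟨e, he, hxe, h⟩ := hloc x
    exact Z.isLocalDiffeoPoint_polar hW hWO hρ (hvW x) he hxe h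
  obtain ⟨V, P, hV, hP, hVP, hPv⟩ := exists_inverse_nhdsSet hW hQ (isCompact_range hv.1.1)
    (range_nonempty v) (range_subset_iff.2 hvW) hinj hloc'
  exact ⟨W, ρ, V, P, hW, hvW, hρ, hQ, hV, hP, hVP, fun x => hPv _ (mem_range_self x)⟩

end AngleMap

/-! ### Polar coordinates in the plane -/

/-- The point of the plane with argument `2 π x` and modulus `exp s`. -/
def polarPoint (x : S1) (s : ℝ) : ℂ := Real.exp s • fourier (T := 1) 1 x

theorem polarPoint_coe (t s : ℝ) : polarPoint (t : S1) s = Real.exp s • circ t := by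
  rw [polarPoint, fourier_coe_apply, circ]
  congr 2
  push_cast
  ring

theorem polarPoint_injective {x y : S1} {s r : ℝ} (h : polarPoint x s = polarPoint y r) :
    x = y ∧ s = r := by
  induction x using QuotientAddGroup.induction_on with
  | H a =>
    induction y using QuotientAddGroup.induction_on with
    | H b =>
      change polarPoint (a : S1) s = polarPoint (b : S1) r at h
      rw [polarPoint_coe, polarPoint_coe] at h
      have h1 := congrArg norm h
      rw [norm_smul, norm_smul, norm_circ, norm_circ, Real.norm_eq_abs, Real.norm_eq_abs,
        Real.abs_exp, Real.abs_exp, mul_one, mul_one, Real.exp_eq_exp] at h1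
      rw [h1] at h
      exact ⟨circ_eq_circ_iff.1 (smul_right_injective ℂ (Real.exp_pos _).ne' h), h1⟩

theorem continuous_polarPoint : Continuous fun p : S1 × ℝ => polarPoint p.1 p.2 :=
  (Real.continuous_exp.comp continuous_snd).smul ((map_continuous _).comp continuous_fst)

variable {T : ℝ → ℝ}

theorem contDiff_polar (hT : ContDiff ℝ ∞ T) :
    ContDiff ℝ ∞ fun p : ℝ × ℝ => Real.exp (T p.1 + p.2) • circ p.1 :=
  (Real.contDiff_exp.comp ((hT.comp contDiff_fst).add contDiff_snd)).smul
    (contDiff_circ.comp contDiff_fst)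

theorem injective_fderiv_polar (hT : ContDiff ℝ ∞ T) (p : ℝ × ℝ) :
    Function.Injective (fderiv ℝ (fun p : ℝ × ℝ => Real.exp (T p.1 + p.2) • circ p.1) p) := by
  refine (injective_iff_map_eq_zero _).2 fun w hw => ?_
  have hd : HasDerivAt (fun r : ℝ => (p.1 + r * w.1, p.2 + r * w.2)) w 0 := by
    have h1 : ∀ a b : ℝ, HasDerivAt (fun r : ℝ => a + r * b) b 0 := fun a b => by
      simpa using ((hasDerivAt_id (0 : ℝ)).mul_const b).const_add a
    exact (h1 p.1 w.1).prodMk (h1 p.2 w.2)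
  have hTd : HasDerivAt T (deriv T p.1) p.1 := (hT.differentiable (by simp) _).hasDerivAt
  have h0 : (fun r : ℝ => (p.1 + r * w.1, p.2 + r * w.2)) 0 = p := by simp
  have h1 := (((contDiff_polar hT).differentiable (by simp) p).hasFDerivAt)
  rw [← h0] at h1
  have h2 := h1.comp_hasDerivAt (0 : ℝ) hd
  rw [h0, hw] at h2
  have h3 : HasDerivAt (fun r : ℝ => p.1 + r * w.1) w.1 0 := hd.fst
  have h4 : HasDerivAt (fun r : ℝ => p.2 + r * w.2) w.2 0 := hd.snd
  have h5 : p.1 + 0 * w.1 = p.1 := by ring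
  rw [← h5] at hTd
  have h6 := ((hTd.comp (0 : ℝ) h3).add h4).exp.smul (hasDerivAt_circ h3)
  have h7 := h6.unique h2
  simp only [Pi.add_apply, Function.comp_apply, zero_mul, add_zero] at h7
  set b := deriv T p.1 * w.1 + w.2 with hb
  set E := Real.exp (T p.1 + p.2) with hE
  -- The derivative is the logarithmic derivative times a nonzero number; its real and imaginary
  -- parts determine w.
  have h8 : (E : ℂ) * circ p.1 * ((b : ℂ) + ((2 * Real.pi * w.1 : ℝ) : ℂ) * Complex.I) = 0 := by
    rw [← h7]
    simp only [Complex.real_smul]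
    push_cast
    ring
  have h9 : (b : ℂ) + ((2 * Real.pi * w.1 : ℝ) : ℂ) * Complex.I = 0 :=
    (mul_eq_zero.1 h8).resolve_left (mul_ne_zero
      (Complex.ofReal_ne_zero.2 (Real.exp_pos _).ne') (circ_ne_zero _))
  have h10 : b = 0 := by simpa using congrArg Complex.re h9
  have h11 : w.1 = 0 := by
    have h12 : 2 * Real.pi * w.1 = 0 := by simpa using congrArg Complex.im h9
    exact (mul_eq_zero.1 h12).resolve_left Real.two_pi_pos.ne'
  have h13 : w.2 = 0 := by rwa [hb, h11, mul_zero, zero_add] at h10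
  exact Prod.ext h11 h13

/-- The annulus is a strip around the graph of τ in polar coordinates, carried to M by P. Since Q ∘
P is the identity, injectivity and immersivity reduce to those of polar coordinates. -/
theorem exists_annulus_of_inverse (hW : IsOpen W) (hQ : ContMDiffOn (𝓡 2) 𝓘(ℝ, ℂ) ∞ Q W)
    {V : Set ℂ} {P : ℂ → M} (hV : IsOpen V) (hP : ContMDiffOn 𝓘(ℝ, ℂ) (𝓡 2) ∞ P V)
    (hPQ : ∀ q ∈ V, P q ∈ W ∧ Q (P q) = q) {τ : C(S1, ℝ)}
    (hτ : ContDiff ℝ ∞ fun t : ℝ => τ (t : S1)) {ε : ℝ} (hε : 0 < ε)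
    (hτV : ∀ x s, |s| < ε → polarPoint x (τ x + s) ∈ V) :
    ∃ A : Annulus M, A.ε = ε ∧ ∀ x s, A.σ x s = P (polarPoint x (τ x + s)) := by
  have hfun : (fun p : ℝ × ℝ => P (polarPoint (p.1 : S1) (τ (p.1 : S1) + p.2))) =
      P ∘ fun p : ℝ × ℝ => Real.exp (τ (p.1 : S1) + p.2) • circ p.1 :=
    funext fun p => congrArg P (polarPoint_coe _ _)
  have hV' : ∀ p : ℝ × ℝ, |p.2| < ε → Real.exp (τ (p.1 : S1) + p.2) • circ p.1 ∈ V := fun p hp => by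
    rw [← polarPoint_coe]
    exact hτV _ _ hp
  have hsm : ∀ p : ℝ × ℝ, |p.2| < ε → ContMDiffAt 𝓘(ℝ, ℝ × ℝ) (𝓡 2) ∞
      (fun p : ℝ × ℝ => P (polarPoint (p.1 : S1) (τ (p.1 : S1) + p.2))) p := fun p hp => by
    rw [hfun]
    exact (hP.contMDiffAt (hV.mem_nhds (hV' p hp))).comp p (contDiff_polar hτ).contMDiff.contMDiffAt
  refine ⟨⟨ε, hε, fun x s => P (polarPoint x (τ x + s)), fun p hp => (hsm p hp).contMDiffWithinAt,
    fun x y s r hs hr h => ?_, fun p hp => ?_⟩, rfl, fun x s => rfl⟩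
  · have h1 := congrArg Q h
    rw [(hPQ _ (hτV x s hs)).2, (hPQ _ (hτV y r hr)).2] at h1
    obtain ⟨rfl, h2⟩ := polarPoint_injective h1
    exact ⟨rfl, add_left_cancel h2⟩
  · have hmem := hPQ _ (hτV (p.1 : S1) p.2 hp)
    have h1 : MDifferentiableAt (𝓡 2) 𝓘(ℝ, ℂ) Q (P (polarPoint (p.1 : S1) (τ (p.1 : S1) + p.2))) :=
      (hQ.contMDiffAt (hW.mem_nhds hmem.1)).mdifferentiableAt (by simp)
    have h2 := mfderiv_comp p h1 ((hsm p hp).mdifferentiableAt (by simp))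
    have h3 : Q ∘ (fun p : ℝ × ℝ => P (polarPoint (p.1 : S1) (τ (p.1 : S1) + p.2))) =ᶠ[𝓝 p]
        fun p : ℝ × ℝ => Real.exp (τ (p.1 : S1) + p.2) • circ p.1 := by
      filter_upwards [(isOpen_lt continuous_snd.abs continuous_const).mem_nhds hp] with q hq
      rw [Function.comp_apply, (hPQ _ (hτV (q.1 : S1) q.2 hq)).2, polarPoint_coe]
    rw [h3.mfderiv_eq, mfderiv_eq_fderiv] at h2
    have h4 := injective_fderiv_polar hτ p
    rw [h2] at h4
    exact Function.Injective.of_comp (f := mfderiv (𝓡 2) 𝓘(ℝ, ℂ) Q _) h4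

/-- In polar coordinates the loop, parametrized by its angle, is the graph of r = ρ ∘ v ∘ ψ⁻¹. A
strip centred at r would not be smooth, so it is centred at a smooth τ₀ near r, and τ = r - τ₀
inherits the full Sobolev class of v. -/
theorem exists_annulus [T2Space M] [SecondCountableTopology M] (hM : IsOrientableSurface M) {k : ℕ}
    {v : S1 → M} (hv : IsEmbeddedLoop (k + 2) v) :
    ∃ (A : Annulus M) (τ : Sob (k + 2)) (ψ : S1 ≃ₜ S1),
      (∀ x, |τ.fn x| < A.ε) ∧ IsReparam 2 ψ ∧ v = A.graph τ.fn ∘ ψ := by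
  obtain ⟨Z⟩ := hv.nonempty_angleMap
  obtain ⟨W, ρ, V, P, hW, hvW, hρ, hQ, hV, hP, hVP, hPv⟩ := Z.exists_inverse_polar hM hv
  obtain ⟨ψ, ξ, hξc, hξ, hξ', hψ, hψ'⟩ := Z.exists_homeomorph
  let r : C(S1, ℝ) := ⟨fun x => ρ (v (ψ.symm x)),
    hρ.continuousOn.comp_continuous (hv.1.1.comp ψ.symm.continuous) fun x => hvW _⟩
  have hr : ∀ x, Z.polar ρ (v (ψ.symm x)) = polarPoint x (r x) := by
    intro x
    induction x using QuotientAddGroup.induction_on with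
    | H a =>
      change Real.exp (ρ (v (ψ.symm (a : S1)))) • Z.Z (v (ψ.symm (a : S1))) = _
      rw [polarPoint_coe, hψ', Z.map_eq, hξ, ← hψ']
      rfl
  obtain ⟨u, w, -, hw, hu, h0, huw⟩ := generalized_tube_lemma (isCompact_univ (X := S1))
    (isCompact_singleton (x := (0 : ℝ)))
    (hV.preimage (continuous_polarPoint.comp (continuous_fst.prodMk
      ((r.continuous.comp continuous_fst).add continuous_snd)))) (by
        rintro ⟨x, s⟩ ⟨-, hs⟩
        change polarPoint x (r x + s) ∈ V
        rw [show s = 0 from hs, add_zero, ← hr]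
        exact (hPv _).1)
  obtain ⟨η, hη, hball⟩ := Metric.isOpen_iff.1 hw 0 (h0 rfl)
  have hrV : ∀ x s, |s| < η → polarPoint x (r x + s) ∈ V := fun x s hs =>
    huw (show (x, s) ∈ u ×ˢ w from ⟨hu (mem_univ x), hball (by simpa using hs)⟩)
  -- One half of η pays for the distance between r and τ₀, the other is the width of the annulus.
  -- The same bound puts r - τ₀ into the domain of the chart.
  obtain ⟨τ₀, hτ₀, hr₀⟩ := exists_contDiff_near r (half_pos hη)
  obtain ⟨A, hA, hσ⟩ := exists_annulus_of_inverse hW hQ hV hP hVP hτ₀ (half_pos hη) fun x s hs => by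
    have h1 := hrV x (τ₀ x - r x + s) ((abs_add_le _ _).trans_lt (by linarith [hr₀ x]))
    rwa [← add_assoc, add_sub_cancel] at h1
  have hpos := Z.deriv_pos
  have hξd : ∀ x, HasDerivAt ξ (deriv Z.Ψ (ξ x))⁻¹ x := fun x =>
    HasDerivAt.of_local_left_inverse hξc.continuousAt (Z.hasDerivAt (ξ x)) (hpos _).ne'
      (Eventually.of_forall hξ)
  have hrH : ∀ t, HAt (k + 1) (fun t : ℝ => r (t : S1) - τ₀ (t : S1)) t := by
    intro t
    have h1 : HAt (k + 1) (fun s : ℝ => ρ (v (s : S1))) (ξ t) :=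
      hv.1.hAt_comp (hρ.contMDiffAt (hW.mem_nhds (hvW _)))
    have h2 := HAt.comp_diffeo hξd ((Z.continuous_deriv.comp hξc).inv₀ fun x => (hpos _).ne')
      (fun x => inv_pos.2 (hpos _))
      (HAt.inverse Z.hasDerivAt Z.continuous_deriv hpos hξc hξ Z.hAt) h1
    refine (h2.congr (Eventually.of_forall fun s => ?_)).sub
      (HAt.of_contDiffAt (contDiffAt_infty.1 hτ₀.contDiffAt _))
    exact congrArg (fun x => ρ (v x)) (hψ' s).symm
  obtain ⟨τ, hτ⟩ := Sob.exists_of_hAt (fun t => by simp only [AddCircle.coe_add_period]) hrH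
  have hτ' : ∀ x, τ.fn x = r x - τ₀ x := fun x => by
    induction x using QuotientAddGroup.induction_on with
    | H a => exact hτ a
  refine ⟨A, τ, ψ, fun x => ?_, ⟨Z.Ψ, Z.continuous, fun t => (hψ t).symm,
    isSobolevOn_of_forall_hAt fun t => (Z.hAt t).of_le (by omega), fun t => (hpos t).ne'⟩, ?_⟩
  · rw [hτ', hA, abs_sub_comm]
    exact hr₀ x
  · funext x
    change v x = A.σ (ψ x) (τ.fn (ψ x))
    rw [hσ, hτ', add_sub_cancel, ← hr, ψ.symm_apply_apply]
    exact (hPv x).2.symm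

end LengthFunctional
end

/-! ### Charts at every loop; critical points are geodesics -/

noncomputable section
namespace LengthFunctional

variable {M : Type*} [TopologicalSpace M] [T2Space M] [SecondCountableTopology M]
    [ChartedSpace Plane M] [IsManifold (𝓡 2) ∞ M]

theorem exists_annulus_of_isParamBy (hM : IsOrientableSurface M) {k : ℕ} {x : UnparamLoop M}
    {v : S1 → M} (hv : IsEmbeddedLoop (k + 2) v) (hx : x.IsParamBy v) :
    ∃ (A : Annulus M) (τ : Sob (k + 2)), (∀ x, |τ.fn x| < A.ε) ∧
      (IsEmbeddedLoop 2 (A.graph τ.fn) → x.IsParamBy (A.graph τ.fn)) := by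
  obtain ⟨A, τ, ψ, hτ, hψ, hv⟩ := exists_annulus hM hv
  obtain ⟨hv', rfl⟩ := hx
  exact ⟨A, τ, hτ, fun h => ⟨h, Quot.sound ⟨ψ, hψ, hv⟩⟩⟩

theorem chartsCover (hM : IsOrientableSurface M) : ChartsCover M := by
  refine ⟨fun A τ hτ => A.isEmbeddedLoop_graph τ hτ, fun x => ?_⟩
  obtain ⟨⟨v, hv⟩, rfl⟩ := Quot.exists_rep x
  obtain ⟨A, τ, hτ, h⟩ := exists_annulus_of_isParamBy hM (k := 0) hv ⟨hv, rfl⟩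
  exact ⟨A, τ, hτ, h (A.isEmbeddedLoop_graph τ hτ)⟩

theorem isEmbeddedGeodesic_of_isCriticalPoint (hM : IsOrientableSurface M) (g : RiemMetric M)
    {x : UnparamLoop M} (hx : IsCriticalPoint (UnparamLoop.length g) x) :
    IsEmbeddedGeodesic g x := by
  -- The level 1 condition supplies a parametrization of class W^{3,2}, hence a chart in which τ
  -- lies in W^{3,2}, where the first variation can be integrated by parts.
  obtain ⟨v, hv, hxv⟩ := hx.1
  obtain ⟨A, τ, hτ, h⟩ := exists_annulus_of_isParamBy hM (k := 1) hv hxv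
  exact Annulus.isEmbeddedGeodesic_of_isCriticalPoint g hτ
    (h (A.isEmbeddedLoop_graph (Sob.incl 2 τ) hτ)) hx

end LengthFunctional
end

theorem mainTheorem9 {M : Type*} [TopologicalSpace M] [T2Space M] [SecondCountableTopology M]
    [ChartedSpace Plane M] [IsManifold (𝓡 2) ∞ M] (hM : IsOrientableSurface M)
    (g : RiemMetric M) :
    -- the charts, in which sc-smoothness is tested, are defined on all of their domains
    -- and cover `E(M)`
    ChartsCover M ∧
    -- the length functional is sc-smooth
    IsScSmooth (UnparamLoop.length g) ∧
    -- its differential at a point of level `1`, in any chart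
    (∀ (A : Annulus M) (τ : sobScale.X 1), sobScale.incl 0 τ ∈ A.domain →
      ∃ D : sobScale.X 0 →L[ℝ] ℝ,
        ScScale.HasScDifferentialAt sobScale ScScale.real
          (A.inChart (UnparamLoop.length g)) D τ ∧
        -- in an arbitrary parametrization `v = u_τ ∘ ψ`
        (∀ ψ : S1 ≃ₜ S1, IsReparam 2 ψ → ∀ h : sobScale.X 0,
          D h = ∫ t in (0 : ℝ)..1, (1 / speed g (A.graph τ.fn ∘ ψ) t) *
            innerCovDeriv g (fun s : ℝ => (A.graph τ.fn ∘ ψ) (s : S1))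
              (A.field τ.fn h.fn ψ) t (velocity (A.graph τ.fn ∘ ψ) t)) ∧
        -- in a parametrization of constant speed, which exists
        (∃ ψ : S1 ≃ₜ S1, IsReparam 2 ψ ∧ ∃ ℓ : ℝ, ∀ t, speed g (A.graph τ.fn ∘ ψ) t = ℓ) ∧
        (∀ ψ : S1 ≃ₜ S1, IsReparam 2 ψ → (∃ ℓ : ℝ, ∀ t, speed g (A.graph τ.fn ∘ ψ) t = ℓ) →
          ∀ h : sobScale.X 0,
          D h = -∫ t in (0 : ℝ)..1, (1 / speed g (A.graph τ.fn ∘ ψ) t) *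
            innerCovDeriv g (fun s : ℝ => (A.graph τ.fn ∘ ψ) (s : S1))
              (velocity (A.graph τ.fn ∘ ψ)) t (A.field τ.fn h.fn ψ t))) ∧
    -- the critical points are exactly the embedded geodesics
    ∀ x : UnparamLoop M, IsCriticalPoint (UnparamLoop.length g) x ↔ IsEmbeddedGeodesic g x := by
  refine ⟨chartsCover hM, isScSmooth_length g, fun A τ hτ => ?_, fun x =>
    ⟨isEmbeddedGeodesic_of_isCriticalPoint hM g, isCriticalPoint_of_isEmbeddedGeodesic g⟩⟩
  obtain ⟨D, hD, hD'⟩ := Annulus.hasScDifferentialAt_length g hτ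
  refine ⟨D, hD, fun ψ hψ h => ?_, Annulus.exists_constantSpeed g hτ, fun ψ hψ hℓ h => ?_⟩
  · obtain ⟨Ψ, hΨ⟩ := hψ.exists_isDiffLift
    rw [hD', Annulus.integral_innerCovDeriv_field g hτ hΨ]
  · obtain ⟨Ψ, hΨ⟩ := hψ.exists_isDiffLift
    obtain ⟨ℓ, hℓ⟩ := hℓ
    rw [hD', Annulus.integral_innerCovDeriv_velocity g hτ hΨ hℓ, neg_neg]
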